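/- **Setting.** For $U=(u_1,\dots,u_n)\in\mathbb R^{d\times n}$, $z\in\mathbb R^n_{>0}$ and $S\subseteq[n]$ put $Z=\mathrm{diag}(z)$, $M_S=U_SZ_SU_S^{\top}=\sum_{j\in S}z_ju_ju_j^{\top}$, $M=M_{[n]}=UZU^{\top}$. For $T\subseteq[n]$ and $\alpha\ge 1$ the progress function is $$h(\alpha)=\sum_{j\in T}\ell_j\bigl(z\circ(1_{\overline T}+\alpha 1_T)\bigr)=\mathrm{tr}\bigl[\alpha M_T(M_{\overline T}+\alpha M_T)^{-1}\bigr],\qquad \ell_j(z)=z_ju_j^{\top}(UZU^{\top})^{-1}u_j .$$ An input $(U,z,T,\gamma)$ is *feasible* if $\mathrm{rk}(U)=d$, $z>0$, $0<\gamma\le 1$ and $\sup_{\alpha\ge1}h(\alpha)\ge h(1)+\gamma$. Let $\mu_1,\dots,\mu_d\in[0,1]$ be the eigenvalues of $M^{-1}M_T$ and $\mu_s=\sum_{i:\mu_i<1/2}\mu_i$. **Algorithms.** They run in the real model: one unit of time per exact arithmetic operation $+,-,\times,\div$, per comparison of two numbers, and per loading of a constant $0$ or $1$. Determinants, inverses and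 the rank of $M_T$ are computed from the characteristic polynomial by the Faddeev–LeVerrier recursion. *Update*$(U,z,T,\gamma)$: if $h'(1)\ge\gamma/4$ let $\alpha_0=1$; otherwise let $\alpha_0=1+\gamma/(2\tilde\mu)$ with $\tilde\mu$ the output of *Approx-Small-Eigen-Sum*$(U,z,T)$. Then perform the Newton–Dinkelbach method for $h$ from $\alpha_0$ with lower target $b'=h(1)+\gamma/5$ and upper target $b=h(1)+\gamma$: while $h(\alpha_t)<b'$ put $\alpha_{t+1}=\alpha_t+(b-h(\alpha_t))/h'(\alpha_t)$. Output the final iterate $\hat\alpha$. *Approx-Small-Eigen-Sum*$(U,z,T)$: let $p$ be the integer nearest to $\tau=\mathrm{tr}[M_TM^{-1}]$. If $p=\mathrm{rk}(U_T)$ output $0$; else if $p=0$ output $\tau$. Otherwise let $K=U^{\top}M^{-1}UZ$. Starting with $D=\emptyset$, add $p$ times the $i\in T\setminus D$ maximizing $\det K_{D+i,D+i}$; then, as long as the maximum of $\det K_{D-i+j,D-i+j}$ over $i\in D$, $j\in T\setminus D$ exceeds $2\det K_{D,D}$, replace $D$ by a maximizing $D-i+j$. Output $\mathrm{tr}\bigl[(I_d-U_D(U_D^{\top}M^{-1}U_D)^{-1}U_D^{\top}M^{-1})\,M_TM^{-1}\bigr]$.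 **Theorem.** There are universal constants $C,k\in\mathbb N$ such that for every feasible input $(U,z,T,\gamma)$: 1. *Update* terminates without dividing by zero and outputs $\hat\alpha\ge 1$ with $$\frac{\gamma}{5}\le h(\hat\alpha)-h(1)\le\gamma .$$ 2. It is strongly polynomial: it executes at most $C(n+d)^k$ instructions of the real model (a bound independent of the sizes of the numbers and of $\gamma$). 3. It makes at most $C\log(nd)$ Newton–Dinkelbach iterations. 4. If $h'(1)\ge\gamma/4$, then $\alpha_0=1$. Otherwise $\alpha_0=1+\gamma/(2\tilde\mu)$, where the output $\tilde\mu$ of *Approx-Small-Eigen-Sum* satisfies $0<\mu_s\le\tilde\mu\le(1+8nd^2)\mu_s$. 5. Suppose moreover that the entries of $U$ and $z$ are rational numbers of bit length at most $b$. If $\gamma$ is too, then all numbers computed by *Update* before the first Newton–Dinkelbach iteration (while computing $\alpha_0,b',b$) are rational of bit length at most $C(n+d+b)^k$. And for all rational $\alpha\ge1$, $b'$, $b''$ of bit length at most $b$, one round of the Newton–Dinkelbach loop from the iterate $\alpha$, with lower target $b'$ and upper target $b''$, terminates without dividing by zero, and all numbers it computes are rational of bit length at most $C(n+d+b)^k$.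 -/

import Mathlib

open scoped Matrix

namespace FrameScaling

/-! ## Frames, leverage scores and the progress function -/

section Frames

variable {d n : ℕ}

/-- `U_S Z_S U_Sᵀ = ∑ j ∈ S, z_j u_j u_jᵀ`, where `u_j` are the columns of `U`. -/
def gram (U : Matrix (Fin d) (Fin n) ℝ) (z : Fin n → ℝ) (S : Finset (Fin n)) :
    Matrix (Fin d) (Fin d) ℝ :=
  U * Matrix.diagonal (fun j => if j ∈ S then z j else 0) * Uᵀ

/-- The leverage score `z_j u_jᵀ (U Z Uᵀ)⁻¹ u_j`. -/
noncomputable def leverage (U : Matrix (Fin d) (Fin n) ℝ) (z : Fin n → ℝ) (j : Fin n) : ℝ :=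
  z j * (Uᵀ j ⬝ᵥ ((U * Matrix.diagonal z * Uᵀ)⁻¹ *ᵥ Uᵀ j))

/-- The scaling `z ∘ (1_{Tᶜ} + α 1_T)`. -/
def scaleUp (z : Fin n → ℝ) (T : Finset (Fin n)) (α : ℝ) : Fin n → ℝ :=
  fun j => if j ∈ T then α * z j else z j

/-- The progress function: the sum of the leverage scores in `T` after `T` is scaled up by `α`. -/
noncomputable def progress (U : Matrix (Fin d) (Fin n) ℝ) (z : Fin n → ℝ) (T : Finset (Fin n))
    (α : ℝ) : ℝ :=
  ∑ j ∈ T, leverage U (scaleUp z T α) j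

/-- The sum of the eigenvalues smaller than `1/2`, with algebraic multiplicity, of
`(U Z Uᵀ)⁻¹ U_T Z_T U_Tᵀ`. -/
noncomputable def smallEigenSum (U : Matrix (Fin d) (Fin n) ℝ) (z : Fin n → ℝ)
    (T : Finset (Fin n)) : ℝ := by
  classical
  exact ((((U * Matrix.diagonal z * Uᵀ)⁻¹ * gram U z T).charpoly.roots).filter
    (fun μ => μ < 1 / 2)).sum

/-- Feasible input: a full row rank frame, a positive scaling, and a margin `γ ∈ (0, 1]` such that
`sup_{α ≥ 1} h(α) ≥ h(1) + γ`. -/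
structure Feasible (U : Matrix (Fin d) (Fin n) ℝ) (z : Fin n → ℝ) (T : Finset (Fin n))
    (γ : ℝ) : Prop where
  rank_eq : U.rank = d
  scaling_pos : ∀ j, 0 < z j
  margin_pos : 0 < γ
  margin_le : γ ≤ 1
  progress_sup : progress U z T 1 + γ ≤ sSup (progress U z T '' Set.Ici 1)

end Frames

/-! ## Programs over the real model of computation

A program of type `Prog R α` computes an `α` using numbers from `R`. It is written for an arbitrary
type `R` without any structure, so numbers can be produced and inspected only by the instructions. -/

inductive Arith where
  | add
  | sub
  | mul
  | div

noncomputable def Arith.eval : Arith → ℝ → ℝ → ℝ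
  | .add, x, y => x + y
  | .sub, x, y => x - y
  | .mul, x, y => x * y
  | .div, x, y => x / y

inductive Prog (R : Type) : Type → Type 1 where
  | ret {α : Type} (a : α) : Prog R α
  | seq {α β : Type} (p : Prog R β) (f : β → Prog R α) : Prog R α
  | zero : Prog R R
  | one : Prog R R
  | arith (o : Arith) (x y : R) : Prog R R
  | lt (x y : R) : Prog R Bool
  /-- Repeat `body` from state `s` until it exits (`Sum.inr`) with a result. -/
  | loop {σ α : Type} (body : σ → Prog R (σ ⊕ α)) (s : σ) : Prog R α

instance (R : Type) : Monad (Prog R) where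
  pure := Prog.ret
  bind := Prog.seq

/-- Terminating runs of a loop whose body has the runs described by `step`. -/
inductive LoopRuns {σ α : Type} (step : σ → σ ⊕ α → ℕ → List ℝ → Prop) :
    σ → α → ℕ → List ℝ → Prop where
  | exit {s : σ} {a : α} {t : ℕ} {vs : List ℝ} (h : step s (Sum.inr a) t vs) :
      LoopRuns step s a t vs
  | next {s s' : σ} {a : α} {t₁ t₂ : ℕ} {vs₁ vs₂ : List ℝ} (h : step s (Sum.inl s') t₁ vs₁)
      (h' : LoopRuns step s' a t₂ vs₂) : LoopRuns step s a (t₁ + t₂) (vs₁ ++ vs₂)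

/-- `Runs p a t vs`: executed with exact real arithmetic, the program `p` terminates without ever
dividing by zero, returns `a`, executes `t` instructions (arithmetic operations, comparisons and
loading of the constants `0`, `1`), and `vs` lists all the numbers it computes on the way. -/
def Runs : {α : Type} → Prog ℝ α → α → ℕ → List ℝ → Prop
  | _, .ret a, r, t, vs => r = a ∧ t = 0 ∧ vs = []
  | _, .seq p f, r, t, vs => ∃ b t₁ vs₁ t₂ vs₂,
      Runs p b t₁ vs₁ ∧ Runs (f b) r t₂ vs₂ ∧ t = t₁ + t₂ ∧ vs = vs₁ ++ vs₂
  | _, .zero, r, t, vs => r = 0 ∧ t = 1 ∧ vs = [r]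
  | _, .one, r, t, vs => r = 1 ∧ t = 1 ∧ vs = [r]
  | _, .arith o x y, r, t, vs =>
      (o = Arith.div → y ≠ 0) ∧ r = o.eval x y ∧ t = 1 ∧ vs = [r]
  | _, .lt x y, r, t, vs => (r = true ↔ x < y) ∧ t = 1 ∧ vs = []
  | _, .loop body s, r, t, vs => LoopRuns (fun s' => Runs (body s')) s r t vs

theorem LoopRuns.unique {σ α : Type} {step : σ → σ ⊕ α → ℕ → List ℝ → Prop}
    (hstep : ∀ {s r r' t t' vs vs'}, step s r t vs → step s r' t' vs' →
      r = r' ∧ t = t' ∧ vs = vs')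
    {s : σ} {a a' : α} {t t' : ℕ} {vs vs' : List ℝ}
    (h : LoopRuns step s a t vs) (h' : LoopRuns step s a' t' vs') :
    a = a' ∧ t = t' ∧ vs = vs' := by
  induction h generalizing a' t' vs' with
  | exit h₁ =>
    cases h' with
    | exit h₂ => simpa using hstep h₁ h₂
    | next h₂ _ => simpa using (hstep h₁ h₂).1
  | next h₁ _ ih =>
    cases h' with
    | exit h₂ => simpa using (hstep h₁ h₂).1
    | next h₂ h₃ =>
      obtain ⟨hs, rfl, rfl⟩ := hstep h₁ h₂
      cases hs
      obtain ⟨rfl, rfl, rfl⟩ := ih h₃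
      exact ⟨rfl, rfl, rfl⟩

/-- Programs are deterministic. -/
theorem Runs.unique {α : Type} {p : Prog ℝ α} {a a' : α} {t t' : ℕ} {vs vs' : List ℝ}
    (h : Runs p a t vs) (h' : Runs p a' t' vs') : a = a' ∧ t = t' ∧ vs = vs' := by
  induction p generalizing t t' vs vs' with
  | ret b =>
    obtain ⟨rfl, rfl, rfl⟩ := h
    obtain ⟨rfl, rfl, rfl⟩ := h'
    exact ⟨rfl, rfl, rfl⟩
  | seq p f ihp ihf =>
    obtain ⟨b, t₁, v₁, t₂, v₂, h₁, h₂, rfl, rfl⟩ := h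
    obtain ⟨b', t₁', v₁', t₂', v₂', h₁', h₂', rfl, rfl⟩ := h'
    obtain ⟨rfl, rfl, rfl⟩ := ihp h₁ h₁'
    obtain ⟨rfl, rfl, rfl⟩ := ihf _ h₂ h₂'
    exact ⟨rfl, rfl, rfl⟩
  | zero =>
    obtain ⟨rfl, rfl, rfl⟩ := h
    obtain ⟨rfl, rfl, rfl⟩ := h'
    exact ⟨rfl, rfl, rfl⟩
  | one =>
    obtain ⟨rfl, rfl, rfl⟩ := h
    obtain ⟨rfl, rfl, rfl⟩ := h'
    exact ⟨rfl, rfl, rfl⟩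
  | arith o x y =>
    obtain ⟨_, rfl, rfl, rfl⟩ := h
    obtain ⟨_, rfl, rfl, rfl⟩ := h'
    exact ⟨rfl, rfl, rfl⟩
  | lt x y =>
    obtain ⟨h₁, rfl, rfl⟩ := h
    obtain ⟨h₂, rfl, rfl⟩ := h'
    exact ⟨Bool.eq_iff_iff.2 (h₁.trans h₂.symm), rfl, rfl⟩
  | loop body s ih =>
    exact LoopRuns.unique (step := fun s' => Runs (body s')) (fun h₁ h₂ => ih _ h₁ h₂) h h'

/-- The number of bits of a rational number written as a reduced fraction with a sign. -/
def bitLength (q : ℚ) : ℕ := 1 + q.num.natAbs.size + q.den.size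

/-- `x` is a rational number of bit length at most `b`. -/
def HasBits (b : ℕ) (x : ℝ) : Prop := ∃ q : ℚ, (q : ℝ) = x ∧ bitLength q ≤ b

/-! ## Linear algebra in the real model -/

section Programs

variable {R : Type}

def tabulate {β : Type} : (m : ℕ) → (Fin m → Prog R β) → Prog R (Fin m → β)
  | 0, _ => pure Fin.elim0
  | m + 1, f => do
      let x ← f 0
      let xs ← tabulate m (fun i => f i.succ)
      pure (Fin.cons x xs)

def tabulate₂ (l m : ℕ) (f : Fin l → Fin m → Prog R R) : Prog R (Fin l → Fin m → R) :=
  tabulate l (fun i => tabulate m (f i))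

def sumOver {ι : Type} (f : ι → Prog R R) : List ι → Prog R R
  | [] => .zero
  | i :: l => do
      let x ← f i
      let s ← sumOver f l
      .arith .add x s

/-- The first maximizer of `f` on a list together with the maximal value
(`none` for the empty list). -/
def argmax {ι : Type} (f : ι → Prog R R) : List ι → Prog R (Option (ι × R))
  | [] => pure none
  | i :: l => do
      let x ← f i
      match ← argmax f l with
      | none => pure (some (i, x))
      | some (j, y) => do
          if ← .lt x y then pure (some (j, y)) else pure (some (i, x))

def isZero (x : R) : Prog R Bool := do
  let o ← .zero
  let neg ← .lt x o
  let pos ← .lt o x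
  pure (!neg && !pos)

def matMul {l m q : ℕ} (A : Fin l → Fin m → R) (B : Fin m → Fin q → R) :
    Prog R (Fin l → Fin q → R) :=
  tabulate₂ l q (fun i j => sumOver (fun k => .arith .mul (A i k) (B k j)) (List.finRange m))

def matTrace {m : ℕ} (A : Fin m → Fin m → R) : Prog R R :=
  sumOver (fun i => pure (A i i)) (List.finRange m)

/-- State of the Faddeev–LeVerrier recursion for an `m × m` matrix `A` after `k` steps:
`c` is the coefficient of `λ^(m-k)` in the characteristic polynomial `det (λ I - A)`,
`B = A^(k-1) + c₁ A^(k-2) + ⋯ + c_(k-1) I`, and `idx` is the number `k`. -/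
structure FLState (R : Type) (m : ℕ) where
  B : Fin m → Fin m → R
  c : R
  idx : R

def flInit (m : ℕ) : Prog R (FLState R m) := do
  let o ← .zero
  let e ← .one
  pure { B := fun _ _ => o, c := e, idx := o }

/-- `B ↦ A B + c I`, then `c ↦ - tr (A B) / k`. -/
def flStep {m : ℕ} (A : Fin m → Fin m → R) (s : FLState R m) : Prog R (FLState R m) := do
  let P ← matMul A s.B
  let B ← tabulate₂ m m (fun i j => if i = j then .arith .add (P i j) s.c else pure (P i j))
  let Q ← matMul A B
  let t ← matTrace Q
  let e ← .one
  let idx ← .arith .add s.idx e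
  let q ← .arith .div t idx
  let o ← .zero
  let c ← .arith .sub o q
  pure { B := B, c := c, idx := idx }

def flSteps {m : ℕ} (A : Fin m → Fin m → R) : ℕ → Prog R (FLState R m)
  | 0 => flInit m
  | k + 1 => do
      let s ← flSteps A k
      flStep A s

def matDet {m : ℕ} (A : Fin m → Fin m → R) : Prog R R := do
  let s ← flSteps A m
  if m % 2 = 0 then pure s.c
  else do
    let o ← .zero
    .arith .sub o s.c

/-- The inverse `- B / c` (after `m` steps) of an invertible matrix. -/
def matInv {m : ℕ} (A : Fin m → Fin m → R) : Prog R (Fin m → Fin m → R) := do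
  let s ← flSteps A m
  let o ← .zero
  tabulate₂ m m (fun i j => do
    let q ← .arith .div (s.B i j) s.c
    .arith .sub o q)

/-- The largest `k` for which the coefficient of `λ^(m-k)` in the characteristic polynomial is
nonzero; this is the rank if `A` is symmetric. -/
def symRank {m : ℕ} (A : Fin m → Fin m → R) : Prog R ℕ := do
  let s ← flInit m
  let rec go : ℕ → ℕ → ℕ → FLState R m → Prog R ℕ
    | 0, _, r, _ => pure r
    | fuel + 1, k, r, s => do
        let s' ← flStep A s
        if ← isZero s'.c then go fuel (k + 1) r s' else go fuel (k + 1) (k + 1) s'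
  go m 0 0 s

/-- The integer in `{0, …, m}` nearest to `x`, by comparison with `1/2`, `3/2`, … -/
def nearestUpTo (x : R) (m : ℕ) : Prog R ℕ := do
  let e ← .one
  let two ← .arith .add e e
  let half ← .arith .div e two
  let rec go : ℕ → ℕ → R → Prog R ℕ
    | 0, k, _ => pure k
    | fuel + 1, k, threshold => do
        if ← .lt x threshold then pure k
        else do
          let threshold' ← .arith .add threshold e
          go fuel (k + 1) threshold'
  go m 0 half

/-! ## The algorithms -/

variable {d n : ℕ}

/-- `U_S Z_S U_Sᵀ` -/
def gramProg (U : Fin d → Fin n → R) (z : Fin n → R) (S : Finset (Fin n)) :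
    Prog R (Fin d → Fin d → R) :=
  tabulate₂ d d (fun a b => sumOver (fun j => do
    let x ← .arith .mul (U a j) (z j)
    .arith .mul x (U b j)) ((List.finRange n).filter (· ∈ S)))

/-- The data for evaluating `h` and `h'` at `α`: the matrices `M_T`, `M_{Tᶜ}`
and `(M_{Tᶜ} + α M_T)⁻¹`, where `M_S = U_S Z_S U_Sᵀ`. -/
def evalData (U : Fin d → Fin n → R) (z : Fin n → R) (T : Finset (Fin n)) (α : R) :
    Prog R ((Fin d → Fin d → R) × (Fin d → Fin d → R) × (Fin d → Fin d → R)) := do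
  let MT ← gramProg U z T
  let MTc ← gramProg U z Tᶜ
  let A ← tabulate₂ d d (fun a b => do
    let x ← .arith .mul α (MT a b)
    .arith .add (MTc a b) x)
  let S ← matInv A
  pure (MT, MTc, S)

/-- `h(α) = tr [α M_T (M_{Tᶜ} + α M_T)⁻¹]` -/
def evalH (U : Fin d → Fin n → R) (z : Fin n → R) (T : Finset (Fin n)) (α : R) : Prog R R := do
  let (MT, _, S) ← evalData U z T α
  let X ← matMul MT S
  let t ← matTrace X
  .arith .mul α t

/-- `h'(α) = tr [M_T (M_{Tᶜ} + α M_T)⁻¹ M_{Tᶜ} (M_{Tᶜ} + α M_T)⁻¹]` -/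
def evalDerivH (U : Fin d → Fin n → R) (z : Fin n → R) (T : Finset (Fin n)) (α : R) :
    Prog R R := do
  let (MT, MTc, S) ← evalData U z T α
  let X ← matMul MT S
  let Y ← matMul MTc S
  let XY ← matMul X Y
  matTrace XY

/-- The determinant of the principal submatrix of `K` with index set `D`. -/
def subDet (K : Fin n → Fin n → R) (D : Finset (Fin n)) : Prog R R :=
  matDet (fun i j : Fin D.card => K (D.orderEmbOfFin rfl i) (D.orderEmbOfFin rfl j))

/-- Greedy phase: `p` times, add to the current set the element of `T` outside of it
that maximizes the subdeterminant. -/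
def greedy (K : Fin n → Fin n → R) (T : Finset (Fin n)) : ℕ → Prog R (Finset (Fin n))
  | 0 => pure ∅
  | p + 1 => do
      let G ← greedy K T p
      match ← argmax (fun i => subDet K (insert i G))
          ((List.finRange n).filter (· ∈ T \ G)) with
      | none => pure G
      | some (i, _) => pure (insert i G)

/-- One round of local search: find the exchange `D - i + j` with `i ∈ D`, `j ∈ T - D` of maximal
subdeterminant; perform it if this determinant exceeds twice that of `D`, else exit with `D`. -/
def localSearchStep (K : Fin n → Fin n → R) (T D : Finset (Fin n)) :
    Prog R (Finset (Fin n) ⊕ Finset (Fin n)) := do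
  let δ ← subDet K D
  match ← argmax (fun ij : Fin n × Fin n => subDet K (insert ij.2 (D.erase ij.1)))
      (((List.finRange n).filter (· ∈ D)).product ((List.finRange n).filter (· ∈ T \ D))) with
  | none => pure (Sum.inr D)
  | some (ij, δ') => do
      let δ₂ ← .arith .add δ δ
      if ← .lt δ₂ δ' then pure (Sum.inl (insert ij.2 (D.erase ij.1))) else pure (Sum.inr D)

/-- Greedy followed by local search for a large principal subdeterminant of size `p` of
`K = Uᵀ W U Z`, where `W` is to be `(U Z Uᵀ)⁻¹`. -/
def detLocalOpt (U : Fin d → Fin n → R) (z : Fin n → R) (W : Fin d → Fin d → R)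
    (T : Finset (Fin n)) (p : ℕ) : Prog R (Finset (Fin n)) := do
  let WU ← matMul W U
  let UWU ← matMul (fun j a => U a j) WU
  let K ← tabulate₂ n n (fun i j => .arith .mul (UWU i j) (z j))
  let G ← greedy K T p
  .loop (localSearchStep K T) G

/-- `tr [(I - U_D (U_Dᵀ W U_D)⁻¹ U_Dᵀ W) X]`, where `W` is to be `(U Z Uᵀ)⁻¹`
and `X` is to be `U_T Z_T U_Tᵀ (U Z Uᵀ)⁻¹`. -/
def projectedTrace (U : Fin d → Fin n → R) (W X : Fin d → Fin d → R) (D : Finset (Fin n)) :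
    Prog R R := do
  let UD : Fin d → Fin D.card → R := fun a i => U a (D.orderEmbOfFin rfl i)
  let UDt : Fin D.card → Fin d → R := fun i a => UD a i
  let UDtW ← matMul UDt W
  let G ← matMul UDtW UD
  let Ginv ← matInv G
  let UDG ← matMul UD Ginv
  let P ← matMul UDG UDtW
  let o ← .zero
  let e ← .one
  let Q ← tabulate₂ d d (fun a b => .arith .sub (if a = b then e else o) (P a b))
  let QX ← matMul Q X
  matTrace QX

/-- Approximation of the sum of the eigenvalues smaller than `1/2`
of `U_T Z_T U_Tᵀ (U Z Uᵀ)⁻¹`. -/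
def approxSmallEigenSum (U : Fin d → Fin n → R) (z : Fin n → R) (T : Finset (Fin n)) :
    Prog R R := do
  let M ← gramProg U z Finset.univ
  let W ← matInv M
  let MT ← gramProg U z T
  let X ← matMul MT W
  let τ ← matTrace X
  let p ← nearestUpTo τ d
  let r ← symRank MT
  if p = r then .zero
  else if p = 0 then pure τ
  else do
    let D ← detLocalOpt U z W T p
    projectedTrace U W X D

/-- One round of the Newton–Dinkelbach method for the function computed by `f` with derivative
computed by `f'`, lower target `lo` and upper target `hi`, from iterate `s.1` with counter `s.2`. -/
def ndStep (f f' : R → Prog R R) (lo hi : R) (s : R × ℕ) : Prog R ((R × ℕ) ⊕ (R × ℕ)) := do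
  let v ← f s.1
  if ← .lt v lo then do
    let g ← f' s.1
    let gap ← .arith .sub hi v
    let q ← .arith .div gap g
    let α ← .arith .add s.1 q
    pure (Sum.inl (α, s.2 + 1))
  else pure (Sum.inr s)

/-- The Newton–Dinkelbach method started from `α₀`; it returns the final iterate `α_t`
together with the number `t` of iterations. -/
def newtonDinkelbach (f f' : R → Prog R R) (α₀ lo hi : R) : Prog R (R × ℕ) :=
  .loop (ndStep f f' lo hi) (α₀, 0)

/-- What the Newton–Dinkelbach method is called with. -/
structure NDInput (R : Type) where
  start : R
  lo : R
  hi : R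

/-- The part of the update algorithm before the Newton–Dinkelbach iterations: the starting point is
`1` if `h'(1) ≥ γ/4` and `1 + γ/(2 μ)`, with `μ` the approximate small-eigenvalue sum, otherwise;
the targets are `h(1) + γ/5` and `h(1) + γ`. -/
def updateSetup (U : Fin d → Fin n → R) (z : Fin n → R) (T : Finset (Fin n)) (γ : R) :
    Prog R (NDInput R) := do
  let e ← .one
  let two ← .arith .add e e
  let four ← .arith .add two two
  let five ← .arith .add four e
  let slope ← evalDerivH U z T e
  let γ₄ ← .arith .div γ four
  let α₀ ←
    if ← .lt slope γ₄ then do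
      let μ ← approxSmallEigenSum U z T
      let μ₂ ← .arith .add μ μ
      let q ← .arith .div γ μ₂
      .arith .add e q
    else pure e
  let h₁ ← evalH U z T e
  let γ₅ ← .arith .div γ five
  let lo ← .arith .add h₁ γ₅
  let hi ← .arith .add h₁ γ
  pure { start := α₀, lo := lo, hi := hi }

/-- The output `value` of the update algorithm, recorded together with the starting point and the
number of iterations of the Newton–Dinkelbach method. -/
structure UpdateOutput (R : Type) where
  start : R
  iterations : ℕ
  value : R

/-- The update algorithm. -/
def update (U : Fin d → Fin n → R) (z : Fin n → R) (T : Finset (Fin n)) (γ : R) :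
    Prog R (UpdateOutput R) := do
  let s ← updateSetup U z T γ
  let (α, t) ← newtonDinkelbach (evalH U z T) (evalDerivH U z T) s.start s.lo s.hi
  pure { start := s.start, iterations := t, value := α }

end Programs

end FrameScaling

open FrameScaling

namespace FrameScaling

/-! ## The Faddeev–LeVerrier recursion -/

section FaddeevLeVerrier

open Polynomial

variable {R : Type*} [CommRing R] {m : ℕ}

/-! Since M_T and M are positive semidefinite and M is invertible, there is an invertible Q with M =
QᵀQ and M_T = Qᵀ diag(μ) Q (`exists_spectralData`). Hence h(α) = ∑ αμᵢ / (1 + (α-1)μᵢ) is a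
nondecreasing concave function of α, and the analysis of the method concerns only the numbers μᵢ in
[0, 1].

Newton–Dinkelbach: the tangent lies above h, so an iterate never passes the upper target
(`eigenProgress_newton_le`), and an iterate that is still below the lower target has at most a fifth
of the previous slope (`eigenSlope_newton_le`). If h'(1) ≥ γ/4, one step from 1 suffices. Otherwise
every μᵢ is close to 0 or 1; below the lower target the slope is at least 9/50 of the sum μ_s of the
small eigenvalues (`smallSum_le_eigenSlope`), while at 1 + γ/(2m) with m ≥ μ_s it is at most 2m
(`eigenSlope_start_le`). If m is within a polynomial factor of μ_s, logarithmically many divisions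
by five exhaust the gap.

Such an m comes from columns: let Y be the frame in the coordinates where M = I, so that the minors
of K are Gram determinants of Y. If P projects onto p of its columns, p being the number of
eigenvalues at least 1/2, then tr((I-P) diag μ) is at least μ_s (`smallSum_add_le_trace`) and at
most μ_s (1 + tr G⁻¹), where G is the Gram matrix of these columns (`trace_le_smallSum`). By
Cramer's rule the diagonal of G⁻¹ consists of ratios of minors, which local optimality bounds by 4n
(`principalMinor_erase_le`). Greedy choice gives a start from which local search, doubling a bounded
determinant each time, is short.

Cost: a program logic bounds instructions and sizes of numbers by powers of one parameter L. It is
run with a trivial size measure for correctness and instruction counts, and with fraction sizes for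
bit lengths. Only the Faddeev–LeVerrier recursion needs a global size argument: clear denominators,
bound the integral recursion and scale back (`IsSized.fl`). -/

theorem derivative_charpoly (A : Matrix (Fin m) (Fin m) R) :
    derivative A.charpoly = (Matrix.adjugate A.charmatrix).trace := by
  have hadj : ∀ i, Matrix.adjugate A.charmatrix i i
      = (A.charmatrix.updateCol i (Pi.single i 1)).det := by
    intro i
    rw [← Matrix.transpose_apply (Matrix.adjugate _), Matrix.adjugate_transpose,
      Matrix.adjugate_apply, Matrix.updateRow_transpose, Matrix.det_transpose]
  rw [Matrix.charpoly, Matrix.det_apply, derivative_sum, Matrix.trace]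
  simp only [Matrix.diag_apply, hadj]
  simp only [Matrix.det_apply]
  -- Both sides are now sums over a permutation σ and an index i. Replacing column i by a unit
  -- vector leaves the indicator of σ i = i, which is the derivative of the entry at (σ i, i).
  rw [Finset.sum_comm]
  refine Finset.sum_congr rfl fun σ _ => ?_
  rw [derivative_smul, derivative_prod_finset, Finset.smul_sum]
  refine Finset.sum_congr rfl fun i _ => ?_
  rw [← Finset.mul_prod_erase Finset.univ _ (Finset.mem_univ i)]
  congr 1
  rw [mul_comm]
  congr 1
  · by_cases h : σ i = i
    · simp [h]
    · simp [h]
  · refine Finset.prod_congr rfl fun j hj => ?_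
    rw [Matrix.updateCol_ne (Finset.ne_of_mem_erase hj)]

/-- The matrix coefficients of the adjugate of the characteristic matrix, the leading one first. -/
noncomputable def flMat (A : Matrix (Fin m) (Fin m) R) (k : ℕ) : Matrix (Fin m) (Fin m) R :=
  (matPolyEquiv (Matrix.adjugate A.charmatrix)).coeff (m - k)

/-- The coefficients of the characteristic polynomial, the leading one first. -/
noncomputable def flCoeff (A : Matrix (Fin m) (Fin m) R) (k : ℕ) : R := A.charpoly.coeff (m - k)

/-- The product of XI - A with its adjugate, read as a polynomial with matrix coefficients;
comparing coefficients turns it into the Faddeev–LeVerrier recursion. -/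
theorem adjugate_charmatrix_relation (A : Matrix (Fin m) (Fin m) R) :
    (X - C A) * matPolyEquiv (Matrix.adjugate A.charmatrix)
      = A.charpoly.map (algebraMap R (Matrix (Fin m) (Fin m) R)) := by
  rw [← Matrix.matPolyEquiv_charmatrix, ← map_mul, Matrix.mul_adjugate,
    matPolyEquiv_smul_one, Matrix.charpoly]

theorem coeff_adjugate_succ (A : Matrix (Fin m) (Fin m) R) (k : ℕ) :
    (matPolyEquiv (Matrix.adjugate A.charmatrix)).coeff k
      = A * (matPolyEquiv (Matrix.adjugate A.charmatrix)).coeff (k + 1)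
        + A.charpoly.coeff (k + 1) • (1 : Matrix (Fin m) (Fin m) R) := by
  have h := congrArg (fun p => p.coeff (k + 1)) (adjugate_charmatrix_relation A)
  simp only [sub_mul, coeff_sub, coeff_X_mul, coeff_C_mul, coeff_map] at h
  rw [sub_eq_iff_eq_add'] at h
  rw [h, Algebra.algebraMap_eq_smul_one]

theorem mul_coeff_adjugate_zero (A : Matrix (Fin m) (Fin m) R) :
    A * (matPolyEquiv (Matrix.adjugate A.charmatrix)).coeff 0
      = - A.charpoly.coeff 0 • (1 : Matrix (Fin m) (Fin m) R) := by
  have h := congrArg (fun p => p.coeff 0) (adjugate_charmatrix_relation A)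
  simp only [sub_mul, coeff_sub, mul_coeff_zero, coeff_X_zero, zero_mul, coeff_C_zero, coeff_map,
    zero_sub] at h
  rw [neg_smul, ← Algebra.algebraMap_eq_smul_one, ← h, neg_neg]

theorem trace_coeff_adjugate (A : Matrix (Fin m) (Fin m) R) (k : ℕ) :
    ((matPolyEquiv (Matrix.adjugate A.charmatrix)).coeff k).trace
      = A.charpoly.coeff (k + 1) * (k + 1) := by
  have h := congrArg (fun p => p.coeff k) (derivative_charpoly A)
  simp only [coeff_derivative] at h
  rw [h]
  simp [Matrix.trace, matPolyEquiv_coeff_apply]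

theorem charpoly_coeff_of_lt (A : Matrix (Fin m) (Fin m) R) {k : ℕ} (hk : m < k) :
    A.charpoly.coeff k = 0 := by
  nontriviality R
  apply coeff_eq_zero_of_natDegree_lt
  simpa using hk

theorem charpoly_coeff_card (A : Matrix (Fin m) (Fin m) R) : A.charpoly.coeff m = 1 := by
  nontriviality R
  have := A.charpoly_monic.coeff_natDegree
  simpa using this

/-- From degree m on, the scalar term of `coeff_adjugate_succ` vanishes, so each coefficient is A
times the next one; downward induction from the degree of the adjugate gives zero. -/
theorem coeff_adjugate_of_le (A : Matrix (Fin m) (Fin m) R) {k : ℕ} (hk : m ≤ k) :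
    (matPolyEquiv (Matrix.adjugate A.charmatrix)).coeff k = 0 := by
  set q := matPolyEquiv (Matrix.adjugate A.charmatrix) with hq
  have key : ∀ i j, m ≤ j → q.natDegree < j + i → q.coeff j = 0 := by
    intro i
    induction i with
    | zero => intro j _ h; exact coeff_eq_zero_of_natDegree_lt (by simpa using h)
    | succ i ih =>
      intro j hj h
      rw [hq, coeff_adjugate_succ, charpoly_coeff_of_lt A (by omega), ← hq,
        ih (j + 1) (by omega) (by omega)]
      simp
  exact key (q.natDegree + 1) k hk (by omega)

theorem flMat_zero (A : Matrix (Fin m) (Fin m) R) : flMat A 0 = 0 :=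
  coeff_adjugate_of_le A (by simp)

theorem flCoeff_zero (A : Matrix (Fin m) (Fin m) R) : flCoeff A 0 = 1 :=
  charpoly_coeff_card A

theorem flMat_succ (A : Matrix (Fin m) (Fin m) R) {k : ℕ} (hk : k < m) :
    flMat A (k + 1) = A * flMat A k + flCoeff A k • (1 : Matrix (Fin m) (Fin m) R) := by
  have := coeff_adjugate_succ A (m - (k + 1))
  rwa [show m - (k + 1) + 1 = m - k by omega] at this

/-- In the trace of the recursion, the identity matrix contributes m copies of the coefficient, and
Jacobi's formula `derivative_charpoly` accounts for m - (k + 1) of them. -/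
theorem trace_mul_flMat (A : Matrix (Fin m) (Fin m) R) {k : ℕ} (hk : k < m) :
    (A * flMat A (k + 1)).trace = - ((k + 1 : ℕ) : R) * flCoeff A (k + 1) := by
  unfold flMat flCoeff
  rcases Nat.exists_eq_add_of_lt hk with ⟨j, rfl⟩
  rw [show k + j + 1 - (k + 1) = j by omega]
  -- The last step has no lower adjugate coefficient; there the constant term of the adjugate
  -- identity is used.
  cases j with
  | zero =>
    rw [mul_coeff_adjugate_zero]
    simp only [neg_smul, Matrix.trace_neg, Matrix.trace_smul, Matrix.trace_one, Fintype.card_fin,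
      smul_eq_mul]
    push_cast
    ring
  | succ j =>
    have h := coeff_adjugate_succ A j
    rw [← sub_eq_iff_eq_add] at h
    rw [← h, Matrix.trace_sub, trace_coeff_adjugate, Matrix.trace_smul, Matrix.trace_one]
    simp only [Fintype.card_fin, smul_eq_mul]
    push_cast
    ring

theorem mul_flMat_card (A : Matrix (Fin m) (Fin m) R) :
    A * flMat A m = - flCoeff A m • (1 : Matrix (Fin m) (Fin m) R) := by
  unfold flMat flCoeff
  rw [Nat.sub_self]
  exact mul_coeff_adjugate_zero A

theorem flCoeff_card (A : Matrix (Fin m) (Fin m) R) : flCoeff A m = (-1) ^ m * A.det := by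
  unfold flCoeff
  rw [Nat.sub_self, Matrix.det_eq_sign_charpoly_coeff, Fintype.card_fin, ← mul_assoc, ← mul_pow]
  simp

theorem flCoeff_succ {K : Type*} [Field K] [CharZero K] (A : Matrix (Fin m) (Fin m) K) {k : ℕ}
    (hk : k < m) :
    flCoeff A (k + 1) = 0 - (A * flMat A (k + 1)).trace / ((k + 1 : ℕ) : K) := by
  rw [trace_mul_flMat A hk]
  have : ((k + 1 : ℕ) : K) ≠ 0 := Nat.cast_ne_zero.2 (by omega)
  field_simp
  ring

/-- The coefficient number k is homogeneous of degree k in A and the matrix number k of degree k -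
1. The extra s on the left avoids the exponent k - 1 at k = 0. -/
theorem fl_smul {K : Type*} [Field K] [CharZero K] (s : K) (A : Matrix (Fin m) (Fin m) K) :
    ∀ k, k ≤ m → s • flMat (s • A) k = s ^ k • flMat A k ∧ flCoeff (s • A) k = s ^ k * flCoeff A k
  | 0, _ => by simp [flMat_zero, flCoeff_zero]
  | k + 1, hk => by
    obtain ⟨h₁, h₂⟩ := fl_smul s A k (by omega)
    have hB : s • flMat (s • A) (k + 1) = s ^ (k + 1) • flMat A (k + 1) := by
      rw [flMat_succ _ (by omega), flMat_succ _ (by omega), smul_add, Matrix.smul_mul,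
        ← Matrix.mul_smul, h₁, h₂, Matrix.mul_smul, smul_add, smul_smul, smul_smul, smul_smul,
        pow_succ' s k]
      congr 2
      ring
    refine ⟨hB, ?_⟩
    rw [flCoeff_succ _ (by omega), flCoeff_succ _ (by omega), Matrix.smul_mul, ← Matrix.mul_smul,
      hB, Matrix.mul_smul, Matrix.trace_smul, smul_eq_mul]
    ring

theorem flCoeff_map {S : Type*} [CommRing S] (f : R →+* S) (A : Matrix (Fin m) (Fin m) R) (k : ℕ) :
    flCoeff (A.map f) k = f (flCoeff A k) := by
  unfold flCoeff
  rw [Matrix.charpoly_map, coeff_map]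

theorem flMat_map {S : Type*} [CommRing S] (f : R →+* S) (A : Matrix (Fin m) (Fin m) R) :
    ∀ k, k ≤ m → flMat (A.map f) k = (flMat A k).map f
  | 0, _ => by simp [flMat_zero]
  | k + 1, hk => by
    rw [flMat_succ _ (by omega), flMat_succ _ (by omega), flMat_map f A k (by omega), flCoeff_map]
    ext i j
    simp only [Matrix.mul_apply, Matrix.one_apply, Matrix.add_apply, Matrix.map_apply, Matrix.smul_apply,
      smul_eq_mul, mul_ite, mul_one, mul_zero, map_add, map_sum, map_mul]
    split_ifs <;> simp

end FaddeevLeVerrier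

/-! ## Rational numbers of bounded size -/

/-- `x` is a fraction whose numerator and denominator are at most `2 ^ b`. -/
def IsSized (b : ℕ) (x : ℝ) : Prop :=
  ∃ (N : ℤ) (D : ℕ), 0 < D ∧ x = N / D ∧ N.natAbs ≤ 2 ^ b ∧ D ≤ 2 ^ b

theorem IsSized.mono {a b : ℕ} {x : ℝ} (hab : a ≤ b) : IsSized a x → IsSized b x := by
  rintro ⟨N, D, hD, hx, h₁, h₂⟩
  have := Nat.pow_le_pow_right (n := 2) (by norm_num) hab
  exact ⟨N, D, hD, hx, h₁.trans this, h₂.trans this⟩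

theorem HasBits.isSized {b : ℕ} {x : ℝ} : HasBits b x → IsSized b x := by
  rintro ⟨q, rfl, hq⟩
  unfold bitLength at hq
  refine ⟨q.num, q.den, q.den_pos, Rat.cast_def q, ?_, ?_⟩
  · exact (Nat.lt_size_self _).le.trans (Nat.pow_le_pow_right (by norm_num) (by omega))
  · exact (Nat.lt_size_self _).le.trans (Nat.pow_le_pow_right (by norm_num) (by omega))

theorem IsSized.hasBits {b : ℕ} {x : ℝ} : IsSized b x → HasBits (2 * b + 3) x := by
  rintro ⟨N, D, hD, rfl, hN, hD'⟩
  refine ⟨(N : ℚ) / (D : ℚ), by push_cast; rfl, ?_⟩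
  have key : ∀ k : ℕ, k ≤ 2 ^ b → k.size ≤ b + 1 := fun k hk =>
    Nat.size_le.2 (hk.trans_lt (Nat.pow_lt_pow_right (by norm_num) (by omega)))
  have h₂ : (((N : ℚ) / (D : ℚ)).den) ≤ D := by
    have := Rat.den_dvd N D
    rw [Rat.divInt_eq_div] at this
    exact Nat.le_of_dvd hD (by exact_mod_cast this)
  have h₁ : (((N : ℚ) / (D : ℚ)).num.natAbs) ≤ N.natAbs := by
    rcases eq_or_ne N 0 with rfl | h0
    · simp
    have := Rat.num_dvd N (b := D) (by exact_mod_cast hD.ne')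
    rw [Rat.divInt_eq_div] at this
    exact Nat.le_of_dvd (Int.natAbs_pos.2 h0) (Int.natAbs_dvd_natAbs.2 (by exact_mod_cast this))
  unfold bitLength
  have := key _ (h₁.trans hN)
  have := key _ (h₂.trans hD')
  omega

/-- Cross multiplication adds the sizes, and a sum costs one more bit. Denominators have to stay
positive, so division moves the sign of the divisor to the numerator. -/
theorem IsSized.arith (o : Arith) {a b : ℕ} {x y : ℝ} :
    IsSized a x → IsSized b y → IsSized (a + b + 1) (o.eval x y) := by
  rintro ⟨N, D, hD, rfl, hN, hD'⟩ ⟨N', D', hd, rfl, hN', hd'⟩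
  have hD0 : (D : ℝ) ≠ 0 := by exact_mod_cast hD.ne'
  have hd0 : (D' : ℝ) ≠ 0 := by exact_mod_cast hd.ne'
  have e₁ : N.natAbs * D' ≤ 2 ^ (a + b) := by rw [pow_add]; exact Nat.mul_le_mul hN hd'
  have e₂ : N'.natAbs * D ≤ 2 ^ (a + b) := by
    rw [pow_add, mul_comm]; exact Nat.mul_le_mul hD' hN'
  have e₃ : D * D' ≤ 2 ^ (a + b) := by rw [pow_add]; exact Nat.mul_le_mul hD' hd'
  have e₄ : N.natAbs * N'.natAbs ≤ 2 ^ (a + b) := by rw [pow_add]; exact Nat.mul_le_mul hN hN'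
  have e₅ : 2 ^ (a + b + 1) = 2 ^ (a + b) + 2 ^ (a + b) := by ring
  cases o with
  | add =>
    refine ⟨N * D' + N' * D, D * D', by positivity, ?_, ?_, by omega⟩
    · simp only [Arith.eval]; push_cast; field_simp
    · refine (Int.natAbs_add_le _ _).trans ?_
      simp only [Int.natAbs_mul, Int.natAbs_natCast]
      omega
  | sub =>
    refine ⟨N * D' - N' * D, D * D', by positivity, ?_, ?_, by omega⟩
    · simp only [Arith.eval]; push_cast; field_simp
    · refine (Int.natAbs_sub_le _ _).trans ?_
      simp only [Int.natAbs_mul, Int.natAbs_natCast]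
      omega
  | mul =>
    refine ⟨N * N', D * D', by positivity, ?_, ?_, by omega⟩
    · simp only [Arith.eval]; push_cast; field_simp
    · rw [Int.natAbs_mul]; omega
  | div =>
    -- The quotient by zero is 0 by convention, so no hypothesis on the divisor is needed.
    rcases eq_or_ne N' 0 with rfl | h0
    · refine ⟨0, 1, one_pos, by simp [Arith.eval], by simp, Nat.one_le_two_pow⟩
    refine ⟨N * D' * N'.sign, D * N'.natAbs, Nat.mul_pos hD (Int.natAbs_pos.2 h0), ?_, ?_, ?_⟩
    · have h0' : (N' : ℝ) ≠ 0 := by exact_mod_cast h0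
      have hs : (N'.sign : ℝ) * (N'.natAbs : ℝ) = N' := by
        rw [← Int.cast_natCast, ← Int.cast_mul, Int.sign_mul_natAbs]
      have hs2 : (N'.sign : ℝ) * (N'.sign : ℝ) = 1 := by
        rcases lt_or_gt_of_ne h0 with h | h
        · simp [Int.sign_eq_neg_one_of_neg h]
        · simp [Int.sign_eq_one_of_pos h]
      have ha : (N'.natAbs : ℝ) = N' * N'.sign := by
        rw [← hs]; linear_combination -(N'.natAbs : ℝ) * hs2
      have hsn : (N'.sign : ℝ) ≠ 0 := by
        intro h; rw [h] at hs2; simp at hs2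
      simp only [Arith.eval]
      push_cast
      rw [ha]
      field_simp
    · rw [Int.natAbs_mul, Int.natAbs_mul, Int.natAbs_sign_of_ne_zero h0]
      simp only [Int.natAbs_natCast]
      omega
    · rw [mul_comm]; omega

/-- On an integer matrix the recursion stays integral, and dividing by k + 1 only decreases absolute
values, so a step costs at most a factor G². Propagating `IsSized.arith` through the recursion would
give a bound exponential in m. -/
theorem abs_fl_le {m : ℕ} (A : Matrix (Fin m) (Fin m) ℤ) {H G : ℤ} (hH : 0 ≤ H)
    (hA : ∀ i j, |A i j| ≤ H) (hG : 2 ≤ G) (hmG : m * H ≤ G) (hmmG : m * (m * H) ≤ G) :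
    ∀ k, k ≤ m → (∀ i j, |flMat A k i j| ≤ G ^ (2 * k)) ∧ |flCoeff A k| ≤ G ^ (2 * k + 1)
  | 0, _ => by
    rw [flMat_zero, flCoeff_zero]
    simp
    omega
  | k + 1, hk => by
    obtain ⟨h₁, h₂⟩ := abs_fl_le A hH hA hG hmG hmmG k (by omega)
    have hG0 : (0 : ℤ) ≤ G := by omega
    have hmul : ∀ (B : Matrix (Fin m) (Fin m) ℤ) (b : ℤ), (∀ i j, |B i j| ≤ b) → ∀ i j,
        |(A * B) i j| ≤ m * H * b := by
      intro B b hB i j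
      rw [Matrix.mul_apply]
      refine (Finset.abs_sum_le_sum_abs _ _).trans ?_
      refine (Finset.sum_le_card_nsmul _ _ (H * b) fun l _ => ?_).trans ?_
      · rw [abs_mul]; exact mul_le_mul (hA i l) (hB l j) (abs_nonneg _) hH
      · simp [mul_assoc]
    have hB : ∀ i j, |flMat A (k + 1) i j| ≤ G ^ (2 * (k + 1)) := by
      intro i j
      rw [flMat_succ A (by omega), Matrix.add_apply]
      refine (abs_add_le _ _).trans ?_
      have e₁ := hmul _ _ h₁ i j
      have e₂ : |(flCoeff A k • (1 : Matrix (Fin m) (Fin m) ℤ)) i j| ≤ G ^ (2 * k + 1) := by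
        rw [Matrix.smul_apply, Matrix.one_apply, smul_eq_mul]
        split_ifs
        · simpa using h₂
        · simp; positivity
      have e₃ : m * H * G ^ (2 * k) ≤ G * G ^ (2 * k) :=
        mul_le_mul_of_nonneg_right hmG (by positivity)
      have e₄ : 2 * G ^ (2 * k + 1) ≤ G * G ^ (2 * k + 1) :=
        mul_le_mul_of_nonneg_right hG (by positivity)
      have e₅ : G * G ^ (2 * k) = G ^ (2 * k + 1) := by ring
      have e₆ : G * G ^ (2 * k + 1) = G ^ (2 * (k + 1)) := by ring
      linarith
    refine ⟨hB, ?_⟩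
    have ht : |(A * flMat A (k + 1)).trace| ≤ m * (m * H) * G ^ (2 * (k + 1)) := by
      rw [Matrix.trace]
      refine (Finset.abs_sum_le_sum_abs _ _).trans ?_
      refine (Finset.sum_le_card_nsmul _ _ (m * H * G ^ (2 * (k + 1))) fun l _ => ?_).trans ?_
      · exact hmul _ _ hB l l
      · simp [mul_assoc]
    rw [trace_mul_flMat A (by omega), abs_mul, abs_neg, Nat.abs_cast] at ht
    have e₁ : |flCoeff A (k + 1)| ≤ ((k + 1 : ℕ) : ℤ) * |flCoeff A (k + 1)| :=
      le_mul_of_one_le_left (abs_nonneg _) (by push_cast; omega)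
    have e₂ : m * (m * H) * G ^ (2 * (k + 1)) ≤ G * G ^ (2 * (k + 1)) :=
      mul_le_mul_of_nonneg_right hmmG (by positivity)
    calc _ ≤ _ := (e₁.trans ht).trans e₂
      _ = _ := by ring

/-- The product of all m² denominators has only b m² bits. -/
theorem exists_common_denominator {m b : ℕ} (A : Matrix (Fin m) (Fin m) ℝ)
    (hA : ∀ i j, IsSized b (A i j)) :
    ∃ (Δ : ℕ) (N : Matrix (Fin m) (Fin m) ℤ), 0 < Δ ∧ Δ ≤ 2 ^ (b * m ^ 2) ∧
      (∀ i j, |N i j| ≤ 2 ^ (b * (m ^ 2 + 1))) ∧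
      A = (1 / (Δ : ℝ)) • N.map (Int.castRingHom ℝ) := by
  choose N D hD hx hN hD' using hA
  refine ⟨∏ p : Fin m × Fin m, D p.1 p.2,
    fun i j => N i j * ((∏ p : Fin m × Fin m, D p.1 p.2) / D i j : ℕ), ?_, ?_, ?_, ?_⟩
  · exact Finset.prod_pos fun p _ => hD _ _
  · refine (Finset.prod_le_pow_card _ _ (2 ^ b) fun p _ => hD' _ _).trans ?_
    rw [← pow_mul]
    simp [sq]
  · intro i j
    rw [abs_mul, Nat.abs_cast]
    have h₁ : |N i j| ≤ 2 ^ b := by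
      rw [Int.abs_eq_natAbs]; exact_mod_cast hN i j
    have h₂ : (∏ p : Fin m × Fin m, D p.1 p.2) / D i j ≤ 2 ^ (b * m ^ 2) := by
      refine (Nat.div_le_self _ _).trans ?_
      refine (Finset.prod_le_pow_card _ _ (2 ^ b) fun p _ => hD' _ _).trans ?_
      rw [← pow_mul]
      simp [sq]
    calc _ ≤ (2 : ℤ) ^ b * 2 ^ (b * m ^ 2) :=
          mul_le_mul h₁ (by exact_mod_cast h₂) (by positivity) (by positivity)
      _ = _ := by rw [← pow_add]; ring_nf
  · ext i j
    have hdvd : D i j ∣ ∏ p : Fin m × Fin m, D p.1 p.2 :=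
      Finset.dvd_prod_of_mem (fun p : Fin m × Fin m => D p.1 p.2) (Finset.mem_univ (i, j))
    have h0 : (D i j : ℝ) ≠ 0 := by exact_mod_cast (hD i j).ne'
    have h1 : ((∏ p : Fin m × Fin m, D p.1 p.2 : ℕ) : ℝ) ≠ 0 := by
      exact_mod_cast (Finset.prod_pos fun p _ => hD _ _).ne'
    rw [Matrix.smul_apply, smul_eq_mul]
    change A i j = 1 / _ * ((N i j * ((∏ p : Fin m × Fin m, D p.1 p.2) / D i j : ℕ) : ℤ) : ℝ)
    rw [hx, Int.cast_mul, Int.cast_natCast, Nat.cast_div hdvd h0]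
    field_simp

/-- By homogeneity (`fl_smul`) the only denominator that arises is a power of the common denominator
of A; the numerators are bounded by the integral recursion. The increase of the exponent is
independent of k. -/
theorem IsSized.fl (L e m : ℕ) (A : Matrix (Fin m) (Fin m) ℝ) (hL : 3 ≤ L) (hm : m ≤ L)
    (hA : ∀ i j, IsSized (L ^ e) (A i j)) (k : ℕ) (hk : k ≤ m) :
    IsSized (L ^ (e + 5)) (flCoeff A k) ∧ ∀ i j, IsSized (L ^ (e + 5)) (flMat A k i j) := by
  obtain ⟨Δ, N, hΔ, hΔ', hN, hAN⟩ := exists_common_denominator A hA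
  set b := L ^ e with hb
  -- With this choice 2 ^ g dominates 2, the common denominator, and m and m² times the entry bound.
  set g := 2 * m + b * (m ^ 2 + 1) + 2 with hg
  have hb1 : 1 ≤ b := Nat.one_le_pow _ _ (by omega)
  have hm2 : m ≤ 2 ^ m := Nat.lt_two_pow_self.le
  have hH1 : 1 ≤ 2 ^ (b * (m ^ 2 + 1)) := Nat.one_le_two_pow
  have hG : m * (m * 2 ^ (b * (m ^ 2 + 1))) ≤ 2 ^ g := by
    calc m * (m * 2 ^ (b * (m ^ 2 + 1)))
        ≤ 2 ^ m * (2 ^ m * 2 ^ (b * (m ^ 2 + 1))) := by gcongr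
      _ = 2 ^ (2 * m + b * (m ^ 2 + 1)) := by rw [← pow_add, ← pow_add]; ring_nf
      _ ≤ 2 ^ g := Nat.pow_le_pow_right (by norm_num) (by omega)
  have hG' : m * 2 ^ (b * (m ^ 2 + 1)) ≤ 2 ^ g := by
    calc m * 2 ^ (b * (m ^ 2 + 1)) ≤ 2 ^ m * 2 ^ (b * (m ^ 2 + 1)) := by gcongr
      _ = 2 ^ (m + b * (m ^ 2 + 1)) := by rw [← pow_add]
      _ ≤ 2 ^ g := Nat.pow_le_pow_right (by norm_num) (by omega)
  have hG2 : 2 ≤ 2 ^ g := by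
    calc 2 = 2 ^ 1 := rfl
      _ ≤ 2 ^ g := Nat.pow_le_pow_right (by norm_num) (by omega)
  obtain ⟨hB, hc⟩ := abs_fl_le N (H := 2 ^ (b * (m ^ 2 + 1))) (G := 2 ^ g) (by positivity) hN
    (by exact_mod_cast hG2) (by exact_mod_cast hG') (by exact_mod_cast hG) k hk
  have hΔg : Δ ≤ 2 ^ g := hΔ'.trans (Nat.pow_le_pow_right (by norm_num) (by
    rw [hg, mul_add]; omega))
  have hfin : g * (2 * k + 2) ≤ L ^ (e + 5) := by
    have e1 : b * (m ^ 2 + 1) ≤ b * (L ^ 2 + 1) := by gcongr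
    have e3 : 2 * L + 2 ≤ L ^ 2 := by nlinarith
    have e4 : L ^ 2 ≤ b * L ^ 2 := Nat.le_mul_of_pos_left _ hb1
    have e5 : b ≤ b * L ^ 2 := Nat.le_mul_of_pos_right _ (by omega)
    have e6 : b * (L ^ 2 + 1) = b * L ^ 2 + b := by ring
    have e2 : g ≤ 3 * (b * L ^ 2) := by linarith
    calc g * (2 * k + 2) ≤ 3 * (b * L ^ 2) * (3 * L) := Nat.mul_le_mul e2 (by omega)
      _ = b * L ^ 2 * L * (3 * 3) := by ring
      _ ≤ b * L ^ 2 * L * (L * L) := by gcongr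
      _ = L ^ (e + 5) := by rw [hb]; ring
  have hΔ0 : (Δ : ℝ) ≠ 0 := by exact_mod_cast hΔ.ne'
  obtain ⟨s₁, s₂⟩ := fl_smul (1 / (Δ : ℝ)) (N.map (Int.castRingHom ℝ)) k hk
  rw [← hAN] at s₁ s₂
  have hden : Δ ^ k ≤ 2 ^ L ^ (e + 5) := by
    calc Δ ^ k ≤ (2 ^ g) ^ k := Nat.pow_le_pow_left hΔg k
      _ = 2 ^ (g * k) := by rw [← pow_mul]
      _ ≤ _ := Nat.pow_le_pow_right (by norm_num) (le_trans (by gcongr; omega) hfin)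
  constructor
  · refine ⟨flCoeff N k, Δ ^ k, by positivity, ?_, ?_, hden⟩
    · rw [s₂, flCoeff_map]
      simp
      field_simp
    · have : (flCoeff N k).natAbs ≤ (2 ^ g) ^ (2 * k + 1) := by
        rw [Int.abs_eq_natAbs] at hc; exact_mod_cast hc
      refine this.trans ?_
      rw [← pow_mul]
      exact Nat.pow_le_pow_right (by norm_num) (le_trans (by gcongr; omega) hfin)
  · intro i j
    refine ⟨Δ * flMat N k i j, Δ ^ k, by positivity, ?_, ?_, hden⟩
    · have := congrFun (congrFun s₁ i) j
      rw [flMat_map _ _ _ hk] at this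
      simp only [Matrix.smul_apply, Matrix.map_apply, smul_eq_mul, eq_intCast] at this
      have h2 : flMat A k i j = Δ * (1 / (Δ : ℝ) * flMat A k i j) := by field_simp
      rw [h2, this, one_div, inv_pow]
      push_cast
      field_simp
    · have : (flMat N k i j).natAbs ≤ (2 ^ g) ^ (2 * k) := by
        have := hB i j
        rw [Int.abs_eq_natAbs] at this; exact_mod_cast this
      rw [Int.natAbs_mul, Int.natAbs_natCast]
      refine (Nat.mul_le_mul hΔg this).trans ?_
      rw [← pow_mul, ← pow_add]
      refine Nat.pow_le_pow_right (by norm_num) (le_trans ?_ hfin)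
      nlinarith

/-! ## Size measures and a program logic -/

/-- A measure of the size of numbers that grows polynomially under the operations used. -/
structure SizeMeasure where
  holds : ℕ → ℝ → Prop
  mono : ∀ {a b : ℕ} {x : ℝ}, a ≤ b → holds a x → holds b x
  zero : holds 1 0
  one : holds 1 1
  arith : ∀ (o : Arith) {a b : ℕ} {x y : ℝ}, holds a x → holds b y → holds (a + b + 1) (o.eval x y)
  fl : ∀ (L e m : ℕ) (A : Matrix (Fin m) (Fin m) ℝ), 3 ≤ L → m ≤ L →
    (∀ i j, holds (L ^ e) (A i j)) → ∀ k, k ≤ m →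
      holds (L ^ (e + 5)) (flCoeff A k) ∧ ∀ i j, holds (L ^ (e + 5)) (flMat A k i j)

/-- The trivial measure. -/
def SizeMeasure.trivial : SizeMeasure where
  holds _ _ := True
  mono _ _ := True.intro
  zero := True.intro
  one := True.intro
  arith _ _ _ _ _ _ _ := True.intro
  fl _ _ _ _ _ _ _ _ _ := ⟨True.intro, fun _ _ => True.intro⟩

/-- The size of numerator and denominator of rational numbers. -/
def SizeMeasure.fraction : SizeMeasure where
  holds := IsSized
  mono := IsSized.mono
  zero := ⟨0, 1, one_pos, by simp, by simp, by simp⟩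
  one := ⟨1, 1, one_pos, by simp, by simp, by simp⟩
  arith o _ _ _ _ := IsSized.arith o
  fl := IsSized.fl

/-- `p` runs without division by zero, returns `a`, executes at most `L ^ e` instructions and
computes only numbers of size at most `L ^ e`. -/
def Comp (σ : SizeMeasure) (L e : ℕ) {α : Type} (p : Prog ℝ α) (a : α) : Prop :=
  ∃ t vs, Runs p a t vs ∧ t ≤ L ^ e ∧ ∀ v ∈ vs, σ.holds (L ^ e) v

section Logic

set_option linter.unusedSectionVars false

variable {σ : SizeMeasure} {L : ℕ} [hL : Fact (3 ≤ L)] {α β : Type}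

theorem pow_le_pow_of_fact {a b : ℕ} (h : a ≤ b) : L ^ a ≤ L ^ b :=
  Nat.pow_le_pow_right (by have := hL.out; omega) h

theorem three_mul_pow_le (a : ℕ) : 3 * L ^ a ≤ L ^ (a + 1) := by
  rw [pow_succ']; exact Nat.mul_le_mul_right _ hL.out

theorem one_le_pow_of_fact (a : ℕ) : 1 ≤ L ^ a :=
  Nat.one_le_pow _ _ (by have := hL.out; omega)

theorem SizeMeasure.le {a b : ℕ} {x : ℝ} (hx : σ.holds (L ^ a) x) (h : a ≤ b := by omega) :
    σ.holds (L ^ b) x :=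
  σ.mono (pow_le_pow_of_fact h) hx

theorem SizeMeasure.arith_le (o : Arith) {a b c : ℕ} {x y : ℝ} (hx : σ.holds (L ^ a) x)
    (hy : σ.holds (L ^ b) y) (hc : max a b + 1 ≤ c := by omega) :
    σ.holds (L ^ c) (o.eval x y) := by
  refine σ.mono ?_ (σ.arith o hx hy)
  have h₁ := pow_le_pow_of_fact (L := L) (le_max_left a b)
  have h₂ := pow_le_pow_of_fact (L := L) (le_max_right a b)
  have h₃ := pow_le_pow_of_fact (L := L) hc
  have h₄ := three_mul_pow_le (L := L) (max a b)
  have h₅ := one_le_pow_of_fact (L := L) (max a b)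
  omega

theorem SizeMeasure.zero_le (a : ℕ) : σ.holds (L ^ a) 0 := σ.mono (one_le_pow_of_fact a) σ.zero

theorem SizeMeasure.one_le (a : ℕ) : σ.holds (L ^ a) 1 := σ.mono (one_le_pow_of_fact a) σ.one

theorem Comp.mono {p : Prog ℝ α} {a : α} {e f : ℕ} (h : Comp σ L e p a)
    (hef : e ≤ f := by omega) : Comp σ L f p a := by
  obtain ⟨t, vs, hr, ht, hv⟩ := h
  exact ⟨t, vs, hr, ht.trans (pow_le_pow_of_fact hef), fun v hm => SizeMeasure.le (hv v hm) hef⟩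

theorem Comp.ret (a : α) (e : ℕ) : Comp σ L e (pure a : Prog ℝ α) a :=
  ⟨0, [], ⟨rfl, rfl, rfl⟩, Nat.zero_le _, by simp⟩

/-- As 2 ≤ L, a sequence of two programs of cost L ^ e costs at most L ^ (e + 1); code with a
constant number of statements raises the exponent by a constant. -/
theorem Comp.bind {p : Prog ℝ β} {f : β → Prog ℝ α} {b : β} {a : α} {e₁ e : ℕ}
    (h₁ : Comp σ L e₁ p b) (h₂ : Comp σ L e (f b) a) (he : e₁ ≤ e := by omega) :
    Comp σ L (e + 1) (p >>= f) a := by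
  obtain ⟨t₁, v₁, r₁, ht₁, hv₁⟩ := h₁.mono he
  obtain ⟨t₂, v₂, r₂, ht₂, hv₂⟩ := h₂
  refine ⟨t₁ + t₂, v₁ ++ v₂, ⟨b, t₁, v₁, t₂, v₂, r₁, r₂, rfl, rfl⟩, ?_, ?_⟩
  · have h₄ := three_mul_pow_le (L := L) e
    omega
  · intro v hv
    rcases List.mem_append.1 hv with h | h
    · exact SizeMeasure.le (hv₁ v h)
    · exact SizeMeasure.le (hv₂ v h)

theorem Comp.zero : Comp σ L 0 (Prog.zero : Prog ℝ ℝ) 0 :=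
  ⟨1, [0], ⟨rfl, rfl, rfl⟩, one_le_pow_of_fact 0, by
    simpa using σ.zero⟩

theorem Comp.one : Comp σ L 0 (Prog.one : Prog ℝ ℝ) 1 :=
  ⟨1, [1], ⟨rfl, rfl, rfl⟩, one_le_pow_of_fact 0, by
    simpa using σ.one⟩

theorem Comp.arith (o : Arith) {x y : ℝ} {a b : ℕ} (hx : σ.holds (L ^ a) x)
    (hy : σ.holds (L ^ b) y) (ho : o = Arith.div → y ≠ 0) :
    Comp σ L (max a b + 1) (Prog.arith o x y) (o.eval x y) :=
  ⟨1, [o.eval x y], ⟨ho, rfl, rfl, rfl⟩, one_le_pow_of_fact _, by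
    simpa using SizeMeasure.arith_le o hx hy le_rfl⟩

theorem Comp.add {x y : ℝ} {a b : ℕ} (hx : σ.holds (L ^ a) x) (hy : σ.holds (L ^ b) y) :
    Comp σ L (max a b + 1) (Prog.arith .add x y) (x + y) := Comp.arith .add hx hy (by simp)

theorem Comp.sub {x y : ℝ} {a b : ℕ} (hx : σ.holds (L ^ a) x) (hy : σ.holds (L ^ b) y) :
    Comp σ L (max a b + 1) (Prog.arith .sub x y) (x - y) := Comp.arith .sub hx hy (by simp)

theorem Comp.mul {x y : ℝ} {a b : ℕ} (hx : σ.holds (L ^ a) x) (hy : σ.holds (L ^ b) y) :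
    Comp σ L (max a b + 1) (Prog.arith .mul x y) (x * y) := Comp.arith .mul hx hy (by simp)

theorem Comp.div {x y : ℝ} {a b : ℕ} (hx : σ.holds (L ^ a) x) (hy : σ.holds (L ^ b) y)
    (h : y ≠ 0) : Comp σ L (max a b + 1) (Prog.arith .div x y) (x / y) :=
  Comp.arith .div hx hy fun _ => h

theorem SizeMeasure.add {x y : ℝ} {a b : ℕ} (hx : σ.holds (L ^ a) x) (hy : σ.holds (L ^ b) y) :
    σ.holds (L ^ (max a b + 1)) (x + y) := SizeMeasure.arith_le .add hx hy le_rfl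

theorem SizeMeasure.sub {x y : ℝ} {a b : ℕ} (hx : σ.holds (L ^ a) x) (hy : σ.holds (L ^ b) y) :
    σ.holds (L ^ (max a b + 1)) (x - y) := SizeMeasure.arith_le .sub hx hy le_rfl

theorem SizeMeasure.mul {x y : ℝ} {a b : ℕ} (hx : σ.holds (L ^ a) x) (hy : σ.holds (L ^ b) y) :
    σ.holds (L ^ (max a b + 1)) (x * y) := SizeMeasure.arith_le .mul hx hy le_rfl

theorem SizeMeasure.div {x y : ℝ} {a b : ℕ} (hx : σ.holds (L ^ a) x) (hy : σ.holds (L ^ b) y) :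
    σ.holds (L ^ (max a b + 1)) (x / y) := SizeMeasure.arith_le .div hx hy le_rfl

theorem Comp.lt (x y : ℝ) : Comp σ L 0 (Prog.lt x y) (decide (x < y)) :=
  ⟨1, [], ⟨by simp, rfl, rfl⟩, one_le_pow_of_fact 0, by simp⟩

theorem Comp.tabulate_aux {e : ℕ} : ∀ {m : ℕ} {f : Fin m → Prog ℝ β} {g : Fin m → β},
    (∀ i, Comp σ L e (f i) (g i)) →
    ∃ t vs, Runs (tabulate m f) g t vs ∧ t ≤ m * L ^ e ∧ ∀ v ∈ vs, σ.holds (L ^ e) v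
  | 0, f, g, _ => ⟨0, [], ⟨by ext i; exact i.elim0, rfl, rfl⟩, by simp, by simp⟩
  | m + 1, f, g, h => by
    obtain ⟨t₁, v₁, r₁, ht₁, hv₁⟩ := h 0
    obtain ⟨t₂, v₂, r₂, ht₂, hv₂⟩ := Comp.tabulate_aux (fun i : Fin m => h i.succ)
    refine ⟨t₁ + (t₂ + 0), v₁ ++ (v₂ ++ []), ⟨_, _, _, _, _, r₁,
      ⟨_, _, _, _, _, r₂, ⟨?_, rfl, rfl⟩, rfl, rfl⟩, rfl, rfl⟩, ?_, ?_⟩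
    · ext i
      refine Fin.cases ?_ (fun j => ?_) i <;> simp
    · rw [add_mul]; omega
    · intro v hv
      simp only [List.append_nil, List.mem_append] at hv
      exact hv.elim (hv₁ v) (hv₂ v)

theorem Comp.tabulate {e m : ℕ} {f : Fin m → Prog ℝ β} {g : Fin m → β}
    (h : ∀ i, Comp σ L e (f i) (g i)) (hm : m ≤ L) : Comp σ L (e + 1) (tabulate m f) g := by
  obtain ⟨t, vs, hr, ht, hv⟩ := Comp.tabulate_aux h
  refine ⟨t, vs, hr, ht.trans ?_, fun v hm => SizeMeasure.le (hv v hm)⟩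
  calc m * L ^ e ≤ L * L ^ e := Nat.mul_le_mul_right _ hm
    _ = L ^ (e + 1) := by ring

theorem Comp.tabulate₂ {e l m : ℕ} {f : Fin l → Fin m → Prog ℝ ℝ} {g : Fin l → Fin m → ℝ}
    (h : ∀ i j, Comp σ L e (f i j) (g i j)) (hl : l ≤ L) (hm : m ≤ L) :
    Comp σ L (e + 2) (tabulate₂ l m f) g :=
  Comp.tabulate (e := e + 1) (fun i => Comp.tabulate (h i) hm) hl

/-- The induction carries a bound linear in the length of the list; applying `Comp.bind` once per
summand would put the length into the exponent. -/
theorem Comp.sumOver_aux {ι : Type} {e : ℕ} {f : ι → Prog ℝ ℝ} {g : ι → ℝ} : ∀ {l : List ι},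
    (∀ i ∈ l, Comp σ L e (f i) (g i)) → (∀ i ∈ l, σ.holds (L ^ e) (g i)) →
    ∃ t vs, Runs (sumOver f l) (l.map g).sum t vs ∧ t ≤ l.length * (L ^ e + 1) + 1 ∧
      σ.holds (l.length * (L ^ e + 1) + 1) (l.map g).sum ∧
      ∀ v ∈ vs, σ.holds (l.length * (L ^ e + 1) + 1 + L ^ e) v
  | [], _, _ => ⟨1, [0], ⟨rfl, rfl, rfl⟩, by simp, by simpa using σ.zero, by
      simpa using σ.mono (by omega) σ.zero⟩
  | i :: l, h, hg => by
    obtain ⟨t₁, v₁, r₁, ht₁, hv₁⟩ := h i (by simp)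
    obtain ⟨t₂, v₂, r₂, ht₂, hs, hv₂⟩ := Comp.sumOver_aux (l := l) (fun j hj => h j (by simp [hj]))
      (fun j hj => hg j (by simp [hj]))
    have hsum := σ.arith Arith.add (hg i (by simp)) hs
    have hlen : (i :: l).length * (L ^ e + 1) = l.length * (L ^ e + 1) + L ^ e + 1 := by
      simp; ring
    refine ⟨t₁ + (t₂ + 1), v₁ ++ (v₂ ++ [g i + (l.map g).sum]), ⟨_, _, _, _, _, r₁,
      ⟨_, _, _, _, _, r₂, ⟨by simp, by simp [Arith.eval], rfl, rfl⟩, rfl, by simp⟩, rfl, rfl⟩,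
      by omega, ?_, ?_⟩
    · rw [List.map_cons, List.sum_cons]
      exact σ.mono (by omega) hsum
    · intro v hv
      simp only [List.mem_append, List.mem_singleton] at hv
      rcases hv with hv | hv | rfl
      · exact σ.mono (by omega) (hv₁ v hv)
      · exact σ.mono (by omega) (hv₂ v hv)
      · exact σ.mono (by omega) hsum

theorem Comp.sumOver {ι : Type} {e : ℕ} {f : ι → Prog ℝ ℝ} {g : ι → ℝ} {l : List ι}
    (h : ∀ i ∈ l, Comp σ L e (f i) (g i)) (hg : ∀ i ∈ l, σ.holds (L ^ e) (g i))
    (hl : l.length ≤ L) :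
    Comp σ L (e + 2) (sumOver f l) (l.map g).sum ∧ σ.holds (L ^ (e + 2)) (l.map g).sum := by
  obtain ⟨t, vs, hr, ht, hs, hv⟩ := Comp.sumOver_aux h hg
  have hb : l.length * (L ^ e + 1) + 1 + L ^ e ≤ L ^ (e + 2) := by
    have h₁ := one_le_pow_of_fact (L := L) e
    have h3 := hL.out
    have h₂ : l.length * (L ^ e + 1) ≤ L * (L ^ e + 1) := Nat.mul_le_mul_right _ hl
    have h₃ : L ^ (e + 2) = L * L * L ^ e := by ring
    rw [h₃]
    nlinarith [Nat.mul_le_mul h3 h₁, Nat.mul_le_mul h3 h3, Nat.mul_le_mul_right (L ^ e) h3,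
      Nat.mul_le_mul_right (L * L ^ e) h3]
  exact ⟨⟨t, vs, hr, by omega, fun v hm => σ.mono hb (hv v hm)⟩, σ.mono (by omega) hs⟩

theorem Comp.argmax_aux {ι : Type} {e : ℕ} {f : ι → Prog ℝ ℝ} {g : ι → ℝ} : ∀ {l : List ι},
    (∀ i ∈ l, Comp σ L e (f i) (g i)) →
    ∃ r t vs, Runs (argmax f l) r t vs ∧ t ≤ l.length * (L ^ e + 1) ∧
      (∀ v ∈ vs, σ.holds (L ^ e) v) ∧
      ((l = [] ∧ r = none) ∨ ∃ i ∈ l, r = some (i, g i) ∧ ∀ j ∈ l, g j ≤ g i)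
  | [], _ => ⟨none, 0, [], ⟨rfl, rfl, rfl⟩, by simp, by simp, Or.inl ⟨rfl, rfl⟩⟩
  | i :: l, h => by
    obtain ⟨t₁, v₁, r₁, ht₁, hv₁⟩ := h i (by simp)
    obtain ⟨r, t₂, v₂, r₂, ht₂, hv₂, hr⟩ :=
      Comp.argmax_aux (l := l) (fun j hj => h j (by simp [hj]))
    have hlen : (i :: l).length * (L ^ e + 1) = l.length * (L ^ e + 1) + L ^ e + 1 := by
      simp; ring
    rcases hr with ⟨rfl, rfl⟩ | ⟨j, hj, rfl, hmax⟩
    · refine ⟨some (i, g i), t₁ + (t₂ + 0), v₁ ++ (v₂ ++ []), ⟨_, _, _, _, _, r₁,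
        ⟨_, _, _, _, _, r₂, ⟨rfl, rfl, rfl⟩, rfl, rfl⟩, rfl, rfl⟩, by omega, ?_, Or.inr ?_⟩
      · intro v hv
        simp only [List.append_nil, List.mem_append] at hv
        exact hv.elim (hv₁ v) (hv₂ v)
      · exact ⟨i, by simp, rfl, by simp⟩
    · have hvs : ∀ v ∈ v₁ ++ (v₂ ++ ([] ++ [])), σ.holds (L ^ e) v := by
        intro v hv
        simp only [List.append_nil, List.mem_append] at hv
        exact hv.elim (hv₁ v) (hv₂ v)
      by_cases hlt : g i < g j
      · refine ⟨some (j, g j), t₁ + (t₂ + (1 + 0)), v₁ ++ (v₂ ++ ([] ++ [])), ⟨_, _, _, _, _, r₁,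
          ⟨_, _, _, _, _, r₂, ⟨true, 1, [], 0, [], ⟨by simp [hlt], rfl, rfl⟩, ⟨rfl, rfl, rfl⟩,
          rfl, rfl⟩, rfl, rfl⟩, rfl, rfl⟩, by omega, hvs, Or.inr ?_⟩
        refine ⟨j, by simp [hj], rfl, fun k hk => ?_⟩
        rcases List.mem_cons.1 hk with rfl | hk
        · exact hlt.le
        · exact hmax k hk
      · refine ⟨some (i, g i), t₁ + (t₂ + (1 + 0)), v₁ ++ (v₂ ++ ([] ++ [])), ⟨_, _, _, _, _, r₁,
          ⟨_, _, _, _, _, r₂, ⟨false, 1, [], 0, [], ⟨by simp [hlt], rfl, rfl⟩, ⟨rfl, rfl, rfl⟩,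
          rfl, rfl⟩, rfl, rfl⟩, rfl, rfl⟩, by omega, hvs, Or.inr ?_⟩
        refine ⟨i, by simp, rfl, fun k hk => ?_⟩
        rcases List.mem_cons.1 hk with rfl | hk
        · exact le_rfl
        · exact (hmax k hk).trans (not_lt.1 hlt)

theorem Comp.argmax {ι : Type} {e : ℕ} {f : ι → Prog ℝ ℝ} {g : ι → ℝ} {l : List ι}
    (h : ∀ i ∈ l, Comp σ L e (f i) (g i)) (hl : l.length ≤ L ^ 2) :
    ∃ r, Comp σ L (e + 3) (argmax f l) r ∧
      ((l = [] ∧ r = none) ∨ ∃ i ∈ l, r = some (i, g i) ∧ ∀ j ∈ l, g j ≤ g i) := by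
  obtain ⟨r, t, vs, hr, ht, hv, hmax⟩ := Comp.argmax_aux h
  refine ⟨r, ⟨t, vs, hr, ht.trans ?_, fun v hm => SizeMeasure.le (hv v hm)⟩, hmax⟩
  have h₁ := one_le_pow_of_fact (L := L) e
  have h3 := hL.out
  calc l.length * (L ^ e + 1) ≤ L ^ 2 * (L ^ e * L) := Nat.mul_le_mul hl (by nlinarith)
    _ = L ^ (e + 3) := by ring

theorem Comp.isZero (x : ℝ) : Comp σ L 3 (isZero x) (decide (x = 0)) := by
  unfold FrameScaling.isZero
  refine Comp.zero.bind ((Comp.lt _ _).bind ((Comp.lt _ _).bind ?_))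
  convert Comp.ret (σ := σ) (L := L) (decide (x = 0)) 0 using 2
  rcases lt_trichotomy x 0 with h | h | h
  · simp [h, h.ne]
  · simp [h]
  · simp [h, h.ne']

end Logic

/-! ### Specifications of the linear algebra programs -/

section ProgramSpecs

variable {σ : SizeMeasure} {L : ℕ} [hL : Fact (3 ≤ L)]

set_option linter.unusedSectionVars false

/-- `p` returns `a` after at most `N` instructions and computes only numbers of size at most `M`. -/
def Cost (σ : SizeMeasure) (N M : ℕ) {α : Type} (p : Prog ℝ α) (a : α) : Prop :=
  ∃ t vs, Runs p a t vs ∧ t ≤ N ∧ ∀ v ∈ vs, σ.holds M v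

theorem Comp.cost {e : ℕ} {α : Type} {p : Prog ℝ α} {a : α} (h : Comp σ L e p a) :
    Cost σ (L ^ e) (L ^ e) p a := h

theorem Cost.mono {N N' M M' : ℕ} {α : Type} {p : Prog ℝ α} {a : α} (h : Cost σ N M p a)
    (hN : N ≤ N') (hM : M ≤ M') : Cost σ N' M' p a := by
  obtain ⟨t, vs, hr, ht, hv⟩ := h
  exact ⟨t, vs, hr, ht.trans hN, fun v hm => σ.mono hM (hv v hm)⟩

theorem Cost.ret {α : Type} (a : α) (N M : ℕ) : Cost σ N M (pure a : Prog ℝ α) a :=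
  ⟨0, [], ⟨rfl, rfl, rfl⟩, Nat.zero_le _, by simp⟩

theorem Cost.bind {N₁ N₂ M : ℕ} {α β : Type} {p : Prog ℝ β} {f : β → Prog ℝ α} {b : β} {a : α}
    (h₁ : Cost σ N₁ M p b) (h₂ : Cost σ N₂ M (f b) a) : Cost σ (N₁ + N₂) M (p >>= f) a := by
  obtain ⟨t₁, v₁, r₁, ht₁, hv₁⟩ := h₁
  obtain ⟨t₂, v₂, r₂, ht₂, hv₂⟩ := h₂
  refine ⟨t₁ + t₂, v₁ ++ v₂, ⟨b, t₁, v₁, t₂, v₂, r₁, r₂, rfl, rfl⟩, by omega, ?_⟩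
  intro v hv
  rcases List.mem_append.1 hv with h | h
  · exact hv₁ v h
  · exact hv₂ v h

/-- In a recursion of variable length the instruction counts add up under a fixed size bound. The
number k of rounds is absorbed into the exponent once, at the end. -/
theorem Cost.comp {k e e' : ℕ} {α : Type} {p : Prog ℝ α} {a : α}
    (h : Cost σ (k * L ^ e) (L ^ e) p a) (hk : k ≤ L ^ e') : Comp σ L (e + e') p a :=
  h.mono (by rw [pow_add, mul_comm]; exact Nat.mul_le_mul_left _ hk)
    (pow_le_pow_of_fact (by omega))

theorem SizeMeasure.natCast {k : ℕ} (hk : k ≤ L) : σ.holds (L ^ 2) (k : ℝ) := by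
  have h : ∀ k : ℕ, σ.holds (2 * k + 1) (k : ℝ) := by
    intro k
    induction k with
    | zero => simpa using σ.zero
    | succ k ih => simpa [Arith.eval] using σ.mono (by omega) (σ.arith Arith.add ih σ.one)
  refine σ.mono ?_ (h k)
  have := hL.out
  nlinarith

/-! ### Matrix arithmetic -/

theorem Comp.matMul {e l m q : ℕ} {A : Matrix (Fin l) (Fin m) ℝ} {B : Matrix (Fin m) (Fin q) ℝ}
    (hA : ∀ i j, σ.holds (L ^ e) (A i j)) (hB : ∀ i j, σ.holds (L ^ e) (B i j))
    (hl : l ≤ L) (hm : m ≤ L) (hq : q ≤ L) :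
    Comp σ L (e + 5) (matMul A B) (A * B : Matrix (Fin l) (Fin q) ℝ) ∧ ∀ i j, σ.holds (L ^ (e + 3)) ((A * B) i j) := by
  have h : ∀ i j, Comp σ L (e + 3)
      (FrameScaling.sumOver (fun k => Prog.arith .mul (A i k) (B k j)) (List.finRange m)) ((A * B) i j) ∧
      σ.holds (L ^ (e + 3)) ((A * B) i j) := by
    intro i j
    rw [Matrix.mul_apply, Fin.sum_univ_def]
    exact Comp.sumOver (e := e + 1) (fun k _ => (Comp.mul (hA i k) (hB k j)).mono)
      (fun k _ => SizeMeasure.le (SizeMeasure.mul (hA i k) (hB k j))) (by simpa using hm)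
  exact ⟨Comp.tabulate₂ (fun i j => (h i j).1) hl hq, fun i j => (h i j).2⟩

theorem Comp.matTrace {e m : ℕ} {A : Matrix (Fin m) (Fin m) ℝ}
    (hA : ∀ i j, σ.holds (L ^ e) (A i j)) (hm : m ≤ L) :
    Comp σ L (e + 2) (matTrace A) A.trace ∧ σ.holds (L ^ (e + 2)) A.trace := by
  rw [Matrix.trace, Fin.sum_univ_def]
  exact Comp.sumOver (l := List.finRange m) (fun k _ => Comp.ret _ _) (fun k _ => hA k k) (by simpa using hm)

/-! ### The Faddeev–LeVerrier recursion -/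

/-- The state of the Faddeev–LeVerrier recursion after `k` steps. -/
noncomputable def flState {m : ℕ} (A : Matrix (Fin m) (Fin m) ℝ) (k : ℕ) : FLState ℝ m :=
  { B := flMat A k, c := flCoeff A k, idx := k }

theorem Comp.flInit {m : ℕ} (A : Matrix (Fin m) (Fin m) ℝ) :
    Comp σ L 2 (flInit m) (flState A 0) := by
  unfold FrameScaling.flInit
  have h : flState A 0 = { B := fun _ _ => 0, c := 1, idx := 0 } := by
    unfold flState
    rw [flMat_zero, flCoeff_zero, Nat.cast_zero]
    rfl
  rw [h]
  exact Comp.zero.bind (Comp.one.bind (Comp.ret _ _))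

/-- The incoming state and the new matrix are sized by `σ.fl`, not through the operations that led
to them, so the exponent does not grow with k. -/
theorem Comp.flStep {e m k : ℕ} {A : Matrix (Fin m) (Fin m) ℝ}
    (hA : ∀ i j, σ.holds (L ^ e) (A i j)) (hm : m ≤ L) (hk : k < m) :
    Comp σ L (e + 30) (flStep A (flState A k)) (flState A (k + 1)) := by
  obtain ⟨hc, hB⟩ := σ.fl L e m A hL.out hm hA k hk.le
  obtain ⟨hc', hB'⟩ := σ.fl L e m A hL.out hm hA (k + 1) hk
  have hA' : ∀ i j, σ.holds (L ^ (e + 5)) (A i j) := fun i j => SizeMeasure.le (hA i j)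
  obtain ⟨c₁, s₁⟩ := Comp.matMul hA' hB hm hm hm
  obtain ⟨c₂, s₂⟩ := Comp.matMul hA' hB' hm hm hm
  obtain ⟨c₃, s₃⟩ := Comp.matTrace s₂ hm
  have c₄ : Comp σ L (e + 11) (FrameScaling.tabulate₂ m m (fun i j =>
      if i = j then Prog.arith .add ((A * flMat A k) i j) (flCoeff A k)
      else pure ((A * flMat A k) i j))) (flMat A (k + 1)) := by
    refine Comp.tabulate₂ (e := e + 9) (fun i j => ?_) hm hm
    rw [flMat_succ A hk]
    by_cases hij : i = j
    · subst hij
      simpa using (Comp.add (s₁ i i) hc).mono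
    · simpa [hij, Matrix.one_apply] using Comp.ret _ _
  have hk0 : ((k + 1 : ℕ) : ℝ) ≠ 0 := Nat.cast_ne_zero.2 (by omega)
  have hs := SizeMeasure.natCast (σ := σ) (L := L) (k := k) (by omega)
  have hs' := SizeMeasure.natCast (σ := σ) (L := L) (k := k + 1) (by omega)
  have c₅ := Comp.add (L := L) hs (SizeMeasure.one_le 2)
  rw [← Nat.cast_succ] at c₅
  have c₆ := Comp.div s₃ hs' hk0
  have s₆ := SizeMeasure.div s₃ hs'
  have c₇ := Comp.sub (L := L) (SizeMeasure.zero_le (σ := σ) 0) s₆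
  rw [← flCoeff_succ A hk] at c₇
  unfold FrameScaling.flStep
  refine Comp.bind c₁ (Comp.bind c₄ (Comp.bind c₂ (Comp.bind c₃ (Comp.bind Comp.one
    (Comp.bind c₅ (Comp.bind c₆ (Comp.bind Comp.zero (Comp.bind (e := e + 21) c₇ ?_))))))))
  exact Comp.ret _ _

theorem Cost.flSteps {e m : ℕ} {A : Matrix (Fin m) (Fin m) ℝ}
    (hA : ∀ i j, σ.holds (L ^ e) (A i j)) (hm : m ≤ L) : ∀ k, k ≤ m →
    Cost σ ((k + 1) * L ^ (e + 30)) (L ^ (e + 30)) (flSteps A k) (flState A k)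
  | 0, _ => by
    have := (Comp.flInit (σ := σ) (L := L) A).mono (f := e + 30)
    simpa [FrameScaling.flSteps] using this.cost
  | k + 1, hk => by
    have h₁ := Cost.flSteps hA hm k (by omega)
    have h₂ := (Comp.flStep (σ := σ) hA hm (k := k) (by omega)).cost
    refine (Cost.bind h₁ h₂).mono (le_of_eq ?_) le_rfl
    ring

theorem Comp.flSteps {e m : ℕ} {A : Matrix (Fin m) (Fin m) ℝ}
    (hA : ∀ i j, σ.holds (L ^ e) (A i j)) (hm : m ≤ L) :
    Comp σ L (e + 32) (flSteps A m) (flState A m) :=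
  (Cost.flSteps hA hm m le_rfl).comp (e' := 2) (by have := hL.out; nlinarith)

theorem Comp.matDet {e m : ℕ} {A : Matrix (Fin m) (Fin m) ℝ}
    (hA : ∀ i j, σ.holds (L ^ e) (A i j)) (hm : m ≤ L) :
    Comp σ L (e + 35) (matDet A) A.det ∧ σ.holds (L ^ (e + 6)) A.det := by
  obtain ⟨hc, -⟩ := σ.fl L e m A hL.out hm hA m le_rfl
  have hs := SizeMeasure.sub (L := L) (SizeMeasure.zero_le (σ := σ) 0) hc
  have h := Comp.flSteps (σ := σ) hA hm
  unfold FrameScaling.matDet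
  by_cases hpar : m % 2 = 0
  · have hdet : A.det = flCoeff A m := by
      rw [flCoeff_card, Even.neg_one_pow (Nat.even_iff.2 hpar), one_mul]
    rw [hdet]
    simp only [hpar, if_true]
    exact ⟨(h.bind (Comp.ret (flCoeff A m) (e + 32))).mono, SizeMeasure.le hc⟩
  · have hdet : A.det = 0 - flCoeff A m := by
      rw [flCoeff_card, Odd.neg_one_pow (Nat.odd_iff.2 (by omega))]; ring
    rw [hdet]
    simp only [hpar, if_false]
    refine ⟨(h.bind (e := e + 33) (Comp.zero.bind (e := e + 32) ?_)).mono, SizeMeasure.le hs⟩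
    exact (Comp.sub (SizeMeasure.zero_le 0) hc).mono

/-- After m steps A times the matrix of the state is minus the last coefficient times I, and that
coefficient is the determinant up to sign. -/
theorem Comp.matInv {e m : ℕ} {A : Matrix (Fin m) (Fin m) ℝ}
    (hA : ∀ i j, σ.holds (L ^ e) (A i j)) (hm : m ≤ L) (hdet : A.det ≠ 0) :
    Comp σ L (e + 35) (matInv A) (A⁻¹ : Matrix (Fin m) (Fin m) ℝ) ∧ ∀ i j, σ.holds (L ^ (e + 7)) (A⁻¹ i j) := by
  obtain ⟨hc, hB⟩ := σ.fl L e m A hL.out hm hA m le_rfl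
  have hc0 : flCoeff A m ≠ 0 := by
    rw [flCoeff_card]
    exact mul_ne_zero (pow_ne_zero _ (by norm_num)) hdet
  have hinv : ∀ i j, A⁻¹ i j = 0 - flMat A m i j / flCoeff A m := by
    have : A * (-(flCoeff A m)⁻¹ • flMat A m) = 1 := by
      rw [Matrix.mul_smul, mul_flMat_card, smul_smul]
      simp [hc0]
    rw [Matrix.inv_eq_right_inv this]
    intro i j
    rw [Matrix.smul_apply, smul_eq_mul]
    field_simp
    ring
  have hd : ∀ i j, σ.holds (L ^ (max (e + 5) (e + 5) + 1)) (flMat A m i j / flCoeff A m) :=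
    fun i j => SizeMeasure.div (hB i j) hc
  constructor
  · have hg : A⁻¹ = Matrix.of fun i j => 0 - flMat A m i j / flCoeff A m := Matrix.ext hinv
    rw [hg]
    unfold FrameScaling.matInv
    refine (Comp.bind (Comp.flSteps (σ := σ) hA hm) (e := e + 33)
      (Comp.zero.bind (e := e + 32) ?_)).mono
    refine (Comp.tabulate₂ (e := e + 9) (fun i j => ?_) hm hm).mono
    exact (Comp.bind (Comp.div (hB i j) hc hc0) (e := e + 8)
      (Comp.sub (SizeMeasure.zero_le 0) (hd i j)).mono)
  · intro i j
    rw [hinv]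
    exact SizeMeasure.le (SizeMeasure.sub (SizeMeasure.zero_le 0) (hd i j))

/-- Only a lower bound for the result is recorded: later the computed rank serves just to exclude p
= r, for which p < rank ≤ r is enough. -/
theorem Cost.symRank_go {e m : ℕ} {A : Matrix (Fin m) (Fin m) ℝ}
    (hA : ∀ i j, σ.holds (L ^ e) (A i j)) (hm : m ≤ L) : ∀ (fuel k r : ℕ), k + fuel = m → r ≤ k →
    ∃ r', Cost σ (fuel * L ^ (e + 32)) (L ^ (e + 32)) (symRank.go A fuel k r (flState A k)) r' ∧
      r ≤ r' ∧ ∀ j, k < j → j ≤ m → flCoeff A j ≠ 0 → j ≤ r'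
  | 0, k, r, hk, hr => ⟨r, Cost.ret _ _ _, le_rfl, fun j h₁ h₂ => by omega⟩
  | fuel + 1, k, r, hk, hr => by
    have hstep := Comp.flStep (σ := σ) hA hm (k := k) (by omega)
    have hz := Comp.isZero (σ := σ) (L := L) (flCoeff A (k + 1))
    by_cases h0 : flCoeff A (k + 1) = 0
    · obtain ⟨r', hc, hr', hj⟩ := Cost.symRank_go hA hm fuel (k + 1) r (by omega) (by omega)
      refine ⟨r', ?_, hr', fun j h₁ h₂ h₃ => ?_⟩
      · refine (Cost.bind (N₁ := L ^ (e + 30)) (N₂ := L ^ (e + 30) + fuel * L ^ (e + 32))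
          (hstep.cost.mono le_rfl (pow_le_pow_of_fact (by omega)))
          (Cost.bind (hz.cost.mono (pow_le_pow_of_fact (by omega))
            (pow_le_pow_of_fact (by omega))) ?_)).mono ?_ le_rfl
        · simpa [flState, h0] using hc
        · have := three_mul_pow_le (L := L) (e + 30)
          have h2 : L ^ (e + 30 + 1) ≤ L ^ (e + 32) := pow_le_pow_of_fact (by omega)
          rw [add_mul]
          omega
      · refine hj j (lt_of_le_of_ne h₁ ?_) h₂ h₃
        rintro rfl
        exact h₃ h0
    · obtain ⟨r', hc, hr', hj⟩ := Cost.symRank_go hA hm fuel (k + 1) (k + 1) (by omega) le_rfl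
      refine ⟨r', ?_, by omega, fun j h₁ h₂ h₃ => ?_⟩
      · refine (Cost.bind (N₁ := L ^ (e + 30)) (N₂ := L ^ (e + 30) + fuel * L ^ (e + 32))
          (hstep.cost.mono le_rfl (pow_le_pow_of_fact (by omega)))
          (Cost.bind (hz.cost.mono (pow_le_pow_of_fact (by omega))
            (pow_le_pow_of_fact (by omega))) ?_)).mono ?_ le_rfl
        · simpa [flState, h0] using hc
        · have := three_mul_pow_le (L := L) (e + 30)
          have h2 : L ^ (e + 30 + 1) ≤ L ^ (e + 32) := pow_le_pow_of_fact (by omega)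
          rw [add_mul]
          omega
      · rcases Nat.lt_or_ge (k + 1) j with h | h
        · exact hj j h h₂ h₃
        · omega

theorem Comp.symRank {e m : ℕ} {A : Matrix (Fin m) (Fin m) ℝ}
    (hA : ∀ i j, σ.holds (L ^ e) (A i j)) (hm : m ≤ L) :
    ∃ r, Comp σ L (e + 34) (symRank A) r ∧ ∀ j, j ≤ m → flCoeff A j ≠ 0 → j ≤ r := by
  obtain ⟨r, hc, -, hj⟩ := Cost.symRank_go (σ := σ) hA hm m 0 0 (by simp) le_rfl
  refine ⟨r, ?_, fun j h₁ h₂ => ?_⟩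
  · unfold FrameScaling.symRank
    exact Comp.bind (Comp.flInit A) (hc.comp (e' := 1) (by simpa using hm))
  · rcases Nat.eq_zero_or_pos j with rfl | h
    · exact Nat.zero_le _
    · exact hj j h h₁ h₂

/-- Invariant: the threshold is k + 1/2 with k ≤ p. The strict inequalities exclude ties, and if the
fuel runs out then k = m = p. -/
theorem Cost.nearestUpTo_go (x : ℝ) {m p : ℕ} (hm : m ≤ L) (hp : p ≤ m) (h₁ : (p : ℝ) - 1 / 2 < x)
    (h₂ : x < p + 1 / 2) : ∀ fuel k, k + fuel = m → k ≤ p →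
    Cost σ (fuel * L ^ 6) (L ^ 6) (nearestUpTo.go x 1 fuel k ((k : ℝ) + 1 / 2)) p
  | 0, k, hk, hkp => by
    obtain rfl : k = p := by omega
    exact Cost.ret _ _ _
  | fuel + 1, k, hk, hkp => by
    have hlt := (Comp.lt (σ := σ) (L := L) x ((k : ℝ) + 1 / 2)).mono (f := 5)
    by_cases hx : x < (k : ℝ) + 1 / 2
    · have : k = p := by
        by_contra hne
        have h : ((k + 1 : ℕ) : ℝ) ≤ p := by exact_mod_cast (by omega : k + 1 ≤ p)
        push_cast at h
        linarith
      subst this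
      refine (Cost.bind (N₂ := 0) (hlt.cost.mono le_rfl
        (pow_le_pow_of_fact (b := 6) (by omega))) (?_ : Cost _ _ _ _ k)).mono ?_ le_rfl
      · simp only [hx, decide_true, if_true]
        exact Cost.ret _ _ _
      · have := pow_le_pow_of_fact (L := L) (show 5 ≤ 6 by omega)
        rw [add_mul]
        omega
    · have hkp' : k + 1 ≤ p := by
        by_contra hne
        obtain rfl : k = p := by omega
        exact hx h₂
      have hrec := Cost.nearestUpTo_go x hm hp h₁ h₂ fuel (k + 1) (by omega) hkp'
      have hs : σ.holds (L ^ 4) ((k : ℝ) + 1 / 2) := by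
        have s₁ := SizeMeasure.natCast (σ := σ) (L := L) (k := k) (by omega)
        have s₂ := SizeMeasure.natCast (σ := σ) (L := L) (k := 2) (by have := hL.out; omega)
        exact SizeMeasure.le (SizeMeasure.add s₁
          (SizeMeasure.div (SizeMeasure.one_le 2) s₂))
      have hadd := (Comp.add (L := L) hs (SizeMeasure.one_le 2)).mono (f := 5)
      have he : (k : ℝ) + 1 / 2 + 1 = ((k + 1 : ℕ) : ℝ) + 1 / 2 := by push_cast; ring
      rw [he] at hadd
      refine (Cost.bind (N₂ := L ^ 5 + fuel * L ^ 6) (hlt.cost.mono le_rfl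
        (pow_le_pow_of_fact (b := 6) (by omega))) ?_).mono ?_ le_rfl
      · simp only [hx, decide_false, Bool.false_eq_true, if_false]
        exact Cost.bind (hadd.cost.mono le_rfl (pow_le_pow_of_fact (b := 6) (by omega))) hrec
      · have : 3 * L ^ 5 ≤ L ^ 6 := three_mul_pow_le 5
        rw [add_mul]
        omega

theorem Comp.nearestUpTo (x : ℝ) {m p : ℕ} (hm : m ≤ L) (hp : p ≤ m) (h₁ : (p : ℝ) - 1 / 2 < x)
    (h₂ : x < p + 1 / 2) : Comp σ L 10 (nearestUpTo x m) p := by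
  have hgo := Cost.nearestUpTo_go (σ := σ) x hm hp h₁ h₂ m 0 (by simp) (Nat.zero_le _)
  have hgo := hgo.comp (e' := 1) (by simpa using hm)
  have s₁ := SizeMeasure.one_le (σ := σ) (L := L) 0
  have c₁ := Comp.add s₁ s₁
  have s₂ := SizeMeasure.add s₁ s₁
  have c₂ := Comp.div s₁ s₂ (by norm_num)
  unfold FrameScaling.nearestUpTo
  refine Comp.one.bind (c₁.bind (c₂.bind ?_))
  convert hgo using 2
  norm_num

end ProgramSpecs

/-! ### Specifications of the evaluations, the subdeterminant search and the eigenvalue-sum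
approximation -/

section AlgorithmSpecs

variable {σ : SizeMeasure} {L : ℕ} [hL : Fact (3 ≤ L)] {d n : ℕ}

set_option linter.unusedSectionVars false

theorem gram_apply (U : Matrix (Fin d) (Fin n) ℝ) (z : Fin n → ℝ) (S : Finset (Fin n))
    (a b : Fin d) : gram U z S a b = ∑ j ∈ S, U a j * z j * U b j := by
  unfold gram
  rw [Matrix.mul_apply]
  simp [Matrix.mul_diagonal, Finset.sum_ite_mem]

theorem sum_map_filter_finRange (S : Finset (Fin n)) (f : Fin n → ℝ) :
    (((List.finRange n).filter (· ∈ S)).map f).sum = ∑ j ∈ S, f j := by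
  rw [← List.sum_toFinset f ((List.nodup_finRange n).filter _)]
  refine Finset.sum_congr ?_ fun _ _ => rfl
  ext j
  simp

theorem length_filter_finRange_le (P : Fin n → Bool) : ((List.finRange n).filter P).length ≤ n := by
  simpa using List.length_filter_le P (List.finRange n)

theorem Comp.gramProg {U : Matrix (Fin d) (Fin n) ℝ} {z : Fin n → ℝ}
    (hU : ∀ i j, σ.holds (L ^ 1) (U i j)) (hz : ∀ j, σ.holds (L ^ 1) (z j)) (hd : d ≤ L)
    (hn : n ≤ L) (S : Finset (Fin n)) :
    Comp σ L 8 (gramProg U z S) (gram U z S) ∧ ∀ a b, σ.holds (L ^ 6) (gram U z S a b) := by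
  have h : ∀ a b, Comp σ L 6 (FrameScaling.sumOver (fun j => do
      let x ← Prog.arith .mul (U a j) (z j)
      Prog.arith .mul x (U b j)) ((List.finRange n).filter (· ∈ S))) (gram U z S a b) ∧
      σ.holds (L ^ 6) (gram U z S a b) := by
    intro a b
    rw [gram_apply, ← sum_map_filter_finRange]
    refine Comp.sumOver (e := 4)
      (fun j _ => Comp.bind (e := 3) (Comp.mul (hU a j) (hz j)) ?_) (fun j _ => ?_)
      ((length_filter_finRange_le _).trans hn)
    · exact (Comp.mul (SizeMeasure.mul (hU a j) (hz j)) (hU b j)).mono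
    · exact SizeMeasure.le (SizeMeasure.mul (SizeMeasure.mul (hU a j) (hz j)) (hU b j))
  exact ⟨Comp.tabulate₂ (fun a b => (h a b).1) hd hd, fun a b => (h a b).2⟩

/-- The matrix `M_{Tᶜ} + α M_T`. -/
def scaledGram (U : Matrix (Fin d) (Fin n) ℝ) (z : Fin n → ℝ) (T : Finset (Fin n)) (α : ℝ) :
    Matrix (Fin d) (Fin d) ℝ :=
  gram U z Tᶜ + α • gram U z T

theorem Comp.evalData {U : Matrix (Fin d) (Fin n) ℝ} {z : Fin n → ℝ} {α : ℝ}
    (hU : ∀ i j, σ.holds (L ^ 1) (U i j)) (hz : ∀ j, σ.holds (L ^ 1) (z j)) (hd : d ≤ L)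
    (hn : n ≤ L) (T : Finset (Fin n)) (hα : σ.holds (L ^ 1) α)
    (hdet : (scaledGram U z T α).det ≠ 0) :
    Comp σ L 50 (evalData U z T α)
      (gram U z T, gram U z Tᶜ, ((scaledGram U z T α)⁻¹ : Matrix (Fin d) (Fin d) ℝ)) ∧
    ∀ a b, σ.holds (L ^ 15) ((scaledGram U z T α)⁻¹ a b) := by
  obtain ⟨c₁, s₁⟩ := Comp.gramProg hU hz hd hn T
  obtain ⟨c₂, s₂⟩ := Comp.gramProg hU hz hd hn Tᶜ
  have s₃ : ∀ a b, σ.holds (L ^ 8) (scaledGram U z T α a b) := fun a b =>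
    SizeMeasure.le (SizeMeasure.add (s₂ a b) (SizeMeasure.mul hα (s₁ a b)))
  have c₃ : Comp σ L 11 (FrameScaling.tabulate₂ d d (fun a b => do
      let x ← Prog.arith .mul α (gram U z T a b)
      Prog.arith .add (gram U z Tᶜ a b) x)) (scaledGram U z T α) := by
    refine Comp.tabulate₂ (fun a b => ?_) hd hd
    exact Comp.bind (Comp.mul hα (s₁ a b))
      (Comp.add (s₂ a b) (SizeMeasure.mul hα (s₁ a b))).mono (e := 8)
  obtain ⟨c₄, s₄⟩ := Comp.matInv s₃ hd hdet
  refine ⟨?_, s₄⟩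
  unfold FrameScaling.evalData
  exact c₁.bind (c₂.bind (c₃.bind (c₄.bind (Comp.ret _ 46))))

theorem Comp.evalH {U : Matrix (Fin d) (Fin n) ℝ} {z : Fin n → ℝ} {α : ℝ}
    (hU : ∀ i j, σ.holds (L ^ 1) (U i j)) (hz : ∀ j, σ.holds (L ^ 1) (z j)) (hd : d ≤ L)
    (hn : n ≤ L) (T : Finset (Fin n)) (hα : σ.holds (L ^ 1) α)
    (hdet : (scaledGram U z T α).det ≠ 0) :
    Comp σ L 60 (evalH U z T α) (α * (gram U z T * (scaledGram U z T α)⁻¹).trace) ∧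
      σ.holds (L ^ 21) (α * (gram U z T * (scaledGram U z T α)⁻¹).trace) := by
  obtain ⟨c₀, s₀⟩ := Comp.evalData hU hz hd hn T hα hdet
  obtain ⟨-, s₁⟩ := Comp.gramProg hU hz hd hn T
  obtain ⟨c₂, s₂⟩ := Comp.matMul (fun a b => SizeMeasure.le (b := 15) (s₁ a b)) s₀ hd hd hd
  obtain ⟨c₃, s₃⟩ := Comp.matTrace s₂ hd
  refine ⟨?_, SizeMeasure.le (SizeMeasure.mul hα s₃)⟩
  unfold FrameScaling.evalH
  exact c₀.bind (c₂.bind (c₃.bind (Comp.mul hα s₃).mono)) (e := 59)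

theorem Comp.evalDerivH {U : Matrix (Fin d) (Fin n) ℝ} {z : Fin n → ℝ} {α : ℝ}
    (hU : ∀ i j, σ.holds (L ^ 1) (U i j)) (hz : ∀ j, σ.holds (L ^ 1) (z j)) (hd : d ≤ L)
    (hn : n ≤ L) (T : Finset (Fin n)) (hα : σ.holds (L ^ 1) α)
    (hdet : (scaledGram U z T α).det ≠ 0) :
    Comp σ L 60 (evalDerivH U z T α)
      (gram U z T * (scaledGram U z T α)⁻¹ * (gram U z Tᶜ * (scaledGram U z T α)⁻¹)).trace ∧
      σ.holds (L ^ 23)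
        (gram U z T * (scaledGram U z T α)⁻¹ * (gram U z Tᶜ * (scaledGram U z T α)⁻¹)).trace := by
  obtain ⟨c₀, s₀⟩ := Comp.evalData hU hz hd hn T hα hdet
  obtain ⟨-, s₁⟩ := Comp.gramProg hU hz hd hn T
  obtain ⟨-, s₁'⟩ := Comp.gramProg hU hz hd hn Tᶜ
  obtain ⟨c₂, s₂⟩ := Comp.matMul (fun a b => SizeMeasure.le (b := 15) (s₁ a b)) s₀ hd hd hd
  obtain ⟨c₃, s₃⟩ := Comp.matMul (fun a b => SizeMeasure.le (b := 15) (s₁' a b)) s₀ hd hd hd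
  obtain ⟨c₄, s₄⟩ := Comp.matMul s₂ s₃ hd hd hd
  obtain ⟨c₅, s₅⟩ := Comp.matTrace s₄ hd
  refine ⟨?_, s₅⟩
  unfold FrameScaling.evalDerivH
  exact c₀.bind (c₂.bind (c₃.bind (c₄.bind c₅.mono))) (e := 59)

/-! ### Large principal subdeterminants -/

/-- The determinant of the principal submatrix with index set `D`. -/
def principalMinor (K : Matrix (Fin n) (Fin n) ℝ) (D : Finset (Fin n)) : ℝ :=
  (K.submatrix (D.orderEmbOfFin rfl) (D.orderEmbOfFin rfl)).det

theorem Comp.subDet {e : ℕ} {K : Matrix (Fin n) (Fin n) ℝ}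
    (hK : ∀ i j, σ.holds (L ^ e) (K i j)) (hn : n ≤ L) (D : Finset (Fin n)) :
    Comp σ L (e + 35) (subDet K D) (principalMinor K D) ∧
      σ.holds (L ^ (e + 6)) (principalMinor K D) :=
  Comp.matDet (A := K.submatrix (D.orderEmbOfFin rfl) (D.orderEmbOfFin rfl))
    (fun _ _ => hK _ _) ((card_finset_fin_le D).trans hn)

/-- The maximizer does at least as well as the element supplied by `hstep`, so a round loses at most
a factor c, starting from the empty determinant 1. -/
theorem Cost.greedy {e : ℕ} {K : Matrix (Fin n) (Fin n) ℝ}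
    (hK : ∀ i j, σ.holds (L ^ e) (K i j)) (hn : n ≤ L) {T : Finset (Fin n)} {c : ℝ} (hc : 0 < c)
    {p : ℕ} (hstep : ∀ G ⊆ T, G.card < p → 0 < principalMinor K G →
      ∃ j ∈ T \ G, c * principalMinor K G ≤ principalMinor K (insert j G)) :
    ∀ k, k ≤ p → ∃ G, Cost σ (k * L ^ (e + 38)) (L ^ (e + 38)) (greedy K T k) G ∧ G ⊆ T ∧
      G.card = k ∧ c ^ k ≤ principalMinor K G
  | 0, _ => ⟨∅, Cost.ret _ _ _, by simp, by simp, by simp [principalMinor]⟩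
  | k + 1, hk => by
    obtain ⟨G, hG, hGT, hGk, hGc⟩ := Cost.greedy hK hn hc hstep k (by omega)
    have hpos : 0 < principalMinor K G := (pow_pos hc k).trans_le hGc
    obtain ⟨j, hj, hjc⟩ := hstep G hGT (by omega) hpos
    obtain ⟨r, hr, hmax⟩ := Comp.argmax (f := fun i => FrameScaling.subDet K (insert i G))
      (g := fun i => principalMinor K (insert i G))
      (l := (List.finRange n).filter (· ∈ T \ G))
      (fun i _ => (Comp.subDet (σ := σ) hK hn (insert i G)).1)
      ((length_filter_finRange_le _).trans (hn.trans (by have := hL.out; nlinarith)))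
    have hjl : j ∈ (List.finRange n).filter (· ∈ T \ G) := by simpa using hj
    rcases hmax with ⟨hnil, -⟩ | ⟨i, hi, rfl, hmax⟩
    · rw [hnil] at hjl
      simp at hjl
    have hi' : i ∈ T \ G := by simpa using hi
    rw [Finset.mem_sdiff] at hi'
    refine ⟨insert i G, ?_, ?_, ?_, ?_⟩
    · refine (Cost.bind hG (Cost.bind hr.cost (Cost.ret (insert i G) 0 _))).mono ?_ le_rfl
      simp only [add_mul, one_mul, add_zero]
      exact le_of_eq (by ring_nf)
    · exact Finset.insert_subset hi'.1 hGT
    · rw [Finset.card_insert_of_notMem hi'.2, hGk]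
    · calc c ^ (k + 1) = c * c ^ k := by ring
        _ ≤ c * principalMinor K G := by gcongr
        _ ≤ _ := hjc
        _ ≤ _ := hmax j hjl

/-- `D` is a local optimum, up to a factor of two, for exchanges with elements of `T`. -/
def ExchangeOptimal (K : Matrix (Fin n) (Fin n) ℝ) (T D : Finset (Fin n)) : Prop :=
  ∀ i ∈ D, ∀ j ∈ T \ D, principalMinor K (insert j (D.erase i)) ≤ 2 * principalMinor K D

theorem Comp.localSearchStep {e : ℕ} {K : Matrix (Fin n) (Fin n) ℝ}
    (hK : ∀ i j, σ.holds (L ^ e) (K i j)) (hn : n ≤ L) (T D : Finset (Fin n)) :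
    ∃ r, Comp σ L (e + 45) (localSearchStep K T D) r ∧
      ((r = Sum.inr D ∧ ExchangeOptimal K T D) ∨
        ∃ i ∈ D, ∃ j ∈ T \ D, r = Sum.inl (insert j (D.erase i)) ∧
          2 * principalMinor K D < principalMinor K (insert j (D.erase i))) := by
  obtain ⟨c₀, s₀⟩ := Comp.subDet (σ := σ) hK hn D
  have hlen : (((List.finRange n).filter (· ∈ D)).product
      ((List.finRange n).filter (· ∈ T \ D))).length ≤ L ^ 2 := by
    refine (List.length_product _ _).le.trans ?_
    rw [sq]
    exact Nat.mul_le_mul ((length_filter_finRange_le _).trans hn)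
      ((length_filter_finRange_le _).trans hn)
  obtain ⟨r, hr, hmax⟩ := Comp.argmax
    (f := fun ij : Fin n × Fin n => FrameScaling.subDet K (insert ij.2 (D.erase ij.1)))
    (g := fun ij => principalMinor K (insert ij.2 (D.erase ij.1)))
    (fun ij _ => (Comp.subDet (σ := σ) hK hn (insert ij.2 (D.erase ij.1))).1) hlen
  have hmem : ∀ ij : Fin n × Fin n, ij ∈ ((List.finRange n).filter (· ∈ D)).product
      ((List.finRange n).filter (· ∈ T \ D)) ↔ ij.1 ∈ D ∧ ij.2 ∈ T \ D := by
    rintro ⟨i, j⟩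
    simp
  unfold FrameScaling.localSearchStep
  rcases hmax with ⟨hnil, rfl⟩ | ⟨ij, hij, rfl, hmax⟩
  · refine ⟨Sum.inr D, (c₀.bind (e := e + 39) (hr.bind (e := e + 38) ?_)).mono,
      Or.inl ⟨rfl, fun i hi j hj => ?_⟩⟩
    · exact Comp.ret _ _
    have := (hmem (i, j)).2 ⟨hi, hj⟩
    rw [hnil] at this
    simp at this
  have hadd := Comp.add s₀ s₀
  rw [← two_mul] at hadd
  have hlt := Comp.lt (σ := σ) (L := L) (2 * principalMinor K D)
    (principalMinor K (insert ij.2 (D.erase ij.1)))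
  by_cases h : 2 * principalMinor K D < principalMinor K (insert ij.2 (D.erase ij.1))
  · refine ⟨Sum.inl (insert ij.2 (D.erase ij.1)), ?_,
      Or.inr ⟨ij.1, ((hmem _).1 hij).1, ij.2, ((hmem _).1 hij).2, rfl, h⟩⟩
    refine (c₀.bind (hr.bind (e := e + 38) (hadd.bind (e := e + 37) (hlt.bind (e := e + 36) ?_)))).mono
    simp only [h, decide_true, if_true]
    exact Comp.ret _ _
  · refine ⟨Sum.inr D, ?_, Or.inl ⟨rfl, fun i hi j hj => ?_⟩⟩
    · refine (c₀.bind (hr.bind (e := e + 38) (hadd.bind (e := e + 37)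
        (hlt.bind (e := e + 36) ?_)))).mono
      simp only [h, decide_false, Bool.false_eq_true, if_false]
      exact Comp.ret _ _
    · exact (hmax (i, j) ((hmem _).2 ⟨hi, hj⟩)).trans (not_lt.1 h)

/-- The minor is a potential: each exchange more than doubles it and B bounds it from above, so
every exchange uses up one factor two of the assumed gap 2 ^ N. -/
theorem Cost.localSearch {e p : ℕ} {K : Matrix (Fin n) (Fin n) ℝ}
    (hK : ∀ i j, σ.holds (L ^ e) (K i j)) (hn : n ≤ L) {T : Finset (Fin n)} {B : ℝ}
    (hB : ∀ D ⊆ T, D.card = p → principalMinor K D ≤ B) : ∀ (N : ℕ) (D : Finset (Fin n)),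
    D ⊆ T → D.card = p → 0 < principalMinor K D → B < 2 ^ N * principalMinor K D →
    ∃ D', Cost σ (N * L ^ (e + 45)) (L ^ (e + 45)) (Prog.loop (localSearchStep K T) D) D' ∧
      D' ⊆ T ∧ D'.card = p ∧ 0 < principalMinor K D' ∧ ExchangeOptimal K T D'
  | 0, D, hDT, hDp, hD, hBD => by
    have := hB D hDT hDp
    simp at hBD
    linarith
  | N + 1, D, hDT, hDp, hD, hBD => by
    obtain ⟨r, ⟨t, vs, hr, ht, hv⟩, h⟩ := Comp.localSearchStep (σ := σ) hK hn T D
    rcases h with ⟨rfl, hopt⟩ | ⟨i, hi, j, hj, rfl, hlt⟩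
    · refine ⟨D, ⟨t, vs, LoopRuns.exit hr, ?_, hv⟩, hDT, hDp, hD, hopt⟩
      rw [add_mul]
      omega
    · rw [Finset.mem_sdiff] at hj
      obtain ⟨D', ⟨t', vs', hr', ht', hv'⟩, h'⟩ := Cost.localSearch hK hn hB N
        (insert j (D.erase i))
        (Finset.insert_subset hj.1 ((Finset.erase_subset _ _).trans hDT))
        (by
          rw [Finset.card_insert_of_notMem (fun h => hj.2 (Finset.mem_of_mem_erase h)),
            Finset.card_erase_of_mem hi, hDp]
          have := Finset.card_pos.2 ⟨i, hi⟩
          omega)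
        (by linarith)
        (by
          refine hBD.trans_le ?_
          rw [pow_succ, mul_assoc]
          gcongr)
      refine ⟨D', ⟨t + t', vs ++ vs', LoopRuns.next hr hr', ?_, ?_⟩, h'⟩
      · rw [add_mul]
        omega
      · intro v hm
        rcases List.mem_append.1 hm with h | h
        · exact hv v h
        · exact hv' v h

theorem Comp.detLocalOpt {U : Matrix (Fin d) (Fin n) ℝ} {z : Fin n → ℝ}
    {W : Matrix (Fin d) (Fin d) ℝ} (hU : ∀ i j, σ.holds (L ^ 1) (U i j))
    (hz : ∀ j, σ.holds (L ^ 1) (z j)) (hW : ∀ i j, σ.holds (L ^ 13) (W i j)) (hd : d ≤ L)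
    (hn : n ≤ L) {T : Finset (Fin n)} {p : ℕ} (hp : p ≤ L) {c B : ℝ} {N : ℕ} (hc : 0 < c)
    (hN : N ≤ L ^ 3) (hBN : B < 2 ^ N * c ^ p)
    (hB : ∀ D ⊆ T, D.card = p → principalMinor (Uᵀ * (W * U) * Matrix.diagonal z) D ≤ B)
    (hstep : ∀ G ⊆ T, G.card < p → 0 < principalMinor (Uᵀ * (W * U) * Matrix.diagonal z) G →
      ∃ j ∈ T \ G, c * principalMinor (Uᵀ * (W * U) * Matrix.diagonal z) G
        ≤ principalMinor (Uᵀ * (W * U) * Matrix.diagonal z) (insert j G)) :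
    ∃ D, Comp σ L 75 (detLocalOpt U z W T p) D ∧ D ⊆ T ∧ D.card = p ∧
      0 < principalMinor (Uᵀ * (W * U) * Matrix.diagonal z) D ∧
      ExchangeOptimal (Uᵀ * (W * U) * Matrix.diagonal z) T D := by
  obtain ⟨c₁, s₁⟩ := Comp.matMul hW (fun i j => SizeMeasure.le (b := 13) (hU i j)) hd hd hn
  obtain ⟨c₂, s₂⟩ := Comp.matMul (A := Uᵀ) (fun i j => SizeMeasure.le (b := 16) (hU j i)) s₁
    hn hd hn
  set K := Uᵀ * (W * U) * Matrix.diagonal z with hKdef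
  have hKij : ∀ i j, K i j = (Uᵀ * (W * U)) i j * z j := fun i j => by
    rw [hKdef, Matrix.mul_diagonal]
  have s₃ : ∀ i j, σ.holds (L ^ 20) (K i j) := fun i j => by
    rw [hKij]
    exact SizeMeasure.le (SizeMeasure.mul (s₂ i j) (hz j))
  have c₃ : Comp σ L 22 (FrameScaling.tabulate₂ n n (fun i j =>
      Prog.arith .mul ((Uᵀ * (W * U)) i j) (z j))) K := by
    refine Comp.tabulate₂ (fun i j => ?_) hn hn
    rw [hKij]
    exact (Comp.mul (s₂ i j) (hz j)).mono
  obtain ⟨G, hG, hGT, hGp, hGc⟩ := Cost.greedy s₃ hn hc hstep p le_rfl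
  have hpos : 0 < principalMinor K G := (pow_pos hc p).trans_le hGc
  obtain ⟨D, hD, hprop⟩ := Cost.localSearch s₃ hn hB N G hGT hGp hpos
    (hBN.trans_le (mul_le_mul_of_nonneg_left hGc (by positivity)))
  refine ⟨D, ?_, hprop⟩
  unfold FrameScaling.detLocalOpt
  have hG' := hG.comp (e' := 1) (by simpa using hp)
  have hD' := hD.comp (e' := 3) hN
  exact c₁.bind (c₂.bind (c₃.bind (hG'.bind hD'.mono))) (e := 74)

/-- The trace of the part of `X` that a projection with range `span U_D` leaves over. -/
noncomputable def residualTrace (U : Matrix (Fin d) (Fin n) ℝ) (W X : Matrix (Fin d) (Fin d) ℝ)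
    (D : Finset (Fin n)) : ℝ :=
  let V := U.submatrix id (D.orderEmbOfFin rfl)
  ((1 - V * (Vᵀ * W * V)⁻¹ * (Vᵀ * W)) * X).trace

theorem Comp.projectedTrace {U : Matrix (Fin d) (Fin n) ℝ} {W X : Matrix (Fin d) (Fin d) ℝ}
    (hU : ∀ i j, σ.holds (L ^ 1) (U i j)) (hW : ∀ i j, σ.holds (L ^ 13) (W i j))
    (hX : ∀ i j, σ.holds (L ^ 16) (X i j)) (hd : d ≤ L) (hn : n ≤ L) (D : Finset (Fin n))
    (hdet : ((U.submatrix id (D.orderEmbOfFin rfl))ᵀ * W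
      * U.submatrix id (D.orderEmbOfFin rfl)).det ≠ 0) :
    Comp σ L 75 (projectedTrace U W X D) (residualTrace U W X D) ∧
      σ.holds (L ^ 50) (residualTrace U W X D) := by
  have hD : D.card ≤ L := (card_finset_fin_le D).trans hn
  set V : Matrix (Fin d) (Fin D.card) ℝ := U.submatrix id (D.orderEmbOfFin rfl) with hV
  obtain ⟨c₁, s₁⟩ := Comp.matMul (A := Vᵀ) (B := W) (e := 13)
    (fun i j => SizeMeasure.le (hU _ _)) hW hD hd hd
  obtain ⟨c₂, s₂⟩ := Comp.matMul (A := Vᵀ * W) (B := V) (e := 16) s₁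
    (fun i j => SizeMeasure.le (hU _ _)) hD hd hD
  obtain ⟨c₃, s₃⟩ := Comp.matInv s₂ hD hdet
  obtain ⟨c₄, s₄⟩ := Comp.matMul (A := V) (e := 26)
    (fun i j => SizeMeasure.le (hU _ _)) s₃ hd hD hD
  obtain ⟨c₅, s₅⟩ := Comp.matMul (e := 29) s₄ (fun i j => SizeMeasure.le (s₁ i j)) hd hD hd
  have s₆ : ∀ a b, σ.holds (L ^ 33)
      ((1 - V * (Vᵀ * W * V)⁻¹ * (Vᵀ * W) : Matrix (Fin d) (Fin d) ℝ) a b) := by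
    intro a b
    rw [Matrix.sub_apply, Matrix.one_apply]
    refine SizeMeasure.le (SizeMeasure.sub (a := 0) ?_ (s₅ a b))
    split_ifs
    · exact SizeMeasure.one_le 0
    · exact SizeMeasure.zero_le 0
  have c₆ : Comp σ L 35 (FrameScaling.tabulate₂ d d (fun a b => Prog.arith .sub
      (if a = b then 1 else 0) ((V * (Vᵀ * W * V)⁻¹ * (Vᵀ * W)) a b)))
      (1 - V * (Vᵀ * W * V)⁻¹ * (Vᵀ * W) : Matrix (Fin d) (Fin d) ℝ) := by
    refine Comp.tabulate₂ (fun a b => ?_) hd hd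
    rw [Matrix.sub_apply, Matrix.one_apply]
    refine (Comp.sub (a := 0) ?_ (s₅ a b)).mono
    split_ifs
    · exact SizeMeasure.one_le 0
    · exact SizeMeasure.zero_le 0
  obtain ⟨c₇, s₇⟩ := Comp.matMul s₆ (fun i j => SizeMeasure.le (b := 33) (hX i j)) hd hd hd
  obtain ⟨c₈, s₈⟩ := Comp.matTrace s₇ hd
  refine ⟨?_, SizeMeasure.le s₈⟩
  unfold FrameScaling.projectedTrace
  exact c₁.bind (c₂.bind (c₃.bind (c₄.bind (c₅.bind (Comp.zero.bind (Comp.one.bind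
    (c₆.bind (c₇.bind c₈.mono)))))))) (e := 74)

/-- The hypotheses isolate the spectral input. A nonzero coefficient with index `j₀` above p rules
out the exit with output 0; `hB` and `hstep` bound the search, and `hG` makes the final inversion
legitimate. -/
theorem Comp.approxSmallEigenSum {U : Matrix (Fin d) (Fin n) ℝ} {z : Fin n → ℝ}
    {W X : Matrix (Fin d) (Fin d) ℝ} {T : Finset (Fin n)}
    (hU : ∀ i j, σ.holds (L ^ 1) (U i j)) (hz : ∀ j, σ.holds (L ^ 1) (z j)) (hd : d ≤ L)
    (hn : n ≤ L) (hdet : (gram U z Finset.univ).det ≠ 0)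
    (hW : W = (gram U z Finset.univ)⁻¹) (hX : X = gram U z T * W)
    {p : ℕ} (hp : p ≤ d) (hp₁ : (p : ℝ) - 1 / 2 < X.trace) (hp₂ : X.trace < p + 1 / 2)
    {j₀ : ℕ} (hj₀ : p < j₀) (hj₀d : j₀ ≤ d) (hj₀c : flCoeff (gram U z T) j₀ ≠ 0)
    {c B : ℝ} {N : ℕ} (hc : 0 < c) (hN : N ≤ L ^ 3) (hBN : B < 2 ^ N * c ^ p)
    (hB : ∀ D ⊆ T, D.card = p → principalMinor (Uᵀ * (W * U) * Matrix.diagonal z) D ≤ B)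
    (hstep : ∀ G ⊆ T, G.card < p → 0 < principalMinor (Uᵀ * (W * U) * Matrix.diagonal z) G →
      ∃ j ∈ T \ G, c * principalMinor (Uᵀ * (W * U) * Matrix.diagonal z) G
        ≤ principalMinor (Uᵀ * (W * U) * Matrix.diagonal z) (insert j G))
    (hG : ∀ D ⊆ T, 0 < principalMinor (Uᵀ * (W * U) * Matrix.diagonal z) D →
      ((U.submatrix id (D.orderEmbOfFin rfl))ᵀ * W
      * U.submatrix id (D.orderEmbOfFin rfl)).det ≠ 0) :
    ∃ μ, Comp σ L 90 (approxSmallEigenSum U z T) μ ∧ σ.holds (L ^ 50) μ ∧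
      ((p = 0 ∧ μ = X.trace) ∨ ∃ D ⊆ T, D.card = p ∧
        0 < principalMinor (Uᵀ * (W * U) * Matrix.diagonal z) D ∧
        ExchangeOptimal (Uᵀ * (W * U) * Matrix.diagonal z) T D ∧ μ = residualTrace U W X D) := by
  obtain ⟨c₁, s₁⟩ := Comp.gramProg hU hz hd hn Finset.univ
  obtain ⟨c₂, s₂⟩ := Comp.matInv s₁ hd hdet
  rw [← hW] at c₂ s₂
  obtain ⟨c₃, s₃⟩ := Comp.gramProg hU hz hd hn T
  obtain ⟨c₄, s₄⟩ := Comp.matMul (fun i j => SizeMeasure.le (b := 13) (s₃ i j)) s₂ hd hd hd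
  rw [← hX] at c₄ s₄
  obtain ⟨c₅, s₅⟩ := Comp.matTrace s₄ hd
  have c₆ := Comp.nearestUpTo (σ := σ) (L := L) X.trace hd hp hp₁ hp₂
  obtain ⟨r, c₇, hr⟩ := Comp.symRank (σ := σ) s₃ hd
  have hpr : p ≠ r := by
    have := hr j₀ hj₀d hj₀c
    omega
  unfold FrameScaling.approxSmallEigenSum
  by_cases hp0 : p = 0
  · refine ⟨X.trace, ?_, SizeMeasure.le s₅, Or.inl ⟨hp0, rfl⟩⟩
    refine c₁.bind (c₂.bind (c₃.bind (c₄.bind (c₅.bind (c₆.bind (c₇.bind (e := 83) ?_))))))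
    simp only [hp0, if_true]
    rw [if_neg (by omega)]
    exact Comp.ret _ _
  · obtain ⟨D, c₈, hDT, hDp, hDpos, hDopt⟩ := Comp.detLocalOpt (σ := σ) hU hz s₂ hd hn (hp.trans hd)
      hc hN hBN hB hstep
    obtain ⟨c₉, s₉⟩ := Comp.projectedTrace (σ := σ) hU s₂ s₄ hd hn D (hG D hDT hDpos)
    refine ⟨_, ?_, s₉, Or.inr ⟨D, hDT, hDp, hDpos, hDopt, rfl⟩⟩
    refine c₁.bind (c₂.bind (c₃.bind (c₄.bind (c₅.bind (c₆.bind (c₇.bind (e := 83) ?_))))))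
    simp only [hpr, if_false, hp0]
    exact (c₈.bind c₉).mono

end AlgorithmSpecs

/-! ## Gram determinants and orthogonal projections -/

section Gram

variable {d n : ℕ} {ι : Type*} [Fintype ι] [DecidableEq ι]

/-- A principal minor does not depend on the enumeration of the index set. This permits an order
adapted to appending or deleting an index instead of the increasing one. -/
theorem principalMinor_eq_det {K : Matrix (Fin n) (Fin n) ℝ} {D : Finset (Fin n)} {f : ι → Fin n}
    (hf : Function.Injective f) (hD : ∀ j, j ∈ D ↔ ∃ i, f i = j) :
    principalMinor K D = (K.submatrix f f).det := by
  let e : Fin D.card ≃ ι := (D.orderIsoOfFin rfl).toEquiv.trans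
    ((Equiv.subtypeEquivRight fun j => hD j).trans (Equiv.ofInjective f hf).symm)
  have he : ∀ i, f (e i) = D.orderEmbOfFin rfl i := by
    intro i
    have := Equiv.apply_ofInjective_symm hf
      (Equiv.subtypeEquivRight (fun j => hD j) (D.orderIsoOfFin rfl i))
    exact this
  rw [← Matrix.det_submatrix_equiv_self e, Matrix.submatrix_submatrix]
  unfold principalMinor
  congr 1
  ext i j
  simp [he]

/-- The orthogonal projection onto the span of the columns of `A`. -/
noncomputable def columnProj (A : Matrix (Fin d) ι ℝ) : Matrix (Fin d) (Fin d) ℝ :=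
  A * (Aᵀ * A)⁻¹ * Aᵀ

variable {A : Matrix (Fin d) ι ℝ}

theorem columnProj_transpose : (columnProj A)ᵀ = columnProj A := by
  simp [columnProj, Matrix.transpose_mul, Matrix.transpose_nonsing_inv, Matrix.mul_assoc]

theorem columnProj_mul_self (hA : (Aᵀ * A).det ≠ 0) : columnProj A * A = A := by
  have h : IsUnit (Aᵀ * A).det := hA.isUnit
  rw [columnProj, Matrix.mul_assoc, Matrix.mul_assoc, Matrix.nonsing_inv_mul _ h, Matrix.mul_one]

theorem columnProj_idem (hA : (Aᵀ * A).det ≠ 0) :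
    columnProj A * columnProj A = columnProj A := by
  conv_lhs => rw [columnProj.eq_1 A, ← columnProj.eq_1 A, columnProj, ← Matrix.mul_assoc,
    ← Matrix.mul_assoc, ← columnProj, columnProj_mul_self hA]
  rfl

theorem trace_columnProj (hA : (Aᵀ * A).det ≠ 0) : (columnProj A).trace = Fintype.card ι := by
  rw [columnProj, Matrix.mul_assoc, Matrix.trace_mul_comm, Matrix.mul_assoc,
    Matrix.nonsing_inv_mul _ hA.isUnit, Matrix.trace_one]

theorem columnProj_diag (hA : (Aᵀ * A).det ≠ 0) (i : Fin d) :
    columnProj A i i = ∑ k, columnProj A i k ^ 2 := by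
  conv_lhs => rw [← columnProj_idem hA]
  rw [Matrix.mul_apply]
  refine Finset.sum_congr rfl fun k _ => ?_
  rw [sq]
  congr 1
  conv_lhs => rw [← columnProj_transpose, Matrix.transpose_apply]

theorem columnProj_diag_nonneg (hA : (Aᵀ * A).det ≠ 0) (i : Fin d) : 0 ≤ columnProj A i i := by
  rw [columnProj_diag hA]
  positivity

theorem columnProj_diag_le_one (hA : (Aᵀ * A).det ≠ 0) (i : Fin d) : columnProj A i i ≤ 1 := by
  have h : columnProj A i i ^ 2 ≤ columnProj A i i := by
    conv_rhs => rw [columnProj_diag hA]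
    exact Finset.single_le_sum (f := fun k => columnProj A i k ^ 2) (fun k _ => sq_nonneg _)
      (Finset.mem_univ i)
  nlinarith

theorem trace_residual (A : Matrix (Fin d) ι ℝ) (μ : Fin d → ℝ) :
    ((1 - columnProj A) * Matrix.diagonal μ).trace = ∑ i, μ i * (1 - columnProj A i i) := by
  rw [Matrix.trace]
  refine Finset.sum_congr rfl fun i _ => ?_
  simp [Matrix.mul_diagonal, mul_comm]

/-- The sum of the entries smaller than `1/2`. -/
noncomputable def smallSum (μ : Fin d → ℝ) : ℝ := ∑ i with μ i < 1 / 2, μ i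

/-- The number of entries that are at least `1/2`. -/
noncomputable def largeCount (μ : Fin d → ℝ) : ℕ := (Finset.univ.filter fun i => ¬ μ i < 1 / 2).card

theorem smallSum_nonneg {μ : Fin d → ℝ} (h0 : ∀ i, 0 ≤ μ i) : 0 ≤ smallSum μ :=
  Finset.sum_nonneg fun i _ => h0 i

/-- The trace is ∑ μᵢ(1 - Pᵢᵢ) with Pᵢᵢ in [0, 1]. Small terms are at least μᵢ - Pᵢᵢ/2, large ones
at least (1 - Pᵢᵢ)/2, and tr P is the number of columns. With `largeCount μ` columns this is the
lower bound for the output; with fewer, it makes the trace at least 1/2. -/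
theorem smallSum_add_le_trace {μ : Fin d → ℝ} (hA : (Aᵀ * A).det ≠ 0) :
    smallSum μ + ((largeCount μ : ℝ) - Fintype.card ι) / 2 ≤
      ((1 - columnProj A) * Matrix.diagonal μ).trace := by
  rw [trace_residual, ← trace_columnProj hA, Matrix.trace, smallSum, largeCount,
    Finset.card_eq_sum_ones, Nat.cast_sum,
    ← Finset.sum_filter_add_sum_filter_not Finset.univ (fun i => μ i < 1 / 2)
      (fun i => μ i * (1 - columnProj A i i)),
    ← Finset.sum_filter_add_sum_filter_not Finset.univ (fun i => μ i < 1 / 2)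
      (fun i => (columnProj A).diag i)]
  have h₁ : ∑ i with μ i < 1 / 2, (μ i - (columnProj A).diag i / 2) ≤
      ∑ i with μ i < 1 / 2, μ i * (1 - columnProj A i i) := by
    refine Finset.sum_le_sum fun i hi => ?_
    have hi' := (Finset.mem_filter.1 hi).2
    have := columnProj_diag_nonneg hA i
    simp only [Matrix.diag_apply]
    nlinarith
  have h₂ : ∑ i with ¬ μ i < 1 / 2, (((1 : ℕ) : ℝ) / 2 - (columnProj A).diag i / 2) ≤
      ∑ i with ¬ μ i < 1 / 2, μ i * (1 - columnProj A i i) := by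
    refine Finset.sum_le_sum fun i hi => ?_
    have hi' := (Finset.mem_filter.1 hi).2
    have := columnProj_diag_le_one hA i
    simp only [Matrix.diag_apply, Nat.cast_one]
    nlinarith
  rw [Finset.sum_sub_distrib, ← Finset.sum_div] at h₁
  rw [Finset.sum_sub_distrib, ← Finset.sum_div, ← Finset.sum_div] at h₂
  linarith

/-- Replacing μᵢ by 1 on the large coordinates and dropping Pᵢᵢ on the small ones bounds the trace
by μ_s plus the part of P that sits on the small coordinates, which is a multiple of μ_s. -/
theorem trace_le_smallSum {μ : Fin d → ℝ} (h0 : ∀ i, 0 ≤ μ i) (h1 : ∀ i, μ i ≤ 1)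
    (hA : (Aᵀ * A).det ≠ 0) (hcard : Fintype.card ι = largeCount μ)
    (hrow : ∀ i, ∑ a, A i a ^ 2 ≤ μ i) :
    ((1 - columnProj A) * Matrix.diagonal μ).trace
      ≤ smallSum μ * (1 + ((Aᵀ * A)⁻¹ : Matrix ι ι ℝ).trace) := by
  -- Write P = C Aᵀ with C = A(AᵀA)⁻¹, whose squared Frobenius norm is tr (AᵀA)⁻¹. Since Pᵢᵢ is the
  -- squared norm of column i of P, Cauchy–Schwarz bounds it by that norm times the squared norm of
  -- row i of A.
  have hbound : ∀ i, columnProj A i i ≤ ((Aᵀ * A)⁻¹ : Matrix ι ι ℝ).trace * μ i := by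
    intro i
    set G := Aᵀ * A with hG
    have hGt : (G⁻¹)ᵀ = G⁻¹ := by rw [Matrix.transpose_nonsing_inv]; simp [hG]
    set C := A * G⁻¹ with hC
    have hCC : Cᵀ * C = G⁻¹ := by
      rw [hC, Matrix.transpose_mul, hGt, Matrix.mul_assoc, ← Matrix.mul_assoc Aᵀ, ← hG,
        Matrix.mul_nonsing_inv _ hA.isUnit, Matrix.mul_one]
    have hP : columnProj A i i = ∑ r, (∑ a, C r a * A i a) ^ 2 := by
      rw [columnProj_diag hA]
      refine Finset.sum_congr rfl fun r _ => ?_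
      have : columnProj A i r = columnProj A r i := by
        conv_lhs => rw [← columnProj_transpose, Matrix.transpose_apply]
      rw [this, columnProj, Matrix.mul_apply]
      rfl
    have hT : (G⁻¹).trace = ∑ r, ∑ a, C r a ^ 2 := by
      rw [← hCC, Matrix.trace, Finset.sum_comm]
      refine Finset.sum_congr rfl fun a _ => ?_
      simp [Matrix.mul_apply, sq]
    have hT0 : 0 ≤ (G⁻¹).trace := by rw [hT]; positivity
    calc columnProj A i i ≤ ∑ r, (∑ a, C r a ^ 2) * ∑ a, A i a ^ 2 := by
          rw [hP]
          exact Finset.sum_le_sum fun r _ => Finset.sum_mul_sq_le_sq_mul_sq _ _ _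
      _ = (G⁻¹).trace * ∑ a, A i a ^ 2 := by rw [← Finset.sum_mul, hT]
      _ ≤ _ := mul_le_mul_of_nonneg_left (hrow i) hT0
  -- P has trace `largeCount μ`, so what its diagonal lacks on the large coordinates it has on the
  -- small ones.
  have htr := trace_columnProj hA
  rw [hcard, largeCount, Finset.card_eq_sum_ones, Nat.cast_sum, Matrix.trace,
    ← Finset.sum_filter_add_sum_filter_not Finset.univ (fun i => μ i < 1 / 2)
      (fun i => (columnProj A).diag i)] at htr
  rw [trace_residual, smallSum,
    ← Finset.sum_filter_add_sum_filter_not Finset.univ (fun i => μ i < 1 / 2)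
      (fun i => μ i * (1 - columnProj A i i))]
  have h₁ : ∑ i with μ i < 1 / 2, μ i * (1 - columnProj A i i) ≤ ∑ i with μ i < 1 / 2, μ i := by
    refine Finset.sum_le_sum fun i hi => ?_
    have := columnProj_diag_nonneg hA i
    have := h0 i
    nlinarith
  have h₂ : ∑ i with ¬ μ i < 1 / 2, μ i * (1 - columnProj A i i) ≤
      ∑ i with ¬ μ i < 1 / 2, (((1 : ℕ) : ℝ) - (columnProj A).diag i) := by
    refine Finset.sum_le_sum fun i hi => ?_
    have := columnProj_diag_le_one hA i
    have := h1 i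
    simp only [Matrix.diag_apply, Nat.cast_one]
    nlinarith
  have h₃ : ∑ i with μ i < 1 / 2, (columnProj A).diag i ≤
      ∑ i with μ i < 1 / 2, ((Aᵀ * A)⁻¹ : Matrix ι ι ℝ).trace * μ i :=
    Finset.sum_le_sum fun i _ => hbound i
  rw [Finset.sum_sub_distrib] at h₂
  rw [← Finset.mul_sum] at h₃
  linarith

/-! ### Adding and removing a vector -/

variable {Y : Matrix (Fin d) (Fin n) ℝ}

/-- The columns of `Y` with index in `D`. -/
def columns (Y : Matrix (Fin d) (Fin n) ℝ) (D : Finset (Fin n)) : Matrix (Fin d) (Fin D.card) ℝ :=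
  Y.submatrix id (D.orderEmbOfFin rfl)

theorem principalMinor_gram (D : Finset (Fin n)) :
    principalMinor (Yᵀ * Y) D = ((columns Y D)ᵀ * columns Y D).det := by
  unfold principalMinor columns
  rw [Matrix.transpose_submatrix, Matrix.submatrix_mul _ _ _ id _ Function.bijective_id]

/-- The Gram matrix of the residuals of the columns of `Y` after projecting out those in `D`. -/
noncomputable def residualGram (Y : Matrix (Fin d) (Fin n) ℝ) (D : Finset (Fin n)) :
    Matrix (Fin n) (Fin n) ℝ :=
  Yᵀ * (1 - columnProj (columns Y D)) * Y

/-- Schur complement: appending a vector multiplies the Gram determinant by its squared distance to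
the span. -/
theorem principalMinor_insert {D : Finset (Fin n)} (hD : principalMinor (Yᵀ * Y) D ≠ 0)
    {j : Fin n} (hj : j ∉ D) :
    principalMinor (Yᵀ * Y) (insert j D) = principalMinor (Yᵀ * Y) D *
      residualGram Y D j j := by
  let f : Fin D.card ⊕ Unit → Fin n := Sum.elim (D.orderEmbOfFin rfl) fun _ => j
  have hf : Function.Injective f := by
    refine Function.Injective.sumElim (D.orderEmbOfFin rfl).injective
      (fun _ _ _ => Subsingleton.elim _ _) fun a _ h => hj ?_
    rw [← h]
    exact D.orderEmbOfFin_mem rfl a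
  have hmem : ∀ k, k ∈ insert j D ↔ ∃ i, f i = k := by
    intro k
    have hr : k ∈ D ↔ ∃ i, D.orderEmbOfFin rfl i = k := by
      rw [← Set.mem_range, Finset.range_orderEmbOfFin, Finset.mem_coe]
    rw [Finset.mem_insert, hr, or_comm, eq_comm]
    simp [f]
  rw [principalMinor_eq_det hf hmem]
  set A := columns Y D with hA
  rw [principalMinor_gram, ← hA] at hD ⊢
  set y : Matrix (Fin d) Unit ℝ := Y.submatrix id fun _ => j with hy
  have hblock : (Yᵀ * Y).submatrix f f
      = Matrix.fromBlocks (Aᵀ * A) (Aᵀ * y) (yᵀ * A) (yᵀ * y) := by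
    ext a b
    rcases a with a | a <;> rcases b with b | b <;>
      simp [f, hA, hy, columns, Matrix.mul_apply]
  have := Matrix.invertibleOfIsUnitDet (Aᵀ * A) hD.isUnit
  rw [hblock, Matrix.det_fromBlocks₁₁, Matrix.invOf_eq_nonsing_inv]
  congr 1
  rw [Matrix.det_unique]
  have : yᵀ * y - yᵀ * A * (Aᵀ * A)⁻¹ * (Aᵀ * y) = yᵀ * (1 - columnProj A) * y := by
    rw [columnProj]
    simp only [Matrix.mul_sub, Matrix.sub_mul, Matrix.mul_one, Matrix.mul_assoc]
  rw [this]
  simp [residualGram, hy, ← hA, Matrix.mul_apply]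

theorem residual_column_eq_zero {D : Finset (Fin n)} (hD : principalMinor (Yᵀ * Y) D ≠ 0)
    {j : Fin n} (hj : j ∈ D) : residualGram Y D j j = 0 := by
  rw [principalMinor_gram] at hD
  have hr : ∃ i, D.orderEmbOfFin rfl i = j := by
    rw [← Set.mem_range, Finset.range_orderEmbOfFin, Finset.mem_coe]; exact hj
  obtain ⟨i, rfl⟩ := hr
  have h0 : (1 - columnProj (columns Y D)) * columns Y D = 0 := by
    rw [Matrix.sub_mul, columnProj_mul_self hD, Matrix.one_mul, sub_self]
  rw [residualGram, Matrix.mul_assoc, Matrix.mul_apply]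
  refine Finset.sum_eq_zero fun k _ => ?_
  have := congrFun (congrFun h0 k) i
  rw [Matrix.mul_apply] at this ⊢
  simp only [columns, Matrix.submatrix_apply, id, Matrix.zero_apply] at this
  rw [show ∑ j, (1 - columnProj (columns Y D)) k j * Y j (D.orderEmbOfFin rfl i) = 0 from this,
    mul_zero]

variable {T : Finset (Fin n)} {μ : Fin d → ℝ}

/-- Each ratio of minors is a squared residual. Elements of D have residual zero, so the sum extends
to all of T, where ∑ yⱼyⱼᵀ = diag μ makes it a trace. -/
theorem sum_principalMinor_insert
    (hY : ∀ i k, ∑ j ∈ T, Y i j * Y k j = Matrix.diagonal μ i k) {D : Finset (Fin n)}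
    (hD : principalMinor (Yᵀ * Y) D ≠ 0) :
    ∑ j ∈ T \ D, principalMinor (Yᵀ * Y) (insert j D) = principalMinor (Yᵀ * Y) D *
      ((1 - columnProj (columns Y D)) * Matrix.diagonal μ).trace := by
  have h₁ : ∑ j ∈ T \ D, principalMinor (Yᵀ * Y) (insert j D) = ∑ j ∈ T \ D,
      principalMinor (Yᵀ * Y) D * residualGram Y D j j :=
    Finset.sum_congr rfl fun j hj => principalMinor_insert hD (Finset.mem_sdiff.1 hj).2
  have h₂ : ∑ j ∈ T \ D, residualGram Y D j j
      = ∑ j ∈ T, residualGram Y D j j := by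
    refine Finset.sum_subset Finset.sdiff_subset fun j hj hj' => ?_
    exact residual_column_eq_zero hD (by simpa [hj] using hj')
  rw [h₁, ← Finset.mul_sum, h₂]
  congr 1
  unfold residualGram
  generalize (1 - columnProj (columns Y D) : Matrix (Fin d) (Fin d) ℝ) = P
  calc ∑ j ∈ T, (Yᵀ * P * Y) j j = ∑ j ∈ T, ∑ k, ∑ i, P i k * (Y k j * Y i j) := by
        refine Finset.sum_congr rfl fun j _ => ?_
        rw [Matrix.mul_apply]
        refine Finset.sum_congr rfl fun k _ => ?_
        rw [Matrix.mul_apply, Finset.sum_mul]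
        exact Finset.sum_congr rfl fun i _ => by rw [Matrix.transpose_apply]; ring
    _ = ∑ k, ∑ i, P i k * ∑ j ∈ T, Y k j * Y i j := by
        rw [Finset.sum_comm]
        refine Finset.sum_congr rfl fun k _ => ?_
        rw [Finset.sum_comm]
        exact Finset.sum_congr rfl fun i _ => (Finset.mul_sum _ _ _).symm
    _ = (P * Matrix.diagonal μ).trace := by
        simp only [hY]
        rw [Finset.sum_comm, Matrix.trace]
        refine Finset.sum_congr rfl fun i _ => ?_
        rw [Matrix.diag_apply, Matrix.mul_apply]

/-- Greedy steps do not lose much. -/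
theorem exists_principalMinor_insert (hμ : ∀ i, 0 ≤ μ i)
    (hY : ∀ i k, ∑ j ∈ T, Y i j * Y k j = Matrix.diagonal μ i k) {D : Finset (Fin n)}
    (hcard : D.card < largeCount μ) (hD : 0 < principalMinor (Yᵀ * Y) D) :
    ∃ j ∈ T \ D, (1 / (2 * n) : ℝ) * principalMinor (Yᵀ * Y) D
      ≤ principalMinor (Yᵀ * Y) (insert j D) := by
  have hsum := sum_principalMinor_insert hY hD.ne'
  -- With fewer than `largeCount μ` columns the trace is at least 1/2, and at most n candidates
  -- share it; hence the factor 1/(2n).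
  have htr := smallSum_add_le_trace (μ := μ) (A := columns Y D)
    (by rw [← principalMinor_gram]; exact hD.ne')
  have hs := smallSum_nonneg hμ
  have hc : (D.card : ℝ) + 1 ≤ largeCount μ := by exact_mod_cast hcard
  rw [Fintype.card_fin] at htr
  by_contra hcon
  push Not at hcon
  have hle : ∑ j ∈ T \ D, principalMinor (Yᵀ * Y) (insert j D) ≤
      ((T \ D).card : ℝ) * ((1 / (2 * n) : ℝ) * principalMinor (Yᵀ * Y) D) := by
    rw [← nsmul_eq_mul]
    exact Finset.sum_le_card_nsmul _ _ _ fun j hj => (hcon j hj).le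
  have hpos : 0 < ∑ j ∈ T \ D, principalMinor (Yᵀ * Y) (insert j D) := by
    rw [hsum]; exact mul_pos hD (by linarith)
  have hne : (T \ D).Nonempty := by
    by_contra h
    rw [Finset.not_nonempty_iff_eq_empty.1 h] at hpos
    simp at hpos
  have hlt : ∑ j ∈ T \ D, principalMinor (Yᵀ * Y) (insert j D) <
      ((T \ D).card : ℝ) * ((1 / (2 * n) : ℝ) * principalMinor (Yᵀ * Y) D) := by
    rw [← nsmul_eq_mul, ← Finset.sum_const]
    exact Finset.sum_lt_sum_of_nonempty hne hcon
  have hn : ((T \ D).card : ℝ) ≤ n := by exact_mod_cast card_finset_fin_le _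
  have hn0 : (0 : ℝ) < n := lt_of_lt_of_le (by exact_mod_cast Finset.card_pos.2 hne) hn
  have h3 : ((T \ D).card : ℝ) * ((1 / (2 * n) : ℝ) * principalMinor (Yᵀ * Y) D) ≤
      n * ((1 / (2 * n) : ℝ) * principalMinor (Yᵀ * Y) D) := by gcongr
  have h4 : n * ((1 / (2 * n) : ℝ) * principalMinor (Yᵀ * Y) D)
      = principalMinor (Yᵀ * Y) D * (1 / 2) := by field_simp
  have h5 : principalMinor (Yᵀ * Y) D * (1 / 2) ≤ principalMinor (Yᵀ * Y) D *
      ((1 - columnProj (columns Y D)) * Matrix.diagonal μ).trace := by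
    gcongr
    linarith
  linarith

/-- Without i one column is missing, so the minors of D - i + j sum to at least half the minor of D
- i. There are at most n of them, each at most twice the minor of D. -/
theorem principalMinor_erase_le (hμ : ∀ i, 0 ≤ μ i)
    (hY : ∀ i k, ∑ j ∈ T, Y i j * Y k j = Matrix.diagonal μ i k) {D : Finset (Fin n)}
    (hcard : D.card = largeCount μ) (hD : 0 < principalMinor (Yᵀ * Y) D)
    (hopt : ExchangeOptimal (Yᵀ * Y) T D) {i : Fin n} (hi : i ∈ D) :
    principalMinor (Yᵀ * Y) (D.erase i) ≤ 4 * n * principalMinor (Yᵀ * Y) D := by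
  rcases le_or_gt (principalMinor (Yᵀ * Y) (D.erase i)) 0 with h | h
  · exact h.trans (by positivity)
  have hsum := sum_principalMinor_insert hY h.ne'
  have htr := smallSum_add_le_trace (μ := μ) (A := columns Y (D.erase i))
    (by rw [← principalMinor_gram]; exact h.ne')
  have hs := smallSum_nonneg hμ
  have hc : ((D.erase i).card : ℝ) + 1 = largeCount μ := by
    rw [← hcard]; exact_mod_cast Finset.card_erase_add_one hi
  rw [Fintype.card_fin] at htr
  have hle : ∑ j ∈ T \ D.erase i, principalMinor (Yᵀ * Y) (insert j (D.erase i)) ≤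
      ((T \ D.erase i).card : ℝ) * (2 * principalMinor (Yᵀ * Y) D) := by
    rw [← nsmul_eq_mul]
    refine Finset.sum_le_card_nsmul _ _ _ fun j hj => ?_
    rw [Finset.mem_sdiff] at hj
    by_cases hji : j = i
    · rw [hji, Finset.insert_erase hi]
      linarith
    · refine hopt i hi j (Finset.mem_sdiff.2 ⟨hj.1, fun hjD => hj.2 ?_⟩)
      exact Finset.mem_erase.2 ⟨hji, hjD⟩
  have hn : ((T \ D.erase i).card : ℝ) ≤ n := by exact_mod_cast card_finset_fin_le _
  have h3 : ((T \ D.erase i).card : ℝ) * (2 * principalMinor (Yᵀ * Y) D) ≤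
      n * (2 * principalMinor (Yᵀ * Y) D) := by gcongr
  have h5 : principalMinor (Yᵀ * Y) (D.erase i) * (1 / 2) ≤ principalMinor (Yᵀ * Y) (D.erase i) *
      ((1 - columnProj (columns Y (D.erase i))) * Matrix.diagonal μ).trace := by
    gcongr
    linarith
  linarith

/-- Cramer's rule. It translates local optimality into a bound on the trace of the inverse Gram
matrix. -/
theorem inv_gram_diag_eq {D : Finset (Fin n)} (hD : principalMinor (Yᵀ * Y) D ≠ 0)
    (a : Fin D.card) :
    (((columns Y D)ᵀ * columns Y D)⁻¹ : Matrix _ _ ℝ) a a =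
      principalMinor (Yᵀ * Y) (D.erase (D.orderEmbOfFin rfl a)) / principalMinor (Yᵀ * Y) D := by
  obtain ⟨m, hm⟩ : ∃ m, D.card = m + 1 := ⟨D.card - 1, by have := a.pos; omega⟩
  let e : Fin D.card ≃ Fin (m + 1) := finCongr hm
  set G := (columns Y D)ᵀ * columns Y D with hG
  rw [principalMinor_gram D, ← hG] at hD ⊢
  have hG' : G = (Yᵀ * Y).submatrix (D.orderEmbOfFin rfl) (D.orderEmbOfFin rfl) := by
    rw [hG, columns, Matrix.transpose_submatrix, Matrix.submatrix_mul _ _ _ id _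
      Function.bijective_id]
  have h₁ : G⁻¹ a a = (G.submatrix e.symm e.symm)⁻¹ (e a) (e a) := by
    rw [Matrix.inv_submatrix_equiv]
    simp
  have h₂ : principalMinor (Yᵀ * Y) (D.erase (D.orderEmbOfFin rfl a)) =
      ((G.submatrix e.symm e.symm).submatrix (e a).succAbove (e a).succAbove).det := by
    rw [principalMinor_eq_det (f := fun i => D.orderEmbOfFin rfl (e.symm ((e a).succAbove i))), hG']
    · rfl
    · exact (D.orderEmbOfFin rfl).injective.comp (e.symm.injective.comp Fin.succAbove_right_injective)
    · intro j
      rw [Finset.mem_erase]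
      constructor
      · rintro ⟨hja, hjD⟩
        have hr : ∃ i, D.orderEmbOfFin rfl i = j := by
          rw [← Set.mem_range, Finset.range_orderEmbOfFin, Finset.mem_coe]; exact hjD
        obtain ⟨b, rfl⟩ := hr
        have hb : e b ≠ e a := fun h => hja (by rw [e.injective h])
        obtain ⟨i, hi⟩ := Fin.exists_succAbove_eq hb
        exact ⟨i, by rw [hi, e.symm_apply_apply]⟩
      · rintro ⟨i, rfl⟩
        refine ⟨fun h => ?_, D.orderEmbOfFin_mem rfl _⟩
        have := (D.orderEmbOfFin rfl).injective h
        rw [Equiv.symm_apply_eq] at this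
        exact Fin.succAbove_ne _ _ this
  rw [h₁, h₂, Matrix.inv_def, Matrix.smul_apply, Matrix.adjugate_fin_succ_eq_det_submatrix,
    Matrix.det_submatrix_equiv_self, Ring.inverse_eq_inv', smul_eq_mul, ← two_mul,
    pow_mul, neg_one_sq, one_pow, one_mul]
  field_simp

/-- The diagonal of the inverse Gram matrix has at most d entries, each at most 4n. The rows of the
chosen columns have squared norm at most μᵢ because those columns are part of T. -/
theorem residual_trace_le (hμ : ∀ i, 0 ≤ μ i) (hμ' : ∀ i, μ i ≤ 1)
    (hY : ∀ i k, ∑ j ∈ T, Y i j * Y k j = Matrix.diagonal μ i k) {D : Finset (Fin n)}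
    (hDT : D ⊆ T) (hcard : D.card = largeCount μ) (hD : 0 < principalMinor (Yᵀ * Y) D)
    (hopt : ExchangeOptimal (Yᵀ * Y) T D) :
    ((1 - columnProj (columns Y D)) * Matrix.diagonal μ).trace
      ≤ smallSum μ * (1 + 4 * n * d) := by
  have hdet : ((columns Y D)ᵀ * columns Y D).det ≠ 0 := by
    rw [← principalMinor_gram]; exact hD.ne'
  refine (trace_le_smallSum hμ hμ' hdet (by simpa using hcard) fun i => ?_).trans ?_
  · have : ∑ j ∈ D, Y i j ^ 2 ≤ μ i := by
      have h := hY i i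
      rw [Matrix.diagonal_apply_eq] at h
      rw [← h]
      refine (Finset.sum_le_sum_of_subset_of_nonneg hDT fun j _ _ => sq_nonneg _).trans ?_
      simp [sq]
    refine le_trans (le_of_eq ?_) this
    have hmap : Finset.univ.map (D.orderEmbOfFin rfl).toEmbedding = D :=
      Finset.map_orderEmbOfFin_univ D rfl
    conv_rhs => rw [← hmap]
    rw [Finset.sum_map]
    rfl
  · refine mul_le_mul_of_nonneg_left ?_ (smallSum_nonneg hμ)
    have h : (((columns Y D)ᵀ * columns Y D)⁻¹ : Matrix _ _ ℝ).trace ≤ D.card * (4 * n) := by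
      rw [Matrix.trace]
      refine (Finset.sum_le_card_nsmul _ _ (4 * n : ℝ) fun a _ => ?_).trans (by simp)
      rw [Matrix.diag_apply, inv_gram_diag_eq hD.ne', div_le_iff₀ hD]
      exact principalMinor_erase_le hμ hY hcard hD hopt (D.orderEmbOfFin_mem rfl a)
    have hd : (D.card : ℝ) ≤ d := by
      rw [hcard]
      exact_mod_cast card_finset_fin_le _
    nlinarith [(Nat.cast_nonneg n : (0 : ℝ) ≤ n)]

/-- A column y in T has squared norm s with s² ≤ yᵀ diag(μ) y ≤ s, so s ≤ 1. By Cauchy–Schwarz the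
Gram entries are at most 1 in absolute value, and the Leibniz expansion has |D|! terms. -/
theorem principalMinor_le_factorial (hμ : ∀ i, μ i ≤ 1)
    (hY : ∀ i k, ∑ j ∈ T, Y i j * Y k j = Matrix.diagonal μ i k) {D : Finset (Fin n)}
    (hDT : D ⊆ T) : principalMinor (Yᵀ * Y) D ≤ (D.card).factorial := by
  have hnorm : ∀ j ∈ T, ∑ i, Y i j ^ 2 ≤ 1 := by
    intro j hj
    set s := ∑ i, Y i j ^ 2 with hs
    have h₁ : s ^ 2 ≤ ∑ k ∈ T, (∑ i, Y i k * Y i j) ^ 2 := by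
      refine le_trans (le_of_eq ?_) (Finset.single_le_sum
        (f := fun k => (∑ i, Y i k * Y i j) ^ 2) (fun k _ => sq_nonneg _) hj)
      simp [hs, sq]
    have h₂ : ∑ k ∈ T, (∑ i, Y i k * Y i j) ^ 2 = ∑ i, μ i * Y i j ^ 2 := by
      calc ∑ k ∈ T, (∑ i, Y i k * Y i j) ^ 2
          = ∑ k ∈ T, ∑ i, ∑ i', (Y i k * Y i' k) * (Y i j * Y i' j) := by
            refine Finset.sum_congr rfl fun k _ => ?_
            rw [sq, Finset.sum_mul_sum]
            exact Finset.sum_congr rfl fun i _ => Finset.sum_congr rfl fun i' _ => by ring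
        _ = ∑ i, ∑ i', (∑ k ∈ T, Y i k * Y i' k) * (Y i j * Y i' j) := by
            rw [Finset.sum_comm]
            refine Finset.sum_congr rfl fun i _ => ?_
            rw [Finset.sum_comm]
            exact Finset.sum_congr rfl fun i' _ => (Finset.sum_mul _ _ _).symm
        _ = ∑ i, μ i * Y i j ^ 2 := by
            refine Finset.sum_congr rfl fun i _ => ?_
            simp [hY, Matrix.diagonal_apply, sq]
    have h₃ : ∑ i, μ i * Y i j ^ 2 ≤ s :=
      Finset.sum_le_sum fun i _ => mul_le_of_le_one_left (sq_nonneg _) (hμ i)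
    nlinarith
  have hent : ∀ a b, |((Yᵀ * Y).submatrix (D.orderEmbOfFin rfl) (D.orderEmbOfFin rfl)) a b| ≤ 1 := by
    intro a b
    rw [Matrix.submatrix_apply, Matrix.mul_apply, ← sq_le_one_iff_abs_le_one]
    refine (Finset.sum_mul_sq_le_sq_mul_sq _ _ _).trans ?_
    refine mul_le_one₀ ?_ (by positivity) ?_
    · exact hnorm _ (hDT (D.orderEmbOfFin_mem rfl a))
    · exact hnorm _ (hDT (D.orderEmbOfFin_mem rfl b))
  have := Matrix.det_le (abv := AbsoluteValue.abs) hent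
  simp only [Fintype.card_fin, one_pow, nsmul_eq_mul, mul_one] at this
  exact (le_abs_self _).trans this

end Gram

/-! ## Simultaneous diagonalization -/

section Spectral

variable {d n : ℕ}

theorem exists_orthogonal_diagonalization {A : Matrix (Fin d) (Fin d) ℝ} (hA : A.IsHermitian) :
    ∃ V : Matrix (Fin d) (Fin d) ℝ, Vᵀ * V = 1 ∧ V * Vᵀ = 1 ∧
      A = Vᵀ * Matrix.diagonal hA.eigenvalues * V := by
  have h₁ := Unitary.coe_star_mul_self hA.eigenvectorUnitary
  have h₂ := Unitary.coe_mul_star_self hA.eigenvectorUnitary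
  have h₃ := hA.spectral_theorem
  rw [Unitary.conjStarAlgAut_apply] at h₃
  refine ⟨(hA.eigenvectorUnitary : Matrix (Fin d) (Fin d) ℝ)ᵀ, ?_, ?_, ?_⟩
  · rw [Matrix.transpose_transpose]
    simpa [Matrix.star_eq_conjTranspose] using h₂
  · rw [Matrix.transpose_transpose]
    simpa [Matrix.star_eq_conjTranspose] using h₁
  · rw [Matrix.transpose_transpose]
    simpa [Matrix.star_eq_conjTranspose, Function.comp_def] using h₃

/-- Factor M = CᵀC by the spectral theorem and diagonalize C⁻ᵀAC⁻¹ by an orthogonal matrix;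
multiplying C by it does not change CᵀC. -/
theorem exists_simultaneous_diagonalization {A M : Matrix (Fin d) (Fin d) ℝ} (hA : A.PosSemidef)
    (hM : M.PosSemidef) (hdet : M.det ≠ 0) :
    ∃ (Q : Matrix (Fin d) (Fin d) ℝ) (μ : Fin d → ℝ), Q.det ≠ 0 ∧ M = Qᵀ * Q ∧
      A = Qᵀ * Matrix.diagonal μ * Q := by
  obtain ⟨V, hV, -, hMV⟩ := exists_orthogonal_diagonalization hM.isHermitian
  set C := Matrix.diagonal (fun i => √(hM.isHermitian.eigenvalues i)) * V with hC
  have hMC : M = Cᵀ * C := by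
    rw [hC, Matrix.transpose_mul, Matrix.diagonal_transpose, Matrix.mul_assoc,
      ← Matrix.mul_assoc (Matrix.diagonal _), Matrix.diagonal_mul_diagonal, ← Matrix.mul_assoc]
    simp only [Real.mul_self_sqrt (hM.eigenvalues_nonneg _)]
    exact hMV
  have hCdet : IsUnit C.det := by
    rw [hMC, Matrix.det_mul] at hdet
    exact (right_ne_zero_of_mul hdet).isUnit
  have hA' : (C⁻¹ᵀ * A * C⁻¹).IsHermitian := by
    have := (hA.conjTranspose_mul_mul_same C⁻¹).isHermitian
    simpa using this
  obtain ⟨V', hV', hV'', hAV⟩ := exists_orthogonal_diagonalization hA'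
  refine ⟨V' * C, hA'.eigenvalues, ?_, ?_, ?_⟩
  · rw [Matrix.det_mul]
    refine mul_ne_zero ?_ hCdet.ne_zero
    have := congrArg Matrix.det hV''
    rw [Matrix.det_mul, Matrix.det_one] at this
    exact left_ne_zero_of_mul (by rw [this]; exact one_ne_zero)
  · rw [Matrix.transpose_mul, Matrix.mul_assoc, ← Matrix.mul_assoc V'ᵀ, hV', Matrix.one_mul, hMC]
  · have : (V' * C)ᵀ * Matrix.diagonal hA'.eigenvalues * (V' * C)
        = Cᵀ * (V'ᵀ * Matrix.diagonal hA'.eigenvalues * V') * C := by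
      simp only [Matrix.transpose_mul, Matrix.mul_assoc]
    rw [this, ← hAV]
    have hCt : Cᵀ * C⁻¹ᵀ = 1 := by
      rw [← Matrix.transpose_mul, Matrix.nonsing_inv_mul _ hCdet, Matrix.transpose_one]
    calc A = (Cᵀ * C⁻¹ᵀ) * A * (C⁻¹ * C) := by
          rw [hCt, Matrix.nonsing_inv_mul _ hCdet, Matrix.one_mul, Matrix.mul_one]
      _ = _ := by simp only [Matrix.mul_assoc]

/-- The zero eigenvalues split off a power of X from the characteristic polynomial; the coefficient
in question is the constant term of the remaining product, a product of nonzero numbers. -/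
theorem flCoeff_rank_ne_zero {A : Matrix (Fin d) (Fin d) ℝ} (hA : A.IsHermitian) :
    flCoeff A A.rank ≠ 0 := by
  unfold flCoeff
  rw [hA.charpoly_eq, hA.rank_eq_card_non_zero_eigs, Fintype.card_subtype,
    ← Finset.prod_filter_mul_prod_filter_not Finset.univ (fun i => hA.eigenvalues i ≠ 0)]
  have h₁ : d - (Finset.univ.filter fun i => hA.eigenvalues i ≠ 0).card
      = (Finset.univ.filter fun i => ¬ hA.eigenvalues i ≠ 0).card := by
    have := Finset.card_filter_add_card_filter_not (s := (Finset.univ : Finset (Fin d)))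
      (fun i => hA.eigenvalues i ≠ 0)
    rw [Finset.card_univ, Fintype.card_fin] at this
    omega
  have h₂ : ∏ i with ¬ hA.eigenvalues i ≠ 0,
      (Polynomial.X - Polynomial.C ((hA.eigenvalues i : ℝ) : ℝ))
      = Polynomial.X ^ (Finset.univ.filter fun i => ¬ hA.eigenvalues i ≠ 0).card := by
    rw [Finset.prod_congr rfl (g := fun _ => Polynomial.X), Finset.prod_const]
    intro i hi
    have := (Finset.mem_filter.1 hi).2
    rw [not_not] at this
    rw [this]
    simp
  simp only [RCLike.ofReal_real_eq_id, id] at h₂ ⊢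
  rw [h₁, h₂, Polynomial.coeff_mul_X_pow', if_pos le_rfl, Nat.sub_self,
    Polynomial.coeff_zero_eq_eval_zero, Polynomial.eval_prod]
  refine Finset.prod_ne_zero_iff.2 fun i hi => ?_
  simpa using (Finset.mem_filter.1 hi).2

/-- Coordinates in which `U Z Uᵀ` is the identity and `U_T Z_T U_Tᵀ` is diagonal. -/
structure SpectralData (U : Matrix (Fin d) (Fin n) ℝ) (z : Fin n → ℝ) (T : Finset (Fin n))
    (Q R : Matrix (Fin d) (Fin d) ℝ) (μ : Fin d → ℝ) : Prop where
  mul_eq_one : Q * R = 1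
  gram_eq : gram U z T = Qᵀ * Matrix.diagonal μ * Q
  gram_compl_eq : gram U z Tᶜ = Qᵀ * Matrix.diagonal (fun i => 1 - μ i) * Q
  nonneg : ∀ i, 0 ≤ μ i
  le_one : ∀ i, μ i ≤ 1

variable {U : Matrix (Fin d) (Fin n) ℝ} {z : Fin n → ℝ} {T : Finset (Fin n)}

theorem gram_posSemidef (hz : ∀ j, 0 < z j) (S : Finset (Fin n)) : (gram U z S).PosSemidef := by
  have h : (Matrix.diagonal fun j => if j ∈ S then z j else 0).PosSemidef := by
    refine Matrix.PosSemidef.diagonal fun j => ?_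
    show (0 : ℝ) ≤ if j ∈ S then z j else 0
    split_ifs
    · exact (hz j).le
    · exact le_rfl
  have := h.mul_mul_conjTranspose_same U
  simpa [gram] using this

theorem gram_univ : gram U z Finset.univ = U * Matrix.diagonal z * Uᵀ := by
  simp [gram]

theorem gram_add_compl : gram U z T + gram U z Tᶜ = gram U z Finset.univ := by
  ext a b
  rw [Matrix.add_apply, gram_apply, gram_apply, gram_apply, Finset.sum_add_sum_compl]

theorem gram_univ_det_ne_zero (hU : U.rank = d) (hz : ∀ j, 0 < z j) :
    (gram U z Finset.univ).det ≠ 0 := by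
  set s : Matrix (Fin n) (Fin n) ℝ := Matrix.diagonal fun j => √(z j) with hs
  have h : gram U z Finset.univ = (U * s) * (U * s)ᵀ := by
    rw [gram_univ, Matrix.transpose_mul, hs, Matrix.diagonal_transpose, ← Matrix.mul_assoc (U * _),
      Matrix.mul_assoc U (Matrix.diagonal _) (Matrix.diagonal _), Matrix.diagonal_mul_diagonal]
    simp only [Real.mul_self_sqrt (hz _).le]
  have hsdet : IsUnit s.det := by
    rw [hs, Matrix.det_diagonal]
    exact (Finset.prod_ne_zero_iff.2 fun j _ => (Real.sqrt_pos.2 (hz j)).ne').isUnit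
  have hrank : (gram U z Finset.univ).rank = d := by
    rw [h, Matrix.rank_self_mul_transpose, Matrix.rank_mul_eq_left_of_isUnit_det _ _ hsdet, hU]
  intro h0
  have h1 := Matrix.exists_mulVec_eq_zero_iff.2 h0
  obtain ⟨v, hv, hv0⟩ := h1
  have hli : LinearIndependent ℝ (gram U z Finset.univ).col := by
    rw [linearIndependent_iff_card_eq_finrank_span, Fintype.card_fin, Set.finrank,
      ← Matrix.rank_eq_finrank_span_cols, hrank]
  exact hv (Matrix.mulVec_injective_iff.2 hli (by rw [hv0, Matrix.mulVec_zero]))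

/-- In coordinates with M = I, the two parts of the frame become diag μ and I - diag μ. Both are
positive semidefinite, so μ has entries in [0, 1]. -/
theorem exists_spectralData (hU : U.rank = d) (hz : ∀ j, 0 < z j) (T : Finset (Fin n)) :
    ∃ Q R μ, SpectralData U z T Q R μ := by
  obtain ⟨Q, μ, hQ, hM, hA⟩ := exists_simultaneous_diagonalization
    (gram_posSemidef (U := U) hz T) (gram_posSemidef (U := U) hz Finset.univ)
    (gram_univ_det_ne_zero hU hz)
  have hB : gram U z Tᶜ = Qᵀ * Matrix.diagonal (fun i => 1 - μ i) * Q := by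
    have h : (Matrix.diagonal fun i => 1 - μ i) = 1 - Matrix.diagonal μ := by
      rw [← Matrix.diagonal_one, Matrix.diagonal_sub]
    rw [h, Matrix.mul_sub, Matrix.sub_mul, Matrix.mul_one, ← hM, ← hA, ← gram_add_compl (T := T)]
    simp
  have hQR : Q * Q⁻¹ = 1 := Matrix.mul_nonsing_inv _ hQ.isUnit
  have key : ∀ {A : Matrix (Fin d) (Fin d) ℝ} {ν : Fin d → ℝ}, A.PosSemidef →
      A = Qᵀ * Matrix.diagonal ν * Q → ∀ i, 0 ≤ ν i := by
    intro A ν hA hAν i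
    have h := (hA.conjTranspose_mul_mul_same Q⁻¹).diag_nonneg (i := i)
    have h2 : (Q⁻¹)ᴴ * A * Q⁻¹ = Matrix.diagonal ν := by
      rw [hAν, Matrix.conjTranspose_eq_transpose_of_trivial]
      calc (Q⁻¹)ᵀ * (Qᵀ * Matrix.diagonal ν * Q) * Q⁻¹
          = ((Q⁻¹)ᵀ * Qᵀ) * Matrix.diagonal ν * (Q * Q⁻¹) := by simp only [Matrix.mul_assoc]
        _ = _ := by rw [← Matrix.transpose_mul, hQR, Matrix.transpose_one, Matrix.one_mul,
          Matrix.mul_one]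
    rw [h2, Matrix.diagonal_apply_eq] at h
    exact h
  exact ⟨Q, Q⁻¹, μ, hQR, hA, hB, key (gram_posSemidef hz T) hA,
    fun i => by linarith [key (gram_posSemidef hz Tᶜ) hB i]⟩

/-- The progress function in terms of the eigenvalues. -/
noncomputable def eigenProgress (μ : Fin d → ℝ) (α : ℝ) : ℝ := ∑ i, α * μ i / (1 + (α - 1) * μ i)

/-- The derivative of the progress function in terms of the eigenvalues. -/
noncomputable def eigenSlope (μ : Fin d → ℝ) (α : ℝ) : ℝ :=
  ∑ i, μ i * (1 - μ i) / (1 + (α - 1) * μ i) ^ 2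

namespace SpectralData

variable {Q R : Matrix (Fin d) (Fin d) ℝ} {μ : Fin d → ℝ} (h : SpectralData U z T Q R μ)
include h

theorem mul_eq_one' : R * Q = 1 := mul_eq_one_comm.1 h.mul_eq_one

theorem transpose_mul : Qᵀ * Rᵀ = 1 := by
  rw [← Matrix.transpose_mul, h.mul_eq_one', Matrix.transpose_one]

theorem transpose_mul' : Rᵀ * Qᵀ = 1 := by
  rw [← Matrix.transpose_mul, h.mul_eq_one, Matrix.transpose_one]

theorem denom_pos {α : ℝ} (hα : 0 < α) (i : Fin d) : 0 < 1 + (α - 1) * μ i := by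
  have h₀ := h.nonneg i
  have h₁ := h.le_one i
  rcases eq_or_lt_of_le h₁ with h₂ | h₂
  · rw [h₂]; linarith
  · nlinarith

theorem conj_mul (a b : Fin d → ℝ) :
    (Qᵀ * Matrix.diagonal a * Q) * (R * Matrix.diagonal b * Rᵀ)
      = Qᵀ * Matrix.diagonal (fun i => a i * b i) * Rᵀ := by
  calc _ = Qᵀ * (Matrix.diagonal a * (Q * R) * Matrix.diagonal b) * Rᵀ := by
        simp only [Matrix.mul_assoc]
    _ = _ := by rw [h.mul_eq_one, Matrix.mul_one, Matrix.diagonal_mul_diagonal]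

theorem trace_conj (a : Fin d → ℝ) : (Qᵀ * Matrix.diagonal a * Rᵀ).trace = ∑ i, a i := by
  rw [Matrix.trace_mul_comm, ← Matrix.mul_assoc, h.transpose_mul', Matrix.one_mul,
    Matrix.trace_diagonal]

theorem conj_conj (a b : Fin d → ℝ) :
    (Qᵀ * Matrix.diagonal a * Rᵀ) * (Qᵀ * Matrix.diagonal b * Rᵀ)
      = Qᵀ * Matrix.diagonal (fun i => a i * b i) * Rᵀ := by
  calc _ = Qᵀ * (Matrix.diagonal a * (Rᵀ * Qᵀ) * Matrix.diagonal b) * Rᵀ := by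
        simp only [Matrix.mul_assoc]
    _ = _ := by rw [h.transpose_mul', Matrix.mul_one, Matrix.diagonal_mul_diagonal]

theorem scaledGram_eq (α : ℝ) : scaledGram U z T α
    = Qᵀ * Matrix.diagonal (fun i => 1 + (α - 1) * μ i) * Q := by
  rw [scaledGram, h.gram_eq, h.gram_compl_eq, ← Matrix.smul_mul, ← Matrix.mul_smul,
    ← Matrix.add_mul, ← Matrix.mul_add, ← Matrix.diagonal_smul, Matrix.diagonal_add]
  congr 3
  ext i
  simp only [Pi.smul_apply, smul_eq_mul]
  ring

theorem scaledGram_mul_inv {α : ℝ} (hα : 0 < α) : scaledGram U z T α *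
    (R * Matrix.diagonal (fun i => (1 + (α - 1) * μ i)⁻¹) * Rᵀ) = 1 := by
  rw [h.scaledGram_eq, h.conj_mul]
  simp only [mul_inv_cancel₀ (h.denom_pos hα _).ne']
  rw [Matrix.diagonal_one, Matrix.mul_one, h.transpose_mul]

theorem scaledGram_inv {α : ℝ} (hα : 0 < α) : (scaledGram U z T α)⁻¹ =
    R * Matrix.diagonal (fun i => (1 + (α - 1) * μ i)⁻¹) * Rᵀ :=
  Matrix.inv_eq_right_inv (h.scaledGram_mul_inv hα)

theorem scaledGram_det_ne_zero {α : ℝ} (hα : 0 < α) : (scaledGram U z T α).det ≠ 0 := by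
  have := congrArg Matrix.det (h.scaledGram_mul_inv hα)
  rw [Matrix.det_mul, Matrix.det_one] at this
  exact left_ne_zero_of_mul (by rw [this]; exact one_ne_zero)

theorem value_eq {α : ℝ} (hα : 0 < α) :
    α * (gram U z T * (scaledGram U z T α)⁻¹).trace = eigenProgress μ α := by
  rw [h.scaledGram_inv hα, h.gram_eq, h.conj_mul, h.trace_conj, eigenProgress, Finset.mul_sum]
  exact Finset.sum_congr rfl fun i _ => by rw [div_eq_mul_inv, mul_assoc]

theorem slope_eq {α : ℝ} (hα : 0 < α) :
    (gram U z T * (scaledGram U z T α)⁻¹ * (gram U z Tᶜ * (scaledGram U z T α)⁻¹)).trace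
      = eigenSlope μ α := by
  rw [h.scaledGram_inv hα, h.gram_eq, h.gram_compl_eq, h.conj_mul, h.conj_mul, h.conj_conj,
    h.trace_conj, eigenSlope]
  refine Finset.sum_congr rfl fun i _ => ?_
  rw [div_eq_mul_inv, ← inv_pow]
  ring

omit h in
theorem progress_eq_trace (α : ℝ) : progress U z T α
    = α * (gram U z T * (scaledGram U z T α)⁻¹).trace := by
  have hs : U * Matrix.diagonal (scaleUp z T α) * Uᵀ = scaledGram U z T α := by
    ext a b
    rw [scaledGram, Matrix.add_apply, Matrix.smul_apply, gram_apply, gram_apply, smul_eq_mul,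
      Finset.mul_sum, add_comm, Matrix.mul_apply, ← Finset.sum_add_sum_compl T]
    congr 1
    · refine Finset.sum_congr rfl fun j hj => ?_
      rw [Matrix.mul_diagonal, scaleUp, if_pos hj, Matrix.transpose_apply]
      ring
    · refine Finset.sum_congr rfl fun j hj => ?_
      rw [Matrix.mul_diagonal, scaleUp, if_neg (Finset.mem_compl.1 hj), Matrix.transpose_apply]
  unfold progress leverage
  rw [hs]
  generalize (scaledGram U z T α)⁻¹ = S
  have h₁ : ∀ j ∈ T, scaleUp z T α j * (Uᵀ j ⬝ᵥ (S *ᵥ Uᵀ j))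
      = α * ∑ a, ∑ b, S a b * (U b j * z j * U a j) := by
    intro j hj
    rw [scaleUp, if_pos hj, mul_assoc]
    congr 1
    simp only [dotProduct, Matrix.mulVec, Finset.mul_sum, Matrix.transpose_apply]
    exact Finset.sum_congr rfl fun a _ => Finset.sum_congr rfl fun b _ => by ring
  rw [Finset.sum_congr rfl h₁, ← Finset.mul_sum]
  congr 1
  rw [Matrix.trace_mul_comm, Matrix.trace, Finset.sum_comm]
  refine Finset.sum_congr rfl fun a _ => ?_
  rw [Matrix.diag_apply, Matrix.mul_apply, Finset.sum_comm]
  refine Finset.sum_congr rfl fun b _ => ?_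
  rw [gram_apply, Finset.mul_sum]

theorem progress_eq {α : ℝ} (hα : 0 < α) : progress U z T α = eigenProgress μ α := by
  rw [progress_eq_trace, h.value_eq hα]

theorem gram_univ_eq : gram U z Finset.univ = Qᵀ * Q := by
  rw [← gram_add_compl (T := T), h.gram_eq, h.gram_compl_eq, ← Matrix.add_mul, ← Matrix.mul_add,
    Matrix.diagonal_add]
  simp

theorem gram_univ_inv : (gram U z Finset.univ)⁻¹ = R * Rᵀ := by
  refine Matrix.inv_eq_right_inv ?_
  rw [h.gram_univ_eq, Matrix.mul_assoc, ← Matrix.mul_assoc Q, h.mul_eq_one, Matrix.one_mul,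
    h.transpose_mul]

theorem gram_mul_inv : gram U z T * (gram U z Finset.univ)⁻¹ = Qᵀ * Matrix.diagonal μ * Rᵀ := by
  have := h.conj_mul μ 1
  rw [h.gram_univ_inv, h.gram_eq]
  simpa using this

/-- M⁻¹M_T and M_TM⁻¹ share their characteristic polynomial, and the latter is similar to diag μ. -/
theorem smallEigenSum_eq : smallEigenSum U z T = smallSum μ := by
  have hroots : (∏ i, (Polynomial.X - Polynomial.C (μ i))).roots = Finset.univ.val.map μ := by
    rw [Polynomial.roots_prod]
    · simp
    · simp [Finset.prod_ne_zero_iff, Polynomial.X_sub_C_ne_zero]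
  unfold smallEigenSum
  rw [← gram_univ, Matrix.charpoly_mul_comm, h.gram_mul_inv, Matrix.charpoly_mul_comm,
    ← Matrix.mul_assoc, h.transpose_mul', Matrix.one_mul, Matrix.charpoly_diagonal,
    hroots, smallSum, Multiset.filter_map]
  rfl

theorem rank_gram : (gram U z T).rank = (Finset.univ.filter fun i => μ i ≠ 0).card := by
  have hQ : IsUnit Q.det := by
    have := congrArg Matrix.det h.mul_eq_one
    rw [Matrix.det_mul, Matrix.det_one] at this
    exact (left_ne_zero_of_mul (by rw [this]; exact one_ne_zero)).isUnit
  rw [h.gram_eq, Matrix.rank_mul_eq_left_of_isUnit_det _ _ hQ,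
    Matrix.rank_mul_eq_right_of_isUnit_det _ _ (by rwa [Matrix.det_transpose]),
    Matrix.rank_diagonal, Fintype.card_subtype]

/-! ### The scaled frame in the new coordinates -/

theorem sum_frame_mul (hz : ∀ j, 0 < z j) (i k : Fin d) :
    ∑ j ∈ T, (Rᵀ * U * Matrix.diagonal fun j => √(z j)) i j
      * (Rᵀ * U * Matrix.diagonal fun j => √(z j)) k j = Matrix.diagonal μ i k := by
  have h₁ : Rᵀ * gram U z T * R = Matrix.diagonal μ := by
    rw [h.gram_eq]
    calc Rᵀ * (Qᵀ * Matrix.diagonal μ * Q) * R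
        = (Rᵀ * Qᵀ) * Matrix.diagonal μ * (Q * R) := by simp only [Matrix.mul_assoc]
      _ = _ := by rw [h.transpose_mul', h.mul_eq_one, Matrix.one_mul, Matrix.mul_one]
  have h₂ : Rᵀ * gram U z T * R
      = (Rᵀ * U) * Matrix.diagonal (fun j => if j ∈ T then z j else 0) * (Rᵀ * U)ᵀ := by
    rw [gram, Matrix.transpose_mul, Matrix.transpose_transpose]
    simp only [Matrix.mul_assoc]
  rw [← h₁, h₂, Matrix.mul_apply, ← Finset.sum_subset (Finset.subset_univ T)]
  · refine Finset.sum_congr rfl fun j hj => ?_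
    rw [Matrix.mul_diagonal, Matrix.mul_diagonal, Matrix.mul_diagonal, if_pos hj,
      Matrix.transpose_apply]
    have := Real.mul_self_sqrt (hz j).le
    linear_combination (Rᵀ * U) i j * (Rᵀ * U) k j * this
  · intro j _ hj
    rw [Matrix.mul_diagonal, if_neg hj]
    simp

/-- K = UᵀM⁻¹UZ is not symmetric, but conjugation by √Z turns it into the Gram matrix of the
whitened frame, and a diagonal conjugation preserves principal minors. -/
theorem principalMinor_eq (hz : ∀ j, 0 < z j) (D : Finset (Fin n)) :
    principalMinor (Uᵀ * ((gram U z Finset.univ)⁻¹ * U) * Matrix.diagonal z) D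
      = principalMinor ((Rᵀ * U * Matrix.diagonal fun j => √(z j))ᵀ *
        (Rᵀ * U * Matrix.diagonal fun j => √(z j))) D := by
  rw [h.gram_univ_inv]
  set B := Uᵀ * (R * Rᵀ * U) with hB
  have hY : (Rᵀ * U * Matrix.diagonal fun j => √(z j))ᵀ *
        (Rᵀ * U * Matrix.diagonal fun j => √(z j))
      = (Matrix.diagonal fun j => √(z j)) * B * Matrix.diagonal fun j => √(z j) := by
    rw [hB]
    simp only [Matrix.transpose_mul, Matrix.diagonal_transpose, Matrix.transpose_transpose,
      Matrix.mul_assoc]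
  rw [hY]
  unfold principalMinor
  set f := D.orderEmbOfFin rfl
  set s : Matrix (Fin D.card) (Fin D.card) ℝ := Matrix.diagonal fun i => √(z (f i)) with hs
  have hsdet : s.det ≠ 0 := by
    rw [hs, Matrix.det_diagonal]
    exact Finset.prod_ne_zero_iff.2 fun j _ => (Real.sqrt_pos.2 (hz _)).ne'
  have hmat : s * (B * Matrix.diagonal z).submatrix f f
      = ((Matrix.diagonal fun j => √(z j)) * B * Matrix.diagonal fun j => √(z j)).submatrix f f
        * s := by
    ext i j
    rw [hs, Matrix.diagonal_mul, Matrix.mul_diagonal, Matrix.submatrix_apply,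
      Matrix.submatrix_apply, Matrix.mul_diagonal, Matrix.mul_diagonal, Matrix.diagonal_mul]
    have := Real.mul_self_sqrt (hz (f j)).le
    linear_combination -√(z (f i)) * B (f i) (f j) * this
  have := congrArg Matrix.det hmat
  rw [Matrix.det_mul, Matrix.det_mul, mul_comm] at this
  exact mul_right_cancel₀ hsdet this

theorem frame_gram_eq (hz : ∀ j, 0 < z j) (D : Finset (Fin n)) :
    ∃ E F : Matrix (Fin D.card) (Fin D.card) ℝ, E * F = 1 ∧ Fᵀ = F ∧ Eᵀ = E ∧
      U.submatrix id (D.orderEmbOfFin rfl)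
        = Qᵀ * columns (Rᵀ * U * Matrix.diagonal fun j => √(z j)) D * E := by
  refine ⟨Matrix.diagonal fun i => (√(z (D.orderEmbOfFin rfl i)))⁻¹,
    Matrix.diagonal fun i => √(z (D.orderEmbOfFin rfl i)), ?_, by simp, by simp, ?_⟩
  · rw [Matrix.diagonal_mul_diagonal, ← Matrix.diagonal_one]
    congr 1
    ext i
    exact inv_mul_cancel₀ (Real.sqrt_pos.2 (hz _)).ne'
  · have h₁ : columns (Rᵀ * U * Matrix.diagonal fun j => √(z j)) D
        * (Matrix.diagonal fun i => (√(z (D.orderEmbOfFin rfl i)))⁻¹)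
        = Rᵀ * U.submatrix id (D.orderEmbOfFin rfl) := by
      ext i j
      rw [Matrix.mul_diagonal, columns, Matrix.submatrix_apply, Matrix.mul_diagonal, mul_assoc,
        mul_inv_cancel₀ (Real.sqrt_pos.2 (hz _)).ne', mul_one, Matrix.mul_apply, Matrix.mul_apply]
      rfl
    rw [Matrix.mul_assoc, h₁, ← Matrix.mul_assoc, h.transpose_mul, Matrix.one_mul]

/-- The oblique projection computed by the algorithm is Qᵀ P Q⁻ᵀ, with P the orthogonal projection
onto the whitened columns: the scalings of the individual columns cancel, and the trace is invariant
under conjugation. -/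
theorem frame_gram (hz : ∀ j, 0 < z j) {D : Finset (Fin n)}
    (hD : 0 < principalMinor (Uᵀ * ((gram U z Finset.univ)⁻¹ * U) * Matrix.diagonal z) D) :
    ((U.submatrix id (D.orderEmbOfFin rfl))ᵀ * (gram U z Finset.univ)⁻¹
      * U.submatrix id (D.orderEmbOfFin rfl)).det ≠ 0 ∧
    residualTrace U (gram U z Finset.univ)⁻¹ (gram U z T * (gram U z Finset.univ)⁻¹) D
      = ((1 - columnProj (columns (Rᵀ * U * Matrix.diagonal fun j => √(z j)) D))
        * Matrix.diagonal μ).trace := by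
  rw [h.principalMinor_eq hz, principalMinor_gram] at hD
  obtain ⟨E, F, hEF, hF, hE, hV⟩ := h.frame_gram_eq hz D
  have hFE : F * E = 1 := mul_eq_one_comm.1 hEF
  set A := columns (Rᵀ * U * Matrix.diagonal fun j => √(z j)) D
  set G := Aᵀ * A with hG
  have hGG : G * G⁻¹ = 1 := Matrix.mul_nonsing_inv _ hD.ne'.isUnit
  have hVW : (U.submatrix id (D.orderEmbOfFin rfl))ᵀ * (gram U z Finset.univ)⁻¹
      = E * Aᵀ * Rᵀ := by
    rw [hV, h.gram_univ_inv, Matrix.transpose_mul, Matrix.transpose_mul, Matrix.transpose_transpose,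
      hE]
    calc E * (Aᵀ * Q) * (R * Rᵀ) = E * Aᵀ * (Q * R) * Rᵀ := by simp only [Matrix.mul_assoc]
      _ = _ := by rw [h.mul_eq_one, Matrix.mul_one]
  have hVWV : (U.submatrix id (D.orderEmbOfFin rfl))ᵀ * (gram U z Finset.univ)⁻¹
      * U.submatrix id (D.orderEmbOfFin rfl) = E * G * E := by
    rw [hVW, hV]
    calc E * Aᵀ * Rᵀ * (Qᵀ * A * E) = E * Aᵀ * (Rᵀ * Qᵀ) * A * E := by
          simp only [Matrix.mul_assoc]
      _ = _ := by rw [h.transpose_mul', Matrix.mul_one, hG]; simp only [Matrix.mul_assoc]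
  have hinv : E * G * E * (F * G⁻¹ * F) = 1 := by
    calc E * G * E * (F * G⁻¹ * F) = E * (G * (E * F) * G⁻¹) * F := by
          simp only [Matrix.mul_assoc]
      _ = 1 := by rw [hEF, Matrix.mul_one, hGG, Matrix.mul_one, hEF]
  constructor
  · rw [hVWV]
    have := congrArg Matrix.det hinv
    rw [Matrix.det_mul, Matrix.det_one] at this
    exact left_ne_zero_of_mul (by rw [this]; exact one_ne_zero)
  · unfold residualTrace
    simp only
    rw [hVWV, hVW, hV, Matrix.inv_eq_right_inv hinv, h.gram_mul_inv]
    have h₁ : Qᵀ * A * E * (F * G⁻¹ * F) * (E * Aᵀ * Rᵀ) = Qᵀ * columnProj A * Rᵀ := by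
      calc _ = Qᵀ * (A * (E * F) * G⁻¹ * (F * E) * Aᵀ) * Rᵀ := by simp only [Matrix.mul_assoc]
        _ = _ := by rw [hEF, hFE, Matrix.mul_one, Matrix.mul_one, columnProj]
    have h₂ : (1 - Qᵀ * columnProj A * Rᵀ) * (Qᵀ * Matrix.diagonal μ * Rᵀ)
        = Qᵀ * ((1 - columnProj A) * Matrix.diagonal μ) * Rᵀ := by
      calc _ = Qᵀ * Matrix.diagonal μ * Rᵀ
            - Qᵀ * columnProj A * (Rᵀ * Qᵀ) * Matrix.diagonal μ * Rᵀ := by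
            rw [Matrix.sub_mul, Matrix.one_mul]; simp only [Matrix.mul_assoc]
        _ = _ := by
            rw [h.transpose_mul', Matrix.mul_one, Matrix.sub_mul, Matrix.one_mul, Matrix.mul_sub,
              Matrix.sub_mul]
            simp only [Matrix.mul_assoc]
    rw [h₁, h₂, Matrix.trace_mul_comm, ← Matrix.mul_assoc, h.transpose_mul', Matrix.one_mul]

end SpectralData

end Spectral

/-! ## The progress function in terms of the eigenvalues -/

section Eigen

variable {d : ℕ} {μ : Fin d → ℝ} (h0 : ∀ i, 0 ≤ μ i) (h1 : ∀ i, μ i ≤ 1)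

theorem eigenDenom_pos {x : ℝ} (hx : 0 ≤ x) (hx1 : x ≤ 1) {α : ℝ} (hα : 0 < α) :
    0 < 1 + (α - 1) * x := by
  rcases eq_or_lt_of_le hx1 with h₂ | h₂
  · rw [h₂]; linarith
  · nlinarith

theorem eigenTerm_sub {x : ℝ} (hx : 0 ≤ x) (hx1 : x ≤ 1) {α β : ℝ} (hα : 0 < α) (hβ : 0 < β) :
    β * x / (1 + (β - 1) * x) - α * x / (1 + (α - 1) * x)
      = x * (1 - x) * (β - α) / ((1 + (α - 1) * x) * (1 + (β - 1) * x)) := by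
  have h₁ := (eigenDenom_pos hx hx1 hα).ne'
  have h₂ := (eigenDenom_pos hx hx1 hβ).ne'
  rw [div_sub_div _ _ h₂ h₁, div_eq_div_iff (mul_ne_zero h₂ h₁) (mul_ne_zero h₁ h₂)]
  ring

include h0 h1

/-- Concavity term by term: `key` exhibits the gap to the tangent as an explicit nonnegative
fraction. -/
theorem eigenProgress_le_tangent {α β : ℝ} (hα : 0 < α) (hβ : 0 < β) :
    eigenProgress μ β ≤ eigenProgress μ α + eigenSlope μ α * (β - α) := by
  rw [← sub_le_iff_le_add', eigenProgress, eigenProgress, eigenSlope, ← Finset.sum_sub_distrib,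
    Finset.sum_mul]
  refine Finset.sum_le_sum fun i _ => ?_
  rw [eigenTerm_sub (h0 i) (h1 i) hα hβ]
  have h₁ := eigenDenom_pos (h0 i) (h1 i) hα
  have h₂ := eigenDenom_pos (h0 i) (h1 i) hβ
  have hx := h0 i
  have hx' : 0 ≤ 1 - μ i := by linarith [h1 i]
  have key : μ i * (1 - μ i) / (1 + (α - 1) * μ i) ^ 2 * (β - α)
      - μ i * (1 - μ i) * (β - α) / ((1 + (α - 1) * μ i) * (1 + (β - 1) * μ i))
      = μ i ^ 2 * (1 - μ i) * (β - α) ^ 2 / ((1 + (α - 1) * μ i) ^ 2 * (1 + (β - 1) * μ i)) := by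
    rw [div_mul_eq_mul_div, div_sub_div _ _ (pow_ne_zero 2 h₁.ne') (mul_ne_zero h₁.ne' h₂.ne'),
      div_eq_div_iff (mul_ne_zero (pow_ne_zero 2 h₁.ne') (mul_ne_zero h₁.ne' h₂.ne'))
        (mul_ne_zero (pow_ne_zero 2 h₁.ne') h₂.ne')]
    ring
  have : 0 ≤ μ i ^ 2 * (1 - μ i) * (β - α) ^ 2
      / ((1 + (α - 1) * μ i) ^ 2 * (1 + (β - 1) * μ i)) := by positivity
  linarith

theorem eigenSlope_term_nonneg (α : ℝ) (i : Fin d) :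
    0 ≤ μ i * (1 - μ i) / (1 + (α - 1) * μ i) ^ 2 :=
  div_nonneg (mul_nonneg (h0 i) (by linarith [h1 i])) (sq_nonneg _)

theorem eigenSlope_pos {α : ℝ} (hα : 0 < α) {i : Fin d} (hi : μ i ≠ 0) (hi' : μ i ≠ 1) :
    0 < eigenSlope μ α := by
  refine Finset.sum_pos' (fun i _ => eigenSlope_term_nonneg h0 h1 α i) ⟨i, Finset.mem_univ i, ?_⟩
  have h₁ := eigenDenom_pos (h0 i) (h1 i) hα
  have h₂ : 0 < μ i := lt_of_le_of_ne (h0 i) hi.symm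
  have h₃ : 0 < 1 - μ i := by linarith [lt_of_le_of_ne (h1 i) hi']
  positivity

theorem eigenProgress_mono {α β : ℝ} (hα : 0 < α) (hαβ : α ≤ β) :
    eigenProgress μ α ≤ eigenProgress μ β := by
  refine Finset.sum_le_sum fun i _ => ?_
  rw [← sub_nonneg, eigenTerm_sub (h0 i) (h1 i) hα (by linarith)]
  have h₁ := eigenDenom_pos (h0 i) (h1 i) hα
  have h₂ := eigenDenom_pos (h0 i) (h1 i) (hα.trans_le hαβ)
  have h₃ : 0 ≤ 1 - μ i := by linarith [h1 i]
  have h₄ : 0 ≤ β - α := by linarith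
  have := h0 i
  positivity

omit h0 h1 in
theorem eigenProgress_one : eigenProgress μ 1 = ∑ i, μ i := by simp [eigenProgress]

omit h0 h1 in
theorem eigenSlope_one : eigenSlope μ 1 = ∑ i, μ i * (1 - μ i) := by simp [eigenSlope]

theorem eigenProgress_le_card {α : ℝ} (hα : 0 < α) :
    eigenProgress μ α ≤ (Finset.univ.filter fun i => μ i ≠ 0).card := by
  rw [Finset.card_eq_sum_ones, Nat.cast_sum, eigenProgress,
    ← Finset.sum_filter_add_sum_filter_not Finset.univ (fun i => μ i ≠ 0)
      (fun i => α * μ i / (1 + (α - 1) * μ i))]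
  have h₁ : ∑ i with ¬ μ i ≠ 0, α * μ i / (1 + (α - 1) * μ i) = 0 := by
    refine Finset.sum_eq_zero fun i hi => ?_
    have := (Finset.mem_filter.1 hi).2
    rw [not_not] at this
    rw [this]; simp
  rw [h₁, add_zero]
  refine Finset.sum_le_sum fun i _ => ?_
  rw [Nat.cast_one, div_le_one (eigenDenom_pos (h0 i) (h1 i) hα)]
  linarith [h1 i]

omit h0 h1 in
theorem hasDerivAt_eigenProgress_one : HasDerivAt (eigenProgress μ) (eigenSlope μ 1) 1 := by
  unfold eigenProgress eigenSlope
  have : ∀ i ∈ Finset.univ, HasDerivAt (fun α : ℝ => α * μ i / (1 + (α - 1) * μ i))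
      (μ i * (1 - μ i) / (1 + ((1 : ℝ) - 1) * μ i) ^ 2) 1 := by
    intro i _
    have hn : HasDerivAt (fun α : ℝ => α * μ i) (1 * μ i) 1 := (hasDerivAt_id 1).mul_const _
    have hd : HasDerivAt (fun α : ℝ => 1 + (α - 1) * μ i) (1 * μ i) 1 :=
      (((hasDerivAt_id 1).sub_const 1).mul_const _).const_add 1
    refine (hn.fun_div hd (by simp)).congr_deriv ?_
    simp
    ring
  exact HasDerivAt.fun_sum this

/-- As μᵢ ≤ 1, each denominator 1 + (α - 1)μᵢ is at most α. -/
theorem eigenProgress_sub_one_ge {α : ℝ} (hα : 1 ≤ α) :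
    eigenSlope μ 1 * ((α - 1) / α) ≤ eigenProgress μ α - eigenProgress μ 1 := by
  have hα0 : 0 < α := by linarith
  rw [eigenSlope_one, eigenProgress, eigenProgress, ← Finset.sum_sub_distrib, Finset.sum_mul]
  refine Finset.sum_le_sum fun i _ => ?_
  rw [eigenTerm_sub (h0 i) (h1 i) one_pos hα0, mul_div_assoc]
  have h₁ := eigenDenom_pos (h0 i) (h1 i) hα0
  have hx := h0 i
  have hx' : 0 ≤ 1 - μ i := by linarith [h1 i]
  refine mul_le_mul_of_nonneg_left ?_ (mul_nonneg hx hx')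
  have h₂ : 0 ≤ α - 1 := by linarith
  rw [sub_self, zero_mul, add_zero, one_mul]
  exact div_le_div_of_nonneg_left h₂ h₁ (by nlinarith)

/-- One Newton–Dinkelbach step from `1` suffices if the slope there is at least a quarter of the
distance to the target. -/
theorem eigenProgress_newton_one {γ : ℝ} (hγ : 0 < γ) (hs : γ / 4 ≤ eigenSlope μ 1) :
    eigenProgress μ 1 + γ / 5 ≤ eigenProgress μ (1 + γ / eigenSlope μ 1) := by
  have hs0 : 0 < eigenSlope μ 1 := by linarith
  have h := eigenProgress_sub_one_ge h0 h1 (α := 1 + γ / eigenSlope μ 1)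
    (by have := div_pos hγ hs0; linarith)
  have h₂ : eigenSlope μ 1 * ((1 + γ / eigenSlope μ 1 - 1) / (1 + γ / eigenSlope μ 1))
      = γ * (eigenSlope μ 1 / (eigenSlope μ 1 + γ)) := by
    field_simp
    ring
  -- This is where the thresholds match: s/(s + γ) ≥ 1/5 means exactly s ≥ γ/4.
  have h₃ : 1 / 5 ≤ eigenSlope μ 1 / (eigenSlope μ 1 + γ) := by
    rw [div_le_div_iff₀ (by norm_num) (by linarith)]
    linarith
  rw [h₂] at h
  nlinarith

/-- The part that the eigenvalues of size at least `1/2` are missing to one. -/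
noncomputable def largeDefect (μ : Fin d → ℝ) : ℝ := ∑ i with ¬ μ i < 1 / 2, (1 - μ i)

omit h0 in
theorem largeDefect_nonneg : 0 ≤ largeDefect μ :=
  Finset.sum_nonneg fun i _ => by linarith [h1 i]

/-- x(1 - x) is at least x/2 below 1/2 and at least (1 - x)/2 above it. So a small slope at 1 forces
every eigenvalue close to 0 or 1. -/
theorem smallSum_add_largeDefect_le : smallSum μ + largeDefect μ ≤ 2 * eigenSlope μ 1 := by
  rw [eigenSlope_one, ← Finset.sum_filter_add_sum_filter_not Finset.univ (fun i => μ i < 1 / 2)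
      (fun i => μ i * (1 - μ i)), mul_add, Finset.mul_sum, Finset.mul_sum, smallSum, largeDefect]
  refine add_le_add (Finset.sum_le_sum fun i hi => ?_) (Finset.sum_le_sum fun i hi => ?_)
  · have := (Finset.mem_filter.1 hi).2
    have := h0 i
    nlinarith
  · have := (Finset.mem_filter.1 hi).2
    have := h1 i
    nlinarith

omit h0 h1 in
theorem sum_eq_smallSum : ∑ i, μ i = smallSum μ + (largeCount μ - largeDefect μ) := by
  rw [← Finset.sum_filter_add_sum_filter_not Finset.univ (fun i => μ i < 1 / 2) μ, largeDefect,
    Finset.sum_sub_distrib, largeCount, Finset.card_eq_sum_ones, Nat.cast_sum, smallSum]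
  simp

/-- The trace differs from `largeCount μ` by the small sum minus the large defect, whose total is
below γ/2 ≤ 1/2. Hence rounding the trace finds p. -/
theorem largeCount_near {γ : ℝ} (hγ : γ ≤ 1) (hs : eigenSlope μ 1 < γ / 4) :
    (largeCount μ : ℝ) - 1 / 2 < ∑ i, μ i ∧ ∑ i, μ i < largeCount μ + 1 / 2 := by
  have h₁ := smallSum_add_largeDefect_le h0 h1
  have h₂ := smallSum_nonneg h0
  have h₃ := largeDefect_nonneg h1
  rw [sum_eq_smallSum]
  constructor <;> linarith

/-- If the slope at `1` is small then there is a positive eigenvalue smaller than `1/2`. -/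
theorem exists_small_eigenvalue {γ : ℝ} (hγ : 0 < γ) (hs : eigenSlope μ 1 < γ / 4)
    (hsup : γ ≤ ∑ i with μ i ≠ 0, (1 - μ i)) : ∃ i, μ i < 1 / 2 ∧ 0 < μ i := by
  by_contra hcon
  push Not at hcon
  have : ∑ i with μ i ≠ 0, (1 - μ i) ≤ largeDefect μ := by
    refine Finset.sum_le_sum_of_subset_of_nonneg (fun i hi => ?_)
      fun i _ _ => by linarith [h1 i]
    rw [Finset.mem_filter] at hi ⊢
    refine ⟨Finset.mem_univ i, fun hlt => hi.2 (le_antisymm (hcon i hlt) (h0 i))⟩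
  have h₁ := smallSum_add_largeDefect_le h0 h1
  have h₂ := smallSum_nonneg h0
  linarith

omit h1 in
theorem smallSum_pos {i : Fin d} (hi : μ i < 1 / 2) (hi' : 0 < μ i) : 0 < smallSum μ :=
  Finset.sum_pos' (fun i _ => h0 i) ⟨i, by simp; linarith, hi'⟩

omit h0 h1 in
theorem largeCount_lt_card {i : Fin d} (hi : μ i < 1 / 2) (hi' : 0 < μ i) :
    largeCount μ < (Finset.univ.filter fun i => μ i ≠ 0).card := by
  refine Finset.card_lt_card ⟨fun j hj => ?_, fun hsub => ?_⟩
  · rw [Finset.mem_filter] at hj ⊢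
    refine ⟨Finset.mem_univ j, fun h => hj.2 ?_⟩
    rw [h]; norm_num
  · have := hsub (Finset.mem_filter.2 ⟨Finset.mem_univ i, hi'.ne'⟩)
    exact (Finset.mem_filter.1 this).2 hi

/-- Small eigenvalues gain at most μᵢγ/(2m) each, at most γ/2 in total. Large ones gain at most
their defect 1 - μᵢ, again less than γ/2 in total. -/
theorem eigenProgress_start_le {γ m : ℝ} (hγ : 0 < γ) (hs : eigenSlope μ 1 < γ / 4)
    (hm : 0 < m) (hsm : smallSum μ ≤ m) :
    eigenProgress μ (1 + γ / (2 * m)) ≤ eigenProgress μ 1 + γ := by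
  have hδ : 0 < γ / (2 * m) := by positivity
  have hα : 0 < 1 + γ / (2 * m) := by linarith
  have hld := smallSum_add_largeDefect_le h0 h1
  have hs0 := smallSum_nonneg h0
  have hsum : eigenProgress μ (1 + γ / (2 * m)) - eigenProgress μ 1
      ≤ smallSum μ * (γ / (2 * m)) + largeDefect μ := by
    rw [eigenProgress, eigenProgress, ← Finset.sum_sub_distrib,
      ← Finset.sum_filter_add_sum_filter_not Finset.univ (fun i => μ i < 1 / 2), smallSum,
      Finset.sum_mul, largeDefect]
    have hterm : ∀ i, (1 + γ / (2 * m)) * μ i / (1 + (1 + γ / (2 * m) - 1) * μ i)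
        - 1 * μ i / (1 + (1 - 1) * μ i)
        = μ i * (1 - μ i) * (γ / (2 * m)) / (1 + γ / (2 * m) * μ i) := by
      intro i
      rw [eigenTerm_sub (h0 i) (h1 i) one_pos hα]
      simp
    refine add_le_add (Finset.sum_le_sum fun i hi => ?_) (Finset.sum_le_sum fun i hi => ?_)
    · rw [hterm]
      have h₀ := h0 i
      have h₁ := h1 i
      have hp : 0 ≤ γ / (2 * m) * μ i := by positivity
      rw [div_le_iff₀ (by linarith)]
      nlinarith [mul_nonneg hp h₀, mul_nonneg hp hp]
    · rw [hterm]
      have h₀ := h0 i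
      have h₁ := h1 i
      have hp : 0 ≤ γ / (2 * m) * μ i := by positivity
      rw [div_le_iff₀ (by linarith)]
      nlinarith
  have h₂ : smallSum μ * (γ / (2 * m)) ≤ γ / 2 := by
    calc smallSum μ * (γ / (2 * m)) ≤ m * (γ / (2 * m)) :=
          mul_le_mul_of_nonneg_right hsm hδ.le
      _ = γ / 2 := by field_simp
  linarith

/-- As long as the progress is small the slope stays comparable to the small eigenvalues. -/
theorem smallSum_le_eigenSlope {γ α : ℝ} (hγ : γ ≤ 1) (hα : 1 ≤ α)
    (hlt : eigenProgress μ α < eigenProgress μ 1 + γ / 5) :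
    9 / 50 * smallSum μ ≤ eigenSlope μ α := by
  have hα0 : 0 < α := by linarith
  have hterm : ∀ i, α * μ i / (1 + (α - 1) * μ i) - 1 * μ i / (1 + (1 - 1) * μ i)
      = μ i * (1 - μ i) * (α - 1) / (1 + (α - 1) * μ i) := by
    intro i
    rw [eigenTerm_sub (h0 i) (h1 i) one_pos hα0]
    simp
  have hnn : ∀ i, 0 ≤ μ i * (1 - μ i) * (α - 1) / (1 + (α - 1) * μ i) := fun i =>
    div_nonneg (mul_nonneg (mul_nonneg (h0 i) (by linarith [h1 i])) (by linarith))
      (eigenDenom_pos (h0 i) (h1 i) hα0).le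
  have hsmall : ∀ i, μ i * (1 - μ i) * (α - 1) / (1 + (α - 1) * μ i) < 1 / 5 := by
    intro i
    have h₁ : eigenProgress μ α - eigenProgress μ 1
        = ∑ i, μ i * (1 - μ i) * (α - 1) / (1 + (α - 1) * μ i) := by
      rw [eigenProgress, eigenProgress, ← Finset.sum_sub_distrib]
      exact Finset.sum_congr rfl fun i _ => hterm i
    have h₂ := Finset.single_le_sum (fun i _ => hnn i) (Finset.mem_univ i)
    linarith
  rw [smallSum, Finset.mul_sum, eigenSlope]
  refine (Finset.sum_le_sum fun i hi => ?_).trans (Finset.sum_le_sum_of_subset_of_nonneg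
    (Finset.subset_univ (Finset.univ.filter fun i => μ i < 1 / 2))
    fun i _ _ => eigenSlope_term_nonneg h0 h1 α i)
  have hi' := (Finset.mem_filter.1 hi).2
  have h₀ := h0 i
  have hs := hsmall i
  have hp : 0 ≤ (α - 1) * μ i := mul_nonneg (by linarith) h₀
  rw [div_lt_iff₀ (by linarith)] at hs
  -- Put x = (α - 1)μᵢ. The i-th gain (1 - μᵢ)x/(1 + x) is below 1/5 and μᵢ < 1/2, so x/2 ≤ (1 +
  -- x)/5. The squared denominator is then at most 25/9, and 9/50 is half of 9/25.
  have hx : (α - 1) * μ i ≤ 2 / 3 := by nlinarith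
  rw [le_div_iff₀ (by positivity)]
  have hsq : (1 + (α - 1) * μ i) ^ 2 ≤ 25 / 9 := by nlinarith
  nlinarith

/-- By concavity the slope at the start is at most the mean slope from 1, a gain of at most γ over a
length γ/(2m). -/
theorem eigenSlope_start_le {γ m : ℝ} (hγ : 0 < γ) (hs : eigenSlope μ 1 < γ / 4)
    (hm : 0 < m) (hsm : smallSum μ ≤ m) : eigenSlope μ (1 + γ / (2 * m)) ≤ 2 * m := by
  have hδ : 0 < γ / (2 * m) := by positivity
  have h₁ := eigenProgress_start_le h0 h1 hγ hs hm hsm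
  have h₂ := eigenProgress_le_tangent h0 h1 (α := 1 + γ / (2 * m)) (β := 1) (by linarith) one_pos
  have h₃ : eigenSlope μ (1 + γ / (2 * m)) * (γ / (2 * m)) ≤ 2 * m * (γ / (2 * m)) := by
    have : 2 * m * (γ / (2 * m)) = γ := by field_simp
    rw [this]
    linarith
  exact le_of_mul_le_mul_right h₃ hδ

/-- A Newton–Dinkelbach step that stays below the lower target divides the slope by five. -/
theorem eigenSlope_newton_le {γ α : ℝ} (hγ : 0 < γ) (hα : 1 ≤ α) (hs : 0 < eigenSlope μ α)
    (hle : eigenProgress μ α ≤ eigenProgress μ 1 + γ)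
    (hlt : eigenProgress μ (α + (eigenProgress μ 1 + γ - eigenProgress μ α) / eigenSlope μ α)
      < eigenProgress μ 1 + γ / 5) :
    eigenSlope μ (α + (eigenProgress μ 1 + γ - eigenProgress μ α) / eigenSlope μ α)
      ≤ eigenSlope μ α / 5 := by
  set f := eigenProgress μ 1 + γ - eigenProgress μ α with hf
  have hq : 0 ≤ f / eigenSlope μ α := div_nonneg (by linarith) hs.le
  set β := α + f / eigenSlope μ α with hβ
  have h₁ := eigenProgress_le_tangent h0 h1 (α := β) (β := α) (by linarith) (by linarith)
  have h₂ := eigenProgress_mono h0 h1 one_pos hα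
  have hmono := eigenProgress_mono h0 h1 (α := α) (β := β) (by linarith) (by linarith)
  have hfγ : f ≤ γ := by linarith
  have hf0 : 4 / 5 * γ < f := by linarith
  have h₃ : α - β = - (f / eigenSlope μ α) := by rw [hβ]; ring
  rw [h₃] at h₁
  -- At β more than 4γ/5 ≥ 4f/5 of the gap f is still open, so the step, which the tangent predicted
  -- to gain f, gains less than f/5.
  have h₄ : eigenSlope μ β * (f / eigenSlope μ α) ≤ f / 5 := by linarith
  have h₅ : eigenSlope μ β * f ≤ eigenSlope μ α / 5 * f := by
    have : eigenSlope μ β * (f / eigenSlope μ α) * eigenSlope μ α = eigenSlope μ β * f := by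
      field_simp
    nlinarith
  exact le_of_mul_le_mul_right h₅ (by linarith)

theorem eigenProgress_newton_le {γ α : ℝ} (hα : 1 ≤ α) (hs : 0 < eigenSlope μ α)
    (hle : eigenProgress μ α ≤ eigenProgress μ 1 + γ) :
    eigenProgress μ (α + (eigenProgress μ 1 + γ - eigenProgress μ α) / eigenSlope μ α)
      ≤ eigenProgress μ 1 + γ := by
  have hq : 0 ≤ (eigenProgress μ 1 + γ - eigenProgress μ α) / eigenSlope μ α :=
    div_nonneg (by linarith) hs.le
  have h₁ := eigenProgress_le_tangent h0 h1 (α := α)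
    (β := α + (eigenProgress μ 1 + γ - eigenProgress μ α) / eigenSlope μ α)
    (by linarith) (by linarith)
  rw [add_sub_cancel_left, mul_div_cancel₀ _ hs.ne'] at h₁
  linarith

end Eigen

/-! ### Consequences of the margin for the spectrum -/

namespace SpectralData

variable {d n : ℕ} {U : Matrix (Fin d) (Fin n) ℝ} {z : Fin n → ℝ} {T : Finset (Fin n)}
  {Q R : Matrix (Fin d) (Fin d) ℝ} {μ : Fin d → ℝ} (h : SpectralData U z T Q R μ)
include h

theorem deriv_progress : deriv (progress U z T) 1 = eigenSlope μ 1 := by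
  refine HasDerivAt.deriv (hasDerivAt_eigenProgress_one.congr_of_eventuallyEq ?_)
  filter_upwards [lt_mem_nhds (zero_lt_one' ℝ)] with α hα
  exact h.progress_eq hα

/-- Each nonzero eigenvalue contributes at most 1 to h, so the supremum is at most their number. -/
theorem margin_le_sum {γ : ℝ} (hf : Feasible U z T γ) : γ ≤ ∑ i with μ i ≠ 0, (1 - μ i) := by
  have hsup : sSup (progress U z T '' Set.Ici 1) ≤ (Finset.univ.filter fun i => μ i ≠ 0).card := by
    refine csSup_le ⟨_, Set.mem_image_of_mem _ (Set.mem_Ici.2 le_rfl)⟩ ?_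
    rintro _ ⟨α, hα, rfl⟩
    have hα0 : 0 < α := by linarith [Set.mem_Ici.1 hα]
    rw [h.progress_eq hα0]
    exact eigenProgress_le_card h.nonneg h.le_one hα0
  have h₁ := hf.progress_sup
  rw [h.progress_eq one_pos, eigenProgress_one] at h₁
  have h₂ : ∑ i with μ i ≠ 0, μ i = ∑ i, μ i := by
    refine Finset.sum_subset (Finset.filter_subset _ _) fun i _ hi => ?_
    simpa using hi
  rw [Finset.sum_sub_distrib, h₂]
  have h₃ : ∑ i with μ i ≠ 0, (1 : ℝ) = (Finset.univ.filter fun i => μ i ≠ 0).card := by simp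
  rw [h₃]
  linarith

/-- If all eigenvalues were 0 or 1 there would be no margin. This keeps the Newton–Dinkelbach
division legitimate. -/
theorem slope_pos {γ : ℝ} (hf : Feasible U z T γ) {α : ℝ} (hα : 0 < α) : 0 < eigenSlope μ α := by
  have h₁ := h.margin_le_sum hf
  have h₂ := hf.margin_pos
  obtain ⟨i, hi, hi'⟩ : ∃ i, μ i ≠ 0 ∧ μ i ≠ 1 := by
    by_contra hcon
    push Not at hcon
    have : ∑ i with μ i ≠ 0, (1 - μ i) = 0 :=
      Finset.sum_eq_zero fun i hi => by rw [hcon i (Finset.mem_filter.1 hi).2, sub_self]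
    linarith
  exact eigenSlope_pos h.nonneg h.le_one hα hi hi'

end SpectralData

/-! ## The update algorithm -/

section Update

variable {d n : ℕ} {U : Matrix (Fin d) (Fin n) ℝ} {z : Fin n → ℝ} {T : Finset (Fin n)}
  {Q R : Matrix (Fin d) (Fin d) ℝ} {μ : Fin d → ℝ} {γ : ℝ}

theorem SpectralData.trace_gram_mul_inv (h : SpectralData U z T Q R μ) :
    (gram U z T * (gram U z Finset.univ)⁻¹).trace = ∑ i, μ i := by
  rw [h.gram_mul_inv, h.trace_conj]

/-- T is neither empty (all μᵢ = 0) nor everything (all μᵢ = 1), as either leaves no margin. With d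
≥ 1 this makes log(nd) bounded below and n + d ≥ 3. -/
theorem Feasible.two_le (hf : Feasible U z T γ) : 2 ≤ n := by
  obtain ⟨Q, R, μ, h⟩ := exists_spectralData hf.rank_eq hf.scaling_pos T
  have h₁ := h.margin_le_sum hf
  have h₂ := hf.margin_pos
  have h₃ := h.trace_gram_mul_inv
  obtain ⟨j, hj⟩ : ∃ j, j ∈ T := by
    by_contra hcon
    push Not at hcon
    obtain rfl : T = ∅ := Finset.eq_empty_of_forall_notMem hcon
    have h₄ : gram U z ∅ = 0 := by ext; simp [gram_apply]
    rw [h₄, Matrix.zero_mul, Matrix.trace_zero, eq_comm,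
      Finset.sum_eq_zero_iff_of_nonneg fun i _ => h.nonneg i] at h₃
    rw [Finset.filter_eq_empty_iff.2 fun i hi => by simpa using h₃ i hi] at h₁
    simp at h₁
    linarith
  obtain ⟨k, hk⟩ : ∃ k, k ∉ T := by
    by_contra hcon
    push Not at hcon
    obtain rfl : T = Finset.univ := Finset.eq_univ_of_forall hcon
    rw [Matrix.mul_nonsing_inv _ (gram_univ_det_ne_zero hf.rank_eq hf.scaling_pos).isUnit,
      Matrix.trace_one] at h₃
    have h₄ : ∑ i with μ i ≠ 0, (1 - μ i) ≤ ∑ i, (1 - μ i) :=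
      Finset.sum_le_sum_of_subset_of_nonneg (Finset.filter_subset _ _)
        fun i _ _ => sub_nonneg.2 (h.le_one i)
    rw [Finset.sum_sub_distrib (s := Finset.univ), ← h₃, Fintype.card_fin] at h₄
    simp only [Finset.sum_const, Finset.card_univ, Fintype.card_fin, nsmul_eq_mul, mul_one,
      sub_self] at h₄
    linarith
  have : Nontrivial (Fin n) := ⟨j, k, fun h => hk (h ▸ hj)⟩
  exact Nat.succ_le_of_lt (by simpa using Fintype.one_lt_card (α := Fin n))

theorem Feasible.one_le (hf : Feasible U z T γ) : 1 ≤ d := by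
  obtain ⟨Q, R, μ, h⟩ := exists_spectralData hf.rank_eq hf.scaling_pos T
  have := h.slope_pos hf one_pos
  rcases Nat.eq_zero_or_pos d with rfl | hd
  · simp [eigenSlope] at this
  · exact hd

/-- Bounds the number of exchanges: greedy search reaches (2n)⁻ᵖ, no minor exceeds p!, and the
exponent estimates (2n)ᵖ and p! separately. -/
theorem factorial_lt_two_pow {p : ℕ} (hn : 0 < n) :
    (p.factorial : ℝ) < 2 ^ (2 * n * p + p ^ 2 + 1) * (1 / (2 * n) : ℝ) ^ p := by
  have h₁ : p.factorial * (2 * n) ^ p < 2 ^ (2 * n * p + p ^ 2 + 1) := by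
    calc p.factorial * (2 * n) ^ p ≤ p ^ p * (2 * n) ^ p :=
          Nat.mul_le_mul_right _ (Nat.factorial_le_pow p)
      _ ≤ (2 ^ p) ^ p * (2 ^ (2 * n)) ^ p := by
          gcongr
          · exact Nat.lt_two_pow_self.le
          · exact Nat.lt_two_pow_self.le
      _ = 2 ^ (2 * n * p + p ^ 2) := by rw [← pow_mul, ← pow_mul, ← pow_add]; ring_nf
      _ < _ := Nat.pow_lt_pow_right one_lt_two (Nat.lt_succ_self _)
  have h₂ : (0 : ℝ) < (2 * n) ^ p := by positivity
  rw [div_pow, one_pow, mul_one_div, lt_div_iff₀ h₂]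
  exact_mod_cast h₁

section Specs

variable {σ : SizeMeasure} {L : ℕ} [hL : Fact (3 ≤ L)]

theorem Comp.approxSmallEigenSum_of_feasible (hf : Feasible U z T γ)
    (h : SpectralData U z T Q R μ) (hs : eigenSlope μ 1 < γ / 4)
    (hU : ∀ i j, σ.holds (L ^ 1) (U i j)) (hz : ∀ j, σ.holds (L ^ 1) (z j)) (hd : d ≤ L)
    (hn : n ≤ L) :
    ∃ m, Comp σ L 90 (FrameScaling.approxSmallEigenSum U z T) m ∧ σ.holds (L ^ 50) m ∧
      0 < smallSum μ ∧ smallSum μ ≤ m ∧ m ≤ (1 + 8 * n * d ^ 2) * smallSum μ := by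
  have hn0 : 0 < n := by have := hf.two_le; omega
  have hd0 : (1 : ℝ) ≤ d := by exact_mod_cast hf.one_le
  have hz0 := hf.scaling_pos
  obtain ⟨i, hi, hi'⟩ := exists_small_eigenvalue h.nonneg h.le_one hf.margin_pos hs
    (h.margin_le_sum hf)
  have hpos := smallSum_pos h.nonneg hi hi'
  obtain ⟨hp₁, hp₂⟩ := largeCount_near h.nonneg h.le_one hf.margin_le hs
  have hlt := largeCount_lt_card hi hi'
  have hrd : (gram U z T).rank ≤ d := by simpa using (gram U z T).rank_le_card_width
  rw [← h.rank_gram] at hlt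
  rw [← h.trace_gram_mul_inv] at hp₁ hp₂
  have hY := h.sum_frame_mul hz0
  have hpd : largeCount μ + 1 ≤ L := by omega
  obtain ⟨m, hm, hm', hcase⟩ := Comp.approxSmallEigenSum (σ := σ) (L := L) (T := T) hU hz hd hn
    (gram_univ_det_ne_zero hf.rank_eq hz0) rfl rfl (p := largeCount μ) (by omega) hp₁ hp₂ hlt hrd
    (flCoeff_rank_ne_zero (gram_posSemidef hz0 T).isHermitian)
    (c := 1 / (2 * n)) (B := (largeCount μ).factorial)
    (N := 2 * n * largeCount μ + largeCount μ ^ 2 + 1) (by positivity)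
    (by
      have h3 := hL.out
      calc 2 * n * largeCount μ + largeCount μ ^ 2 + 1 ≤ 3 * L ^ 2 := by nlinarith
        _ ≤ L ^ 3 := three_mul_pow_le 2)
    (factorial_lt_two_pow hn0)
    (fun D hD hDp => by
      rw [h.principalMinor_eq hz0, ← hDp]
      exact principalMinor_le_factorial h.le_one hY hD)
    (fun G hGT hGp hG => by
      simp only [h.principalMinor_eq hz0] at hG ⊢
      exact exists_principalMinor_insert h.nonneg hY hGp hG)
    (fun D _ hD => (h.frame_gram hz0 hD).1)
  refine ⟨m, hm, hm', hpos, ?_⟩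
  have hnd : (1 : ℝ) + 4 * n * d ≤ 1 + 8 * n * d ^ 2 := by
    have : (0 : ℝ) ≤ n * d := by positivity
    nlinarith
  rcases hcase with ⟨hp0, hm0⟩ | ⟨D, hDT, hDp, hDpos, hopt, hmD⟩
  -- For p = 0 every eigenvalue is small, and the trace is the small sum itself.
  · have h₁ : m = smallSum μ := by
      have h₂ : ∀ i, μ i < 1 / 2 := by simpa [largeCount] using hp0
      rw [hm0, h.trace_gram_mul_inv, smallSum, Finset.filter_true_of_mem fun i _ => h₂ i]
    rw [h₁]
    have : (0 : ℝ) ≤ n * d ^ 2 := by positivity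
    exact ⟨le_rfl, by nlinarith⟩
  · rw [(h.frame_gram hz0 hDpos).2] at hmD
    have hK : ∀ E, principalMinor _ E = principalMinor _ E := h.principalMinor_eq hz0
    unfold ExchangeOptimal at hopt
    simp only [hK] at hDpos hopt
    have hlow := smallSum_add_le_trace (μ := μ)
      (A := columns (Rᵀ * U * Matrix.diagonal fun j => √(z j)) D)
      (by rw [← principalMinor_gram]; exact hDpos.ne')
    have hupp := residual_trace_le h.nonneg h.le_one hY hDT hDp hDpos hopt
    rw [← hmD] at hlow hupp
    rw [Fintype.card_fin, hDp, sub_self, zero_div, add_zero] at hlow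
    exact ⟨hlow, hupp.trans (by rw [mul_comm]; gcongr)⟩

theorem Comp.evalH_eigen (h : SpectralData U z T Q R μ) {α : ℝ} (hα0 : 0 < α)
    (hU : ∀ i j, σ.holds (L ^ 1) (U i j)) (hz : ∀ j, σ.holds (L ^ 1) (z j)) (hd : d ≤ L)
    (hn : n ≤ L) (hα : σ.holds (L ^ 1) α) :
    Comp σ L 60 (FrameScaling.evalH U z T α) (eigenProgress μ α) ∧
      σ.holds (L ^ 21) (eigenProgress μ α) := by
  rw [← h.value_eq hα0]
  exact Comp.evalH hU hz hd hn T hα (h.scaledGram_det_ne_zero hα0)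

theorem Comp.evalDerivH_eigen (h : SpectralData U z T Q R μ) {α : ℝ} (hα0 : 0 < α)
    (hU : ∀ i j, σ.holds (L ^ 1) (U i j)) (hz : ∀ j, σ.holds (L ^ 1) (z j)) (hd : d ≤ L)
    (hn : n ≤ L) (hα : σ.holds (L ^ 1) α) :
    Comp σ L 60 (FrameScaling.evalDerivH U z T α) (eigenSlope μ α) ∧
      σ.holds (L ^ 23) (eigenSlope μ α) := by
  rw [← h.slope_eq hα0]
  exact Comp.evalDerivH hU hz hd hn T hα (h.scaledGram_det_ne_zero hα0)

theorem Comp.ndStep_eigen (hf : Feasible U z T γ) (h : SpectralData U z T Q R μ) {α lo hi : ℝ}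
    (hα1 : 1 ≤ α) (hU : ∀ i j, σ.holds (L ^ 1) (U i j)) (hz : ∀ j, σ.holds (L ^ 1) (z j))
    (hd : d ≤ L) (hn : n ≤ L) (hα : σ.holds (L ^ 1) α) (hhi : σ.holds (L ^ 1) hi) (i : ℕ) :
    ∃ r, Comp σ L 70 (ndStep (FrameScaling.evalH U z T) (FrameScaling.evalDerivH U z T) lo hi (α, i))
      r ∧ ((eigenProgress μ α < lo ∧
          r = Sum.inl (α + (hi - eigenProgress μ α) / eigenSlope μ α, i + 1)) ∨
        (lo ≤ eigenProgress μ α ∧ r = Sum.inr (α, i))) := by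
  have hα0 : 0 < α := by linarith
  obtain ⟨c₁, s₁⟩ := Comp.evalH_eigen h hα0 hU hz hd hn hα
  obtain ⟨c₂, s₂⟩ := Comp.evalDerivH_eigen h hα0 hU hz hd hn hα
  have hslope := h.slope_pos hf hα0
  have c₃ := Comp.lt (σ := σ) (L := L) (eigenProgress μ α) lo
  unfold ndStep
  by_cases hlt : eigenProgress μ α < lo
  · refine ⟨_, ?_, Or.inl ⟨hlt, rfl⟩⟩
    have c₄ := Comp.sub hhi s₁
    have s₄ := SizeMeasure.sub hhi s₁
    have c₅ := Comp.div s₄ s₂ hslope.ne'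
    have s₅ := SizeMeasure.div s₄ s₂
    have c₆ := Comp.add hα s₅
    refine (c₁.bind (c₃.bind (e := 67) ?_)).mono
    simp only [hlt, decide_true, if_true]
    exact c₂.bind (c₄.bind (c₅.bind (c₆.bind (Comp.ret _ 63)))) (e := 66)
  · refine ⟨_, ?_, Or.inr ⟨not_lt.1 hlt, rfl⟩⟩
    refine (c₁.bind (c₃.bind (e := 67) ?_)).mono
    simp only [hlt, decide_false, Bool.false_eq_true, if_false]
    exact Comp.ret _ _

theorem Comp.updateSetup_eigen (hf : Feasible U z T γ) (h : SpectralData U z T Q R μ)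
    (hU : ∀ i j, σ.holds (L ^ 1) (U i j)) (hz : ∀ j, σ.holds (L ^ 1) (z j))
    (hd : d ≤ L) (hn : n ≤ L) (hγ : σ.holds (L ^ 1) γ) :
    ∃ s, Comp σ L 110 (updateSetup U z T γ) s ∧ s.lo = eigenProgress μ 1 + γ / 5 ∧
      s.hi = eigenProgress μ 1 + γ ∧ (γ / 4 ≤ eigenSlope μ 1 → s.start = 1) ∧
      (eigenSlope μ 1 < γ / 4 → ∃ m, Comp σ L 90 (FrameScaling.approxSmallEigenSum U z T) m ∧
        0 < smallSum μ ∧ smallSum μ ≤ m ∧ m ≤ (1 + 8 * n * d ^ 2) * smallSum μ ∧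
        s.start = 1 + γ / (2 * m)) := by
  have s₁ : σ.holds (L ^ 1) 1 := SizeMeasure.one_le 1
  have t₂ := Comp.add s₁ s₁
  have s₂ := SizeMeasure.add s₁ s₁
  have t₄ := Comp.add s₂ s₂
  have s₄ := SizeMeasure.add s₂ s₂
  have t₅ := Comp.add s₄ s₁
  have s₅ := SizeMeasure.add s₄ s₁
  obtain ⟨c₁, u₁⟩ := Comp.evalH_eigen h one_pos hU hz hd hn s₁
  obtain ⟨c₂, u₂⟩ := Comp.evalDerivH_eigen h one_pos hU hz hd hn s₁
  have c₃ := Comp.div hγ s₄ (by norm_num)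
  have c₄ := Comp.lt (σ := σ) (L := L) (eigenSlope μ 1) (γ / (1 + 1 + (1 + 1)))
  have c₅ := Comp.div hγ s₅ (by norm_num)
  have u₅ := SizeMeasure.div hγ s₅
  have c₆ := Comp.add u₁ u₅
  have c₇ := Comp.add u₁ hγ
  have h4 : (1 : ℝ) + 1 + (1 + 1) = 4 := by norm_num
  have h5 : (1 : ℝ) + 1 + (1 + 1) + 1 = 5 := by norm_num
  have tail : ∀ α₀ : ℝ, Comp σ L 80 (do
      let h₁ ← FrameScaling.evalH U z T 1
      let γ₅ ← Prog.arith .div γ (1 + 1 + (1 + 1) + 1)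
      let lo ← Prog.arith .add h₁ γ₅
      let hi ← Prog.arith .add h₁ γ
      pure ({ start := α₀, lo := lo, hi := hi } : NDInput ℝ))
      { start := α₀, lo := eigenProgress μ 1 + γ / (1 + 1 + (1 + 1) + 1),
        hi := eigenProgress μ 1 + γ } := fun α₀ =>
    c₁.bind (c₅.bind (c₆.bind (c₇.bind (Comp.ret _ 76)))) (e := 79)
  unfold updateSetup
  by_cases hlt : eigenSlope μ 1 < γ / 4
  · obtain ⟨m, cm, sm, hpos, hm, hm'⟩ :=
      Comp.approxSmallEigenSum_of_feasible (σ := σ) (L := L) hf h hlt hU hz hd hn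
    have c₈ := Comp.add sm sm
    have s₈ := SizeMeasure.add sm sm
    have c₉ := Comp.div hγ s₈ (by linarith)
    have s₉ := SizeMeasure.div hγ s₈
    have c₁₀ := Comp.add s₁ s₉
    refine ⟨{ start := 1 + γ / (m + m), lo := eigenProgress μ 1 + γ / (1 + 1 + (1 + 1) + 1),
                hi := eigenProgress μ 1 + γ },
      Comp.one.bind (e := 109) (t₂.bind (e := 108) (t₄.bind (e := 107) (t₅.bind (e := 106)
        (c₂.bind (e := 105) (c₃.bind (e := 104) (c₄.bind (e := 103) ?_)))))), ?_⟩
    · rw [← h4] at hlt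
      simp only [hlt, decide_true, if_true]
      exact cm.bind (e := 102) (c₈.bind (e := 101) (c₉.bind (e := 100) (c₁₀.bind (e := 99)
        ((tail _).mono (f := 99)))))
    · exact ⟨by rw [h5], rfl, fun hge => absurd hlt (not_lt.2 hge),
        fun _ => ⟨m, cm, hpos, hm, hm', by rw [two_mul]⟩⟩
  · refine ⟨{ start := 1, lo := eigenProgress μ 1 + γ / (1 + 1 + (1 + 1) + 1),
                hi := eigenProgress μ 1 + γ },
      Comp.one.bind (e := 109) (t₂.bind (e := 108) (t₄.bind (e := 107) (t₅.bind (e := 106)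
        (c₂.bind (e := 105) (c₃.bind (e := 104) (c₄.bind (e := 103) ?_)))))), ?_⟩
    · rw [← h4] at hlt
      simp only [hlt, decide_false, Bool.false_eq_true, if_false]
      exact (Comp.ret 1 0).bind (e := 102) ((tail 1).mono (f := 102))
    · exact ⟨by rw [h5], rfl, fun _ => rfl, fun h => absurd h hlt⟩

end Specs

/-- One unfolding of the Newton–Dinkelbach loop. -/
theorem Cost.newtonDinkelbach_step (hf : Feasible U z T γ) (h : SpectralData U z T Q R μ)
    [Fact (3 ≤ n + d)] {α : ℝ} (hα : 1 ≤ α) (lo hi : ℝ) (i : ℕ) :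
    (lo ≤ eigenProgress μ α ∧ Cost SizeMeasure.trivial ((n + d) ^ 70) 0
      (Prog.loop (ndStep (evalH U z T) (evalDerivH U z T) lo hi) (α, i)) (α, i)) ∨
    (eigenProgress μ α < lo ∧ ∀ M r, Cost SizeMeasure.trivial M 0
      (Prog.loop (ndStep (evalH U z T) (evalDerivH U z T) lo hi)
        (α + (hi - eigenProgress μ α) / eigenSlope μ α, i + 1)) r →
      Cost SizeMeasure.trivial ((n + d) ^ 70 + M) 0
        (Prog.loop (ndStep (evalH U z T) (evalDerivH U z T) lo hi) (α, i)) r) := by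
  obtain ⟨r, ⟨t, vs, hr, ht, -⟩, ⟨hlt, rfl⟩ | ⟨hle, rfl⟩⟩ :=
    Comp.ndStep_eigen (σ := SizeMeasure.trivial) (L := n + d) hf h (lo := lo) (hi := hi) hα
      (fun _ _ => trivial) (fun _ => trivial) (Nat.le_add_left _ _) (Nat.le_add_right _ _)
      trivial trivial i
  · refine Or.inr ⟨hlt, ?_⟩
    rintro M r ⟨t', vs', hr', ht', -⟩
    exact ⟨t + t', vs ++ vs', LoopRuns.next hr hr', add_le_add ht ht', fun _ _ => trivial⟩
  · exact Or.inl ⟨hle, t, vs, LoopRuns.exit hr, ht, fun _ _ => trivial⟩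

/-- Below the lower target the slope is at least 9/50 of the small sum, and each further iteration
there takes away a factor five of the excess. The size measure is trivial because sizes are
controlled per round only. -/
theorem Cost.newtonDinkelbach_of_slope_lt (hf : Feasible U z T γ)
    (h : SpectralData U z T Q R μ) [Fact (3 ≤ n + d)] : ∀ (N : ℕ) (α : ℝ) (i : ℕ), 1 ≤ α →
    eigenProgress μ α ≤ eigenProgress μ 1 + γ →
    (eigenProgress μ α < eigenProgress μ 1 + γ / 5 →
      eigenSlope μ α < 9 / 50 * smallSum μ * 5 ^ N) →
    ∃ β j, Cost SizeMeasure.trivial ((N + 1) * (n + d) ^ 70) 0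
      (Prog.loop (ndStep (evalH U z T) (evalDerivH U z T) (eigenProgress μ 1 + γ / 5)
        (eigenProgress μ 1 + γ)) (α, i)) (β, j) ∧ j ≤ i + N ∧ 1 ≤ β ∧
      eigenProgress μ 1 + γ / 5 ≤ eigenProgress μ β ∧ eigenProgress μ β ≤ eigenProgress μ 1 + γ := by
  intro N
  induction N with
  | zero =>
    intro α i hα hle hslope
    rcases Cost.newtonDinkelbach_step hf h hα (eigenProgress μ 1 + γ / 5)
      (eigenProgress μ 1 + γ) i with ⟨hge, hc⟩ | ⟨hlt, -⟩
    · exact ⟨α, i, by simpa using hc, le_rfl, hα, hge, hle⟩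
    · have := hslope hlt
      rw [pow_zero, mul_one] at this
      exact absurd (smallSum_le_eigenSlope h.nonneg h.le_one hf.margin_le hα hlt) (not_le.2 this)
  | succ N ih =>
    intro α i hα hle hslope
    rcases Cost.newtonDinkelbach_step hf h hα (eigenProgress μ 1 + γ / 5)
      (eigenProgress μ 1 + γ) i with ⟨hge, hc⟩ | ⟨hlt, hc⟩
    · refine ⟨α, i, hc.mono ?_ le_rfl, by omega, hα, hge, hle⟩
      exact Nat.le_mul_of_pos_left _ (Nat.succ_pos _)
    · have hs := h.slope_pos hf (α := α) (by linarith)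
      obtain ⟨β, j, hc', hj, hβ⟩ := ih _ (i + 1)
        (by have := div_nonneg (sub_nonneg.2 hle) hs.le; linarith)
        (eigenProgress_newton_le h.nonneg h.le_one hα hs hle)
        (fun hlt' => by
          have h₁ := eigenSlope_newton_le h.nonneg h.le_one hf.margin_pos hα hs hle hlt'
          have h₂ := hslope hlt
          rw [pow_succ] at h₂
          linarith)
      refine ⟨β, j, (hc _ _ hc').mono (le_of_eq ?_) le_rfl, by omega, hβ⟩
      ring

theorem Cost.newtonDinkelbach_of_le_slope (hf : Feasible U z T γ)
    (h : SpectralData U z T Q R μ) [Fact (3 ≤ n + d)] (hs : γ / 4 ≤ eigenSlope μ 1) :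
    ∃ β j, Cost SizeMeasure.trivial (2 * (n + d) ^ 70) 0
      (Prog.loop (ndStep (evalH U z T) (evalDerivH U z T) (eigenProgress μ 1 + γ / 5)
        (eigenProgress μ 1 + γ)) (1, 0)) (β, j) ∧ j ≤ 1 ∧ 1 ≤ β ∧
      eigenProgress μ 1 + γ / 5 ≤ eigenProgress μ β ∧ eigenProgress μ β ≤ eigenProgress μ 1 + γ := by
  have hγ := hf.margin_pos
  have hs0 := h.slope_pos hf one_pos
  rcases Cost.newtonDinkelbach_step hf h le_rfl (eigenProgress μ 1 + γ / 5)
    (eigenProgress μ 1 + γ) 0 with ⟨hge, -⟩ | ⟨hlt, hc⟩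
  · linarith
  have h₁ := eigenProgress_newton_le (γ := γ) h.nonneg h.le_one le_rfl hs0 (by linarith)
  rw [add_sub_cancel_left] at hc h₁
  have h₂ : (1 : ℝ) ≤ 1 + γ / eigenSlope μ 1 := by
    have := div_pos hγ hs0
    linarith
  have h₃ := eigenProgress_newton_one h.nonneg h.le_one hγ hs
  rcases Cost.newtonDinkelbach_step hf h h₂ (eigenProgress μ 1 + γ / 5)
    (eigenProgress μ 1 + γ) (0 + 1) with ⟨hge, hc'⟩ | ⟨hlt', -⟩
  · exact ⟨_, _, (hc _ _ hc').mono (by omega) le_rfl, le_rfl, h₂, h₃, h₁⟩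
  · linarith

/-- The left side is the ratio of the initial slope bound 2(1 + 8nd²)μ_s to the lower bound
(9/50)μ_s. -/
theorem slope_bound_lt_pow (hn : 2 ≤ n) (hd : 1 ≤ d) :
    (100 / 9 : ℝ) * (1 + 8 * n * d ^ 2) < 5 ^ (3 + 2 * (Nat.log 2 (n * d) + 1)) := by
  have h₁ : n * d < 2 ^ (Nat.log 2 (n * d) + 1) := Nat.lt_pow_succ_log_self one_lt_two _
  set l := Nat.log 2 (n * d) + 1
  have h₂ : (n * d : ℝ) ≤ 2 ^ l := by exact_mod_cast h₁.le
  have hn' : (2 : ℝ) ≤ n := by exact_mod_cast hn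
  have hd' : (1 : ℝ) ≤ d := by exact_mod_cast hd
  have hnd : (2 : ℝ) ≤ n * d := by nlinarith
  have h₃ : (n * d ^ 2 : ℝ) ≤ (n * d) ^ 2 := by
    rw [mul_pow]
    gcongr
    nlinarith
  have h₄ : ((n * d : ℝ)) ^ 2 ≤ 4 ^ l := by
    calc ((n * d : ℝ)) ^ 2 ≤ (2 ^ l) ^ 2 := by gcongr
      _ = 4 ^ l := by rw [← pow_mul, mul_comm, pow_mul]; norm_num
  have h₅ : (4 : ℝ) ^ l ≤ 25 ^ l := by gcongr; norm_num
  have h₆ : (5 : ℝ) ^ (3 + 2 * l) = 125 * 25 ^ l := by rw [pow_add, pow_mul]; norm_num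
  rw [h₆]
  nlinarith

theorem two_mul_log_ge_one (hn : 2 ≤ n) (hd : 1 ≤ d) : 1 ≤ 2 * Real.log ((n : ℝ) * d) := by
  have h₁ : Real.log 2 ≤ Real.log ((n : ℝ) * d) := by
    refine Real.log_le_log two_pos ?_
    exact_mod_cast hn.trans (Nat.le_mul_of_pos_right n hd)
  linarith [Real.log_two_gt_d9]

theorem natLog_le_two_mul_log (hn : 2 ≤ n) (hd : 1 ≤ d) :
    (Nat.log 2 (n * d) : ℝ) ≤ 2 * Real.log ((n : ℝ) * d) := by
  have h₁ : 2 ^ Nat.log 2 (n * d) ≤ n * d :=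
    Nat.pow_log_le_self 2 (Nat.mul_pos (by omega) hd).ne'
  have h₂ : ((2 : ℝ)) ^ Nat.log 2 (n * d) ≤ n * d := by exact_mod_cast h₁
  have h₃ := Real.log_le_log (by positivity) h₂
  rw [Real.log_pow] at h₃
  have h₄ := Real.log_two_gt_d9
  have h₅ : (0 : ℝ) ≤ Nat.log 2 (n * d) := Nat.cast_nonneg _
  nlinarith

theorem update_runs (hf : Feasible U z T γ) (h : SpectralData U z T Q R μ) [Fact (3 ≤ n + d)] :
    ∃ out, Comp SizeMeasure.trivial (n + d) 111 (update U z T γ) out ∧ 1 ≤ out.value ∧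
      eigenProgress μ 1 + γ / 5 ≤ eigenProgress μ out.value ∧
      eigenProgress μ out.value ≤ eigenProgress μ 1 + γ ∧
      (out.iterations : ℝ) ≤ 14 * Real.log ((n : ℝ) * d) ∧
      (γ / 4 ≤ eigenSlope μ 1 → out.start = 1) ∧
      (eigenSlope μ 1 < γ / 4 → ∃ m t vs, Runs (approxSmallEigenSum U z T) m t vs ∧
        0 < smallSum μ ∧ smallSum μ ≤ m ∧ m ≤ (1 + 8 * n * d ^ 2) * smallSum μ ∧
        out.start = 1 + γ / (2 * m)) := by
  have hn := hf.two_le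
  have hd := hf.one_le
  have hL : 3 ≤ n + d := by omega
  obtain ⟨s, hs, hlo, hhi, hs₁, hs₂⟩ := Comp.updateSetup_eigen (σ := SizeMeasure.trivial)
    (L := n + d) hf h (fun _ _ => trivial) (fun _ => trivial) (Nat.le_add_left _ _)
    (Nat.le_add_right _ _) trivial
  have hlog := two_mul_log_ge_one hn hd
  have hlog' := natLog_le_two_mul_log hn hd
  obtain ⟨β, j, hc, hj, hβ, hβ₁, hβ₂⟩ : ∃ β j, Comp SizeMeasure.trivial (n + d) 73
      (newtonDinkelbach (evalH U z T) (evalDerivH U z T) s.start s.lo s.hi) (β, j) ∧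
      (j : ℝ) ≤ 14 * Real.log ((n : ℝ) * d) ∧ 1 ≤ β ∧
      eigenProgress μ 1 + γ / 5 ≤ eigenProgress μ β ∧
      eigenProgress μ β ≤ eigenProgress μ 1 + γ := by
    rw [newtonDinkelbach, hlo, hhi]
    rcases le_or_gt (γ / 4) (eigenSlope μ 1) with hge | hlt
    · rw [hs₁ hge]
      obtain ⟨β, j, hc, hj, hβ⟩ := Cost.newtonDinkelbach_of_le_slope hf h hge
      refine ⟨β, j, Cost.comp (k := 2) (e := 70) (e' := 3) (hc.mono le_rfl (Nat.zero_le _)) ?_,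
        ?_, hβ⟩
      · have := Nat.pow_le_pow_left hL 3
        omega
      · have : (j : ℝ) ≤ 1 := by exact_mod_cast hj
        linarith
    · obtain ⟨m, -, hpos, hm, hm', hstart⟩ := hs₂ hlt
      have hm0 : 0 < m := by linarith
      have hα : 1 ≤ 1 + γ / (2 * m) := by
        have := div_pos hf.margin_pos (mul_pos two_pos hm0)
        linarith
      rw [hstart]
      obtain ⟨β, j, hc, hj, hβ⟩ := Cost.newtonDinkelbach_of_slope_lt hf h
        (3 + 2 * (Nat.log 2 (n * d) + 1)) _ 0 hα
        (eigenProgress_start_le h.nonneg h.le_one hf.margin_pos hlt hm0 hm)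
        (fun _ => by
          refine (eigenSlope_start_le h.nonneg h.le_one hf.margin_pos hlt hm0 hm).trans_lt ?_
          have := mul_lt_mul_of_pos_left (slope_bound_lt_pow hn hd) hpos
          linarith)
      refine ⟨β, j, Cost.comp (e := 70) (e' := 3) (hc.mono le_rfl (Nat.zero_le _)) ?_, ?_, hβ⟩
      · have h₁ := Nat.log_le_self 2 (n * d)
        have h₂ := three_mul_pow_le (L := n + d) 2
        nlinarith
      -- The constant 5 is at most 10 log(nd), and twice the binary logarithm is at most 4 log(nd);
      -- hence 14.
      · have : (j : ℝ) ≤ 3 + 2 * (Nat.log 2 (n * d) + 1) := by exact_mod_cast (by omega)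
        linarith
  refine ⟨{ start := s.start, iterations := j, value := β }, ?_, hβ, hβ₁, hβ₂, hj, hs₁,
    fun hlt => ?_⟩
  · unfold update
    refine hs.bind (e := 110) (Comp.mono (e := 74) ?_)
    exact hc.bind (Comp.ret _ 73)
  · obtain ⟨m, ⟨t, vs, hr, -, -⟩, hm⟩ := hs₂ hlt
    exact ⟨m, t, vs, hr, hm⟩

theorem HasBits.mono {b c : ℕ} {x : ℝ} (hx : HasBits b x) (h : b ≤ c) : HasBits c x := by
  obtain ⟨q, hq, hb⟩ := hx
  exact ⟨q, hq, hb.trans h⟩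

/-- A fraction of size s has at most 2s + 3 ≤ 5s bits for s ≥ 1, which is why C ≥ 5 is required. -/
theorem Comp.hasBits {L e C k : ℕ} {α : Type} {p : Prog ℝ α} {a : α}
    (h : Comp SizeMeasure.fraction L e p a) (hL : 1 ≤ L) (hC : 5 ≤ C) (hk : e ≤ k) :
    ∃ t vs, Runs p a t vs ∧ ∀ v ∈ vs, HasBits (C * L ^ k) v := by
  obtain ⟨t, vs, hr, -, hv⟩ := h
  refine ⟨t, vs, hr, fun v hm => (IsSized.hasBits (hv v hm)).mono ?_⟩
  have h₁ := Nat.pow_le_pow_right hL hk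
  have h₂ := Nat.one_le_pow e L hL
  nlinarith

end Update

end FrameScaling

theorem mainTheorem6 :
    ∃ C k : ℕ, ∀ (d n : ℕ) (U : Matrix (Fin d) (Fin n) ℝ) (z : Fin n → ℝ) (T : Finset (Fin n))
      (γ : ℝ), Feasible U z T γ →
      -- correctness, number of instructions, number of iterations, starting point
      (∃ (out : UpdateOutput ℝ) (t : ℕ) (vs : List ℝ), Runs (update U z T γ) out t vs ∧
        1 ≤ out.value ∧
        γ / 5 ≤ progress U z T out.value - progress U z T 1 ∧
        progress U z T out.value - progress U z T 1 ≤ γ ∧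
        t ≤ C * (n + d) ^ k ∧
        (out.iterations : ℝ) ≤ C * Real.log ((n : ℝ) * d) ∧
        (γ / 4 ≤ deriv (progress U z T) 1 → out.start = 1) ∧
        (deriv (progress U z T) 1 < γ / 4 →
          ∃ (μ : ℝ) (t' : ℕ) (vs' : List ℝ), Runs (approxSmallEigenSum U z T) μ t' vs' ∧
            0 < smallEigenSum U z T ∧
            smallEigenSum U z T ≤ μ ∧
            μ ≤ (1 + 8 * n * d ^ 2) * smallEigenSum U z T ∧
            out.start = 1 + γ / (2 * μ))) ∧
      -- bit lengths of all intermediate numbers, for rational data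
      (∀ b : ℕ, (∀ i j, HasBits b (U i j)) → (∀ j, HasBits b (z j)) →
        (HasBits b γ →
          ∃ (s : NDInput ℝ) (t : ℕ) (vs : List ℝ), Runs (updateSetup U z T γ) s t vs ∧
            ∀ v ∈ vs, HasBits (C * (n + d + b) ^ k) v) ∧
        (∀ (α lo hi : ℝ) (i : ℕ), 1 ≤ α → HasBits b α → HasBits b lo → HasBits b hi →
          ∃ (r : (ℝ × ℕ) ⊕ (ℝ × ℕ)) (t : ℕ) (vs : List ℝ),
            Runs (ndStep (evalH U z T) (evalDerivH U z T) lo hi (α, i)) r t vs ∧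
            ∀ v ∈ vs, HasBits (C * (n + d + b) ^ k) v)) := by
  -- 14 comes from the iteration count, 111 is the exponent of the whole update.
  refine ⟨14, 111, fun d n U z T γ hf => ?_⟩
  obtain ⟨Q, R, μ, h⟩ := exists_spectralData hf.rank_eq hf.scaling_pos T
  have hn := hf.two_le
  have hd := hf.one_le
  refine ⟨?_, fun b hU hz => ?_⟩
  · have : Fact (3 ≤ n + d) := ⟨by omega⟩
    obtain ⟨out, ⟨t, vs, hr, ht, -⟩, h₁, h₂, h₃, h₄, h₅, h₆⟩ := update_runs hf h
    rw [h.deriv_progress, h.smallEigenSum_eq, h.progress_eq one_pos]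
    refine ⟨out, t, vs, hr, h₁, ?_⟩
    rw [h.progress_eq (zero_lt_one.trans_le h₁)]
    exact ⟨by linarith, by linarith, by omega, by exact_mod_cast h₄, h₅, h₆⟩
  · have hL : Fact (3 ≤ n + d + b) := ⟨by omega⟩
    have hsize : ∀ x, HasBits b x → SizeMeasure.fraction.holds ((n + d + b) ^ 1) x :=
      fun x hx => hx.isSized.mono (by rw [pow_one]; omega)
    refine ⟨fun hγ => ?_, fun α lo hi i hα₁ hα _ hhi => ?_⟩
    · obtain ⟨s, hs, -⟩ := Comp.updateSetup_eigen (σ := SizeMeasure.fraction) (L := n + d + b) hf h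
        (fun i j => hsize _ (hU i j)) (fun j => hsize _ (hz j)) (by omega) (by omega) (hsize _ hγ)
      exact ⟨s, hs.hasBits (by omega) (by omega) (by omega)⟩
    · obtain ⟨r, hr, -⟩ := Comp.ndStep_eigen (σ := SizeMeasure.fraction) (L := n + d + b) hf h
        (lo := lo) hα₁ (fun i j => hsize _ (hU i j)) (fun j => hsize _ (hz j)) (by omega)
        (by omega) (hsize _ hα) (hsize _ hhi) i
      exact ⟨r, hr.hasBits (by omega) (by omega) (by omega)⟩
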